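/- **Theorem (Rewriting of the VEM).** Let $\Omega\subset\mathbb R^2$ be open and let $\mathcal T_h$ be a finite conforming mesh of $\Omega$ by disjoint open simple polygons (flat angles at vertices allowed) with $\overline\Omega=\bigcup_K\overline K$ and $K\subset\Omega$. Assume that for some $\gamma\in(0,1]$ every $K$ is star-shaped with respect to a ball $B(K)$ of radius at least $\gamma h_K$ ($h_K=\operatorname{diam}K$) and every edge of $K$ has length at least $\gamma h_K$. Let $\widetilde{\mathcal T}^K$ be the triangulation of $K$ obtained by joining the centre of $B(K)$ with the vertices of $K$. Let $p\ge2$ and $$V_h(K)=\{v\in H^1(K):\ \Delta v\in\mathbb P_{p-2}(K),\ v|_{\partial K}\in C^0(\partial K),\ v|_e\in\mathbb P_p(e)\ \text{for every edge } e\subset\partial K\},$$ $$V_h=\{v\in H^1(\Omega):\ v|_K\in V_h(K)\ \text{for all } K\in\mathcal T_h\}.$$ For every $K$ let $S^K$ be a bilinear form on $V_h(K)$ such that $S^K(1,1)>0$ and, for some $0<\alpha_*<\alpha^*$, $\alpha_*\|\nabla v\|_K^2\le S^K(v,v)\le\alpha^*\|\nabla v\|_K^2$ for all $v\in V_h(K)$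 with $\int_Kv=0$. For each $v\in V_h(K)$ there is a unique $\Pi^\nabla_pv\in\mathbb P_p(K)$ with $(\nabla(v-\Pi^\nabla_pv),\nabla q)_K=0$ for all $q\in\mathbb P_p(K)$ and $S^K(v-\Pi^\nabla_pv,1)=0$. Put $$a_h^K(\varphi,v)=(\nabla\Pi^\nabla_p\varphi,\nabla\Pi^\nabla_pv)_K+S^K((I-\Pi^\nabla_p)\varphi,(I-\Pi^\nabla_p)v),\qquad a_h(\varphi,v)=\sum_{K\in\mathcal T_h}a_h^K(\varphi|_K,v|_K).$$ Let $k\in\{p,p+1\}$, and let $\mathbb{RT}_k(\widetilde{\mathcal T}^K)$ be the fields which on each triangle are of the form $\boldsymbol a+b\,\boldsymbol x$ with $\boldsymbol a\in[\mathbb P_k]^2$, $b\in\mathbb P_k$. For $\varphi\in V_h(K)$ define $$\mathfrak G_h^K(\varphi)=\nabla(\Pi^\nabla_p\varphi-\mathcal S_h^K(\varphi))+\boldsymbol\theta_h^K(\varphi),$$ where $\mathcal S_h^K(\varphi)\in\mathbb P_p(K)$ satisfies $(\nabla\mathcal S_h^K(\varphi),\nabla q)_K=S^K((I-\Pi^\nabla_p)\varphi,q)$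 for all $q\in\mathbb P_p(K)$; the pair consisting of $\mu\in C^0(\partial K)$, a polynomial of degree at most $p$ on every edge, and $r\in\mathbb P_{p-2}(K)$ satisfies $S^K((I-\Pi^\nabla_p)\varphi,v)=(\mu,v)_{\partial K}-(r,v)_K$ for all $v\in V_h(K)$; and $\boldsymbol\theta_h^K(\varphi)$ has minimal norm $\|\cdot\|_K$ among all $\boldsymbol\tau\in\mathbb{RT}_k(\widetilde{\mathcal T}^K)\cap\boldsymbol H(\mathrm{div},K)$ with $\boldsymbol\tau\cdot\boldsymbol n=\mu$ on $\partial K$ and $\operatorname{div}\boldsymbol\tau=r$ in $K$. Then, for every $K\in\mathcal T_h$ and $\varphi\in V_h(K)$, such a field $\mathfrak G_h^K(\varphi)$ exists, and every such field belongs to $\mathbb{RT}_k(\widetilde{\mathcal T}^K)$ and satisfies $$a_h^K(\varphi,v)=(\mathfrak G_h^K(\varphi),\nabla v)_K\qquad\text{for all } v\in V_h(K).$$ Likewise, for every $\varphi\in V_h$ there is a field $\mathfrak G_h(\varphi)\in L^2(\Omega)^2$ with $\mathfrak G_h(\varphi)|_K=\mathfrak G_h^K(\varphi|_K)$ for all $K$,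 and every such field is piecewise in $\mathbb{RT}_k$ over the union of the triangulations $\widetilde{\mathcal T}^K$ and satisfies $$a_h(\varphi,v)=(\mathfrak G_h(\varphi),\nabla v)_\Omega\qquad\text{for all } v\in V_h.$$ -/

import Mathlib

open MeasureTheory Filter Topology
open scoped ContDiff ENNReal

noncomputable section

namespace VEM

/-- The Euclidean plane. -/
abbrev Plane := EuclideanSpace ℝ (Fin 2)

/-! ### Polynomials in the plane -/

/-- Bivariate polynomials of total degree at most `q`. -/
abbrev PolyDeg (q : ℕ) : Submodule ℝ (MvPolynomial (Fin 2) ℝ) :=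
  MvPolynomial.restrictTotalDegree (Fin 2) ℝ q

/-- The function on the plane given by a bivariate polynomial. -/
def polyFun (q : MvPolynomial (Fin 2) ℝ) (x : Plane) : ℝ :=
  MvPolynomial.eval (fun i => x i) q

theorem hasFDerivAt_polyFun (q : MvPolynomial (Fin 2) ℝ) (x : Plane) :
    HasFDerivAt (polyFun q)
      (∑ i, polyFun (MvPolynomial.pderiv i q) x • (EuclideanSpace.proj i : Plane →L[ℝ] ℝ)) x := by
  induction q using MvPolynomial.induction_on with
  | C a =>
    have h : polyFun (MvPolynomial.C a) = fun _ => a := by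
      funext y; simp [polyFun]
    rw [h]
    simpa [polyFun] using hasFDerivAt_const a x
  | add f g hf hg =>
    have h : polyFun (f + g) = fun y => polyFun f y + polyFun g y := by
      funext y; simp [polyFun]
    rw [h]
    refine (hf.fun_add hg).congr_fderiv ?_
    ext y
    simp [polyFun, add_mul]
    ring
  | mul_X f j hf =>
    have h : polyFun (f * MvPolynomial.X j) = fun y => polyFun f y * y j := by
      funext y; simp [polyFun]
    rw [h]
    refine (hf.fun_mul (EuclideanSpace.proj j : Plane →L[ℝ] ℝ).hasFDerivAt).congr_fderiv ?_
    ext y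
    fin_cases j <;>
      simp [polyFun, MvPolynomial.pderiv_X, Pi.single_apply] <;> ring

theorem contDiff_polyFun (q : MvPolynomial (Fin 2) ℝ) : ContDiff ℝ ∞ (polyFun q) := by
  induction q using MvPolynomial.induction_on with
  | C a =>
    have h : polyFun (MvPolynomial.C a) = fun _ => a := by
      funext y; simp [polyFun]
    rw [h]; exact contDiff_const
  | add f g hf hg =>
    have h : polyFun (f + g) = fun y => polyFun f y + polyFun g y := by
      funext y; simp [polyFun]
    rw [h]; exact hf.add hg
  | mul_X f j hf =>
    have h : polyFun (f * MvPolynomial.X j) = fun y => polyFun f y * y j := by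
      funext y; simp [polyFun]
    rw [h]
    exact hf.mul (EuclideanSpace.proj j : Plane →L[ℝ] ℝ).contDiff

theorem gradient_apply (f : Plane → ℝ) (x : Plane) (i : Fin 2) :
    gradient f x i = fderiv ℝ f x (EuclideanSpace.single i 1) := by
  rw [← inner_gradient_left, PiLp.inner_apply]
  fin_cases i <;> simp

theorem gradient_polyFun (q : MvPolynomial (Fin 2) ℝ) (x : Plane) (i : Fin 2) :
    gradient (polyFun q) x i = polyFun (MvPolynomial.pderiv i q) x := by
  rw [gradient_apply, (hasFDerivAt_polyFun q x).fderiv]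
  fin_cases i <;> simp

theorem totalDegree_pderiv (q : MvPolynomial (Fin 2) ℝ) (i : Fin 2) (n : ℕ)
    (h : q.totalDegree ≤ n) : (MvPolynomial.pderiv i q).totalDegree ≤ n - 1 := by
  rw [MvPolynomial.totalDegree_eq] at h ⊢
  refine Finset.sup_le fun s hs => ?_
  rw [MvPolynomial.mem_support_iff, MvPolynomial.coeff_pderiv] at hs
  have h2 := (Finset.sup_le_iff.mp h) (s + Finsupp.single i 1) (by
    rw [MvPolynomial.mem_support_iff]
    intro h0
    simp [h0] at hs)
  simp only [map_add, Multiset.card_add, Finsupp.toMultiset_single, Multiset.card_nsmul,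
    Multiset.card_singleton] at h2
  omega

/-! ### Sobolev spaces -/

/-- `C_c^∞(D)`: smooth functions whose support is compact and contained in `D`. -/
def IsTestFun (D : Set Plane) (ψ : Plane → ℝ) : Prop :=
  ContDiff ℝ ∞ ψ ∧ HasCompactSupport ψ ∧ tsupport ψ ⊆ D

/-- `L²(D)` for scalar functions. -/
abbrev L2 (D : Set Plane) := Lp ℝ 2 (volume.restrict D)

/-- `L²(D)²`. -/
abbrev L2Vec (D : Set Plane) := Lp Plane 2 (volume.restrict D)

/-- `g` is the weak gradient of `u` in `D`. -/
def HasWeakGrad (D : Set Plane) (u : Plane → ℝ) (g : Plane → Plane) : Prop :=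
  ∀ ψ : Plane → ℝ, IsTestFun D ψ → ∀ i : Fin 2,
    ∫ x in D, u x * gradient ψ x i = - ∫ x in D, g x i * ψ x

theorem IsTestFun.continuous_gradient {D : Set Plane} {ψ : Plane → ℝ} (h : IsTestFun D ψ)
    (i : Fin 2) : Continuous fun x => gradient ψ x i := by
  simp only [gradient_apply]
  exact (h.1.continuous_fderiv (by simp)).clm_apply continuous_const

theorem IsTestFun.compact_gradient {D : Set Plane} {ψ : Plane → ℝ} (h : IsTestFun D ψ)
    (i : Fin 2) : HasCompactSupport fun x => gradient ψ x i := by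
  simp only [gradient_apply]
  exact h.2.1.fderiv_apply (𝕜 := ℝ) _

theorem integrable_L2_mul {D : Set Plane} (u : L2 D) {f : Plane → ℝ} (hf : Continuous f)
    (hc : HasCompactSupport f) : IntegrableOn (fun x => u x * f x) D := by
  have h := ((Lp.memLp u).locallyIntegrable (by norm_num)).integrable_smul_left_of_hasCompactSupport
    hf hc
  simpa [IntegrableOn, mul_comm] using h

theorem integrable_L2Vec_mul {D : Set Plane} (g : L2Vec D) {f : Plane → ℝ} (hf : Continuous f)
    (hc : HasCompactSupport f) (i : Fin 2) : IntegrableOn (fun x => g x i * f x) D := by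
  have h := ((Lp.memLp g).locallyIntegrable (by norm_num)).integrable_smul_left_of_hasCompactSupport
    hf hc
  have h2 := (EuclideanSpace.proj i : Plane →L[ℝ] ℝ).integrable_comp h
  simpa [IntegrableOn, mul_comm] using h2

/-- `H¹(D)`, realised as the space of pairs `(u, ∇u)` in `L²(D) × L²(D)²`; the weak gradient is
determined by `u` when `D` is open. -/
def H1 (D : Set Plane) : Submodule ℝ (L2 D × L2Vec D) where
  carrier := {v | HasWeakGrad D v.1 v.2}
  zero_mem' := by
    intro ψ hψ i
    have h1 : ∫ x in D, (0 : L2 D) x * gradient ψ x i = 0 := by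
      apply integral_eq_zero_of_ae
      filter_upwards [Lp.coeFn_zero ℝ 2 (volume.restrict D)] with x hx
      simp only [hx, Pi.zero_apply, zero_mul]
    have h2 : ∫ x in D, (0 : L2Vec D) x i * ψ x = 0 := by
      apply integral_eq_zero_of_ae
      filter_upwards [Lp.coeFn_zero Plane 2 (volume.restrict D)] with x hx
      simp only [hx, Pi.zero_apply, PiLp.zero_apply, zero_mul]
    simp only [Prod.fst_zero, Prod.snd_zero, h1, h2, neg_zero]
  add_mem' := by
    intro v w hv hw ψ hψ i
    have h1 : ∫ x in D, (v.1 + w.1 : L2 D) x * gradient ψ x i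
        = (∫ x in D, v.1 x * gradient ψ x i) + ∫ x in D, w.1 x * gradient ψ x i := by
      rw [← integral_add (integrable_L2_mul _ (hψ.continuous_gradient i) (hψ.compact_gradient i))
        (integrable_L2_mul _ (hψ.continuous_gradient i) (hψ.compact_gradient i))]
      apply integral_congr_ae
      filter_upwards [Lp.coeFn_add v.1 w.1] with x hx
      simp only [hx, Pi.add_apply, add_mul]
    have h2 : ∫ x in D, (v.2 + w.2 : L2Vec D) x i * ψ x
        = (∫ x in D, v.2 x i * ψ x) + ∫ x in D, w.2 x i * ψ x := by
      rw [← integral_add (integrable_L2Vec_mul _ hψ.1.continuous hψ.2.1 i)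
        (integrable_L2Vec_mul _ hψ.1.continuous hψ.2.1 i)]
      apply integral_congr_ae
      filter_upwards [Lp.coeFn_add v.2 w.2] with x hx
      simp only [hx, Pi.add_apply, PiLp.add_apply, add_mul]
    simp only [Prod.fst_add, Prod.snd_add, h1, h2]
    rw [hv ψ hψ i, hw ψ hψ i]; ring
  smul_mem' := by
    intro c v hv ψ hψ i
    have h1 : ∫ x in D, (c • v.1 : L2 D) x * gradient ψ x i
        = c * ∫ x in D, v.1 x * gradient ψ x i := by
      rw [← integral_const_mul]
      apply integral_congr_ae
      filter_upwards [Lp.coeFn_smul c v.1] with x hx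
      simp only [hx, Pi.smul_apply, smul_eq_mul, mul_assoc]
    have h2 : ∫ x in D, (c • v.2 : L2Vec D) x i * ψ x = c * ∫ x in D, v.2 x i * ψ x := by
      rw [← integral_const_mul]
      apply integral_congr_ae
      filter_upwards [Lp.coeFn_smul c v.2] with x hx
      simp only [hx, Pi.smul_apply, PiLp.smul_apply, smul_eq_mul, mul_assoc]
    simp only [Prod.smul_fst, Prod.smul_snd, h1, h2]
    rw [hv ψ hψ i]; ring

/-- The underlying `L²` function of an element of `H¹(D)`. -/
def H1val {D : Set Plane} (v : H1 D) : L2 D := v.1.1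

/-- The weak gradient of an element of `H¹(D)`. -/
def H1grad {D : Set Plane} (v : H1 D) : L2Vec D := v.1.2

/-- Restriction of `L²` functions to a smaller set. -/
def restrictLp {E : Type*} [NormedAddCommGroup E] {D D' : Set Plane} (h : D' ⊆ D)
    (f : Lp E 2 (volume.restrict D)) : Lp E 2 (volume.restrict D') :=
  ((Lp.memLp f).mono_measure (Measure.restrict_mono h le_rfl)).toLp f

theorem coeFn_restrictLp {E : Type*} [NormedAddCommGroup E] {D D' : Set Plane} (h : D' ⊆ D)
    (f : Lp E 2 (volume.restrict D)) : restrictLp h f =ᵐ[volume.restrict D'] f :=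
  MemLp.coeFn_toLp _

theorem IsTestFun.mono {D D' : Set Plane} (h : D' ⊆ D) {ψ : Plane → ℝ} (hψ : IsTestFun D' ψ) :
    IsTestFun D ψ :=
  ⟨hψ.1, hψ.2.1, hψ.2.2.trans h⟩

theorem gradient_eq_zero_of_notMem {ψ : Plane → ℝ} {x : Plane} (hx : x ∉ tsupport ψ) :
    gradient ψ x = 0 := by
  have : fderiv ℝ ψ x = 0 := by
    by_contra h
    exact hx (support_fderiv_subset ℝ h)
  simp [gradient, this]

/-- Restriction `v ↦ v|_{D'}` of `H¹` functions to a smaller open set. -/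
def H1restr {D D' : Set Plane} (h : D' ⊆ D) (v : H1 D) : H1 D' :=
  ⟨((restrictLp h (H1val v)), restrictLp h (H1grad v)), by
    intro ψ hψ i
    have h1 : ∫ x in D', (restrictLp h (H1val v)) x * gradient ψ x i
        = ∫ x in D, (H1val v) x * gradient ψ x i := by
      rw [integral_congr_ae (g := fun x => (H1val v) x * gradient ψ x i)]
      · rw [setIntegral_eq_integral_of_forall_compl_eq_zero,
          setIntegral_eq_integral_of_forall_compl_eq_zero]
        · intro x hx
          rw [gradient_eq_zero_of_notMem fun hx' => hx (h (hψ.2.2 hx'))]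
          simp
        · intro x hx
          rw [gradient_eq_zero_of_notMem fun hx' => hx (hψ.2.2 hx')]
          simp
      · filter_upwards [coeFn_restrictLp h (H1val v)] with x hx
        simp [hx]
    have h2 : ∫ x in D', restrictLp h (H1grad v) x i * ψ x = ∫ x in D, (H1grad v) x i * ψ x := by
      rw [integral_congr_ae (g := fun x => (H1grad v) x i * ψ x)]
      · rw [setIntegral_eq_integral_of_forall_compl_eq_zero,
          setIntegral_eq_integral_of_forall_compl_eq_zero]
        · intro x hx
          rw [image_eq_zero_of_notMem_tsupport fun hx' => hx (h (hψ.2.2 hx'))]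
          simp
        · intro x hx
          rw [image_eq_zero_of_notMem_tsupport fun hx' => hx (hψ.2.2 hx')]
          simp
      · filter_upwards [coeFn_restrictLp h (H1grad v)] with x hx
        simp [hx]
    change ∫ x in D', (restrictLp h (H1val v)) x * gradient ψ x i
      = - ∫ x in D', restrictLp h (H1grad v) x i * ψ x
    rw [h1, h2]
    exact v.2 ψ (hψ.mono h) i⟩

theorem integral_by_parts {D : Set Plane} {w ψ : Plane → ℝ}
    (hw : ContDiff ℝ ∞ w) (hψ : IsTestFun D ψ) (i : Fin 2) :
    ∫ x in D, w x * gradient ψ x i = - ∫ x in D, gradient w x i * ψ x := by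
  have cw : Continuous fun x => gradient w x i := by
    simp only [gradient_apply]
    exact (hw.continuous_fderiv (by simp)).clm_apply continuous_const
  have e1 : ∫ x in D, w x * gradient ψ x i = ∫ x, w x * gradient ψ x i := by
    refine setIntegral_eq_integral_of_forall_compl_eq_zero ?_
    intro x hx
    rw [gradient_eq_zero_of_notMem fun hx' => hx (hψ.2.2 hx')]
    simp
  have e2 : ∫ x in D, gradient w x i * ψ x = ∫ x, gradient w x i * ψ x := by
    refine setIntegral_eq_integral_of_forall_compl_eq_zero ?_
    intro x hx
    rw [image_eq_zero_of_notMem_tsupport fun hx' => hx (hψ.2.2 hx')]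
    simp
  rw [e1, e2]
  have i1 : Integrable (fun x => gradient w x i * ψ x) :=
    (cw.mul hψ.1.continuous).integrable_of_hasCompactSupport hψ.2.1.mul_left
  have i2 : Integrable (fun x => w x * gradient ψ x i) :=
    (hw.continuous.mul (hψ.continuous_gradient i)).integrable_of_hasCompactSupport
      (hψ.compact_gradient i).mul_left
  have i3 : Integrable (fun x => w x * ψ x) :=
    (hw.continuous.mul hψ.1.continuous).integrable_of_hasCompactSupport hψ.2.1.mul_left
  simp only [gradient_apply] at i1 i2 ⊢
  exact integral_mul_fderiv_eq_neg_fderiv_mul_of_integrable i1 i2 i3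
    (fun x _ => (hw.differentiable (by simp)) x) (fun x _ => (hψ.1.differentiable (by simp)) x)

theorem continuous_gradient {w : Plane → ℝ} (hw : ContDiff ℝ ∞ w) : Continuous (gradient w) :=
  (InnerProductSpace.toDual ℝ Plane).symm.continuous.comp (hw.continuous_fderiv (by simp))

theorem memLp_of_continuous {E : Type*} [NormedAddCommGroup E] [SecondCountableTopology E]
    {D : Set Plane} (hm : MeasurableSet D)
    (hb : Bornology.IsBounded D) {f : Plane → E} (hf : Continuous f) :
    MemLp f 2 (volume.restrict D) := by
  have : IsFiniteMeasure (volume.restrict D) :=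
    ⟨by rw [Measure.restrict_apply_univ]; exact hb.measure_lt_top⟩
  obtain ⟨C, hC⟩ := hb.isCompact_closure.exists_bound_of_continuousOn hf.continuousOn
  refine MemLp.of_bound hf.aestronglyMeasurable C ?_
  filter_upwards [ae_restrict_mem hm] with x hx
  exact hC x (subset_closure hx)

/-- The element of `H¹(D)` given by a smooth function on the plane, for bounded `D`. -/
def smoothH1 {D : Set Plane} (hm : MeasurableSet D) (hb : Bornology.IsBounded D) (w : Plane → ℝ)
    (hw : ContDiff ℝ ∞ w) : H1 D :=
  ⟨((memLp_of_continuous hm hb hw.continuous).toLp w,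
    (memLp_of_continuous hm hb (continuous_gradient hw)).toLp (gradient w)), by
    intro ψ hψ i
    have h1 : ∫ x in D, (memLp_of_continuous hm hb hw.continuous).toLp w x * gradient ψ x i
        = ∫ x in D, w x * gradient ψ x i := by
      apply integral_congr_ae
      filter_upwards [MemLp.coeFn_toLp (memLp_of_continuous hm hb hw.continuous)] with x hx
      simp only [hx]
    have h2 : ∫ x in D,
        (memLp_of_continuous hm hb (continuous_gradient hw)).toLp (gradient w) x i * ψ x
        = ∫ x in D, gradient w x i * ψ x := by
      apply integral_congr_ae
      filter_upwards [MemLp.coeFn_toLp (memLp_of_continuous hm hb (continuous_gradient hw))]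
        with x hx
      simp only [hx]
    simp only [h1, h2]
    exact integral_by_parts hw hψ i⟩

/-! ### Polygonal elements and meshes -/

/-- An open polygon whose boundary is the simple closed polygonal curve through the listed vertices,
star-shaped with respect to a given ball. Flat angles at vertices are allowed. -/
structure PolygonalElement where
  /-- The polygon has `m + 3` vertices. -/
  m : ℕ
  carrier : Set Plane
  isOpen : IsOpen carrier
  bounded : Bornology.IsBounded carrier
  vertex : Fin (m + 3) → Plane
  vertex_injective : Function.Injective vertex
  frontier_eq : frontier carrier = ⋃ i, segment ℝ (vertex i) (vertex (i + 1))
  simple : ∀ i j, i ≠ j →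
    segment ℝ (vertex i) (vertex (i + 1)) ∩ segment ℝ (vertex j) (vertex (j + 1)) ⊆
      {vertex i, vertex (i + 1)} ∩ {vertex j, vertex (j + 1)}
  /-- Centre of the ball. -/
  centre : Plane
  /-- Radius of the ball. -/
  radius : ℝ
  radius_pos : 0 < radius
  starShaped : ∀ y ∈ Metric.ball centre radius, StarConvex ℝ y carrier

namespace PolygonalElement

variable (K : PolygonalElement)

/-- The `i`-th (closed) edge. -/
def edge (i : Fin (K.m + 3)) : Set Plane := segment ℝ (K.vertex i) (K.vertex (i + 1))

/-- The affine parametrisation of the `i`-th edge over `[0,1]`. -/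
def edgeMap (i : Fin (K.m + 3)) (t : ℝ) : Plane :=
  AffineMap.lineMap (K.vertex i) (K.vertex (i + 1)) t

/-- The length of the `i`-th edge. -/
def edgeLength (i : Fin (K.m + 3)) : ℝ := dist (K.vertex i) (K.vertex (i + 1))

/-- The `i`-th open triangle of the subtriangulation obtained by joining the centre of the ball
with the vertices. -/
def subTriangle (i : Fin (K.m + 3)) : Set Plane :=
  interior (convexHull ℝ {K.centre, K.vertex i, K.vertex (i + 1)})

/-- `L²(∂K)` inner product of two functions on `∂K`, each given on the edges through the affine
parametrisation. -/
def boundaryInner (f g : Fin (K.m + 3) → ℝ → ℝ) : ℝ :=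
  ∑ i, K.edgeLength i * ∫ t in (0 : ℝ)..1, f i t * g i t

/-- The restriction to `∂K` of a function on the plane, in the edge parametrisation. -/
def onBoundary (w : Plane → ℝ) (i : Fin (K.m + 3)) (t : ℝ) : ℝ := w (K.edgeMap i t)

/-- Continuous functions on `∂K` which are polynomials of degree at most `p` on every edge, in the
edge parametrisation. -/
def boundaryPoly (p : ℕ) : Submodule ℝ (Fin (K.m + 3) → Polynomial ℝ) where
  carrier := {q | ∀ i, (q i).natDegree ≤ p ∧ (q i).eval 1 = (q (i + 1)).eval 0}
  zero_mem' := by simp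
  add_mem' := by
    intro a b ha hb i
    refine ⟨(Polynomial.natDegree_add_le _ _).trans (max_le (ha i).1 (hb i).1), ?_⟩
    simp [(ha i).2, (hb i).2]
  smul_mem' := by
    intro c a ha i
    refine ⟨(Polynomial.natDegree_smul_le _ _).trans (ha i).1, ?_⟩
    simp [(ha i).2]

/-- The function on `∂K` given by polynomials in the edge parametrisation. -/
def polyOnBoundary {K : PolygonalElement} (q : Fin (K.m + 3) → Polynomial ℝ)
    (i : Fin (K.m + 3)) (t : ℝ) : ℝ := (q i).eval t

/-- `g` is the trace of `v ∈ H¹(K)` on `∂K`: some sequence of functions that are smooth up to the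
boundary converges to `v` in `H¹(K)` while its restrictions to `∂K` converge to `g` in
`L²(∂K)`. -/
def IsTrace (v : H1 K.carrier) (g : Fin (K.m + 3) → ℝ → ℝ) : Prop :=
  ∃ w : ℕ → Plane → ℝ, (∀ n, ContDiff ℝ ∞ (w n)) ∧
    Tendsto (fun n => eLpNorm (fun x => w n x - (H1val v) x) 2 (volume.restrict K.carrier))
      atTop (𝓝 0) ∧
    Tendsto (fun n => eLpNorm (fun x => gradient (w n) x - (H1grad v) x) 2
      (volume.restrict K.carrier)) atTop (𝓝 0) ∧
    ∀ i, Tendsto (fun n => eLpNorm (fun t => K.onBoundary (w n) i t - g i t) 2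
      (volume.restrict (Set.Icc (0 : ℝ) 1))) atTop (𝓝 0)

/-- The distributional Laplacian of `v ∈ H¹(K)` is the function `f`. -/
def HasWeakLaplacian (v : H1 K.carrier) (f : Plane → ℝ) : Prop :=
  ∀ ψ : Plane → ℝ, IsTestFun K.carrier ψ →
    ∫ x in K.carrier, inner ℝ ((H1grad v) x) (gradient ψ x) = - ∫ x in K.carrier, f x * ψ x

variable {K}

theorem IsTrace.zero : K.IsTrace 0 0 := by
  have hg : gradient (fun _ : Plane => (0 : ℝ)) = fun _ => 0 := by
    funext x; simp [gradient]
  refine ⟨fun _ _ => 0, fun _ => contDiff_const, ?_, ?_, ?_⟩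
  · have : eLpNorm (fun x => (0 : ℝ) - H1val (0 : H1 K.carrier) x) 2
        (volume.restrict K.carrier) = 0 := by
      rw [eLpNorm_congr_ae (g := fun _ => (0 : ℝ))]
      · exact eLpNorm_zero
      · filter_upwards [Lp.coeFn_zero ℝ 2 (volume.restrict K.carrier)] with x hx
        change 0 - (0 : L2 K.carrier) x = 0
        simp only [hx, Pi.zero_apply, sub_zero]
    simp only [this, tendsto_const_nhds]
  · have : eLpNorm (fun x => (0 : Plane) - H1grad (0 : H1 K.carrier) x) 2
        (volume.restrict K.carrier) = 0 := by
      rw [eLpNorm_congr_ae (g := fun _ => (0 : Plane))]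
      · exact eLpNorm_zero
      · filter_upwards [Lp.coeFn_zero Plane 2 (volume.restrict K.carrier)] with x hx
        change 0 - (0 : L2Vec K.carrier) x = 0
        simp only [hx, Pi.zero_apply, sub_zero]
    simp only [hg, this, tendsto_const_nhds]
  · intro i
    simp [onBoundary]

theorem continuous_edgeMap (i : Fin (K.m + 3)) : Continuous (K.edgeMap i) :=
  AffineMap.lineMap_continuous

theorem tendsto_eLpNorm_add {α E : Type*} [MeasurableSpace α] [NormedAddCommGroup E]
    {μ : Measure α} {a b c : ℕ → α → E} (ha : ∀ n, AEStronglyMeasurable (a n) μ)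
    (hb : ∀ n, AEStronglyMeasurable (b n) μ)
    (hc : ∀ n, c n =ᵐ[μ] a n + b n)
    (h1 : Tendsto (fun n => eLpNorm (a n) 2 μ) atTop (𝓝 0))
    (h2 : Tendsto (fun n => eLpNorm (b n) 2 μ) atTop (𝓝 0)) :
    Tendsto (fun n => eLpNorm (c n) 2 μ) atTop (𝓝 0) := by
  have h := h1.add h2
  rw [add_zero] at h
  refine tendsto_of_tendsto_of_tendsto_of_le_of_le tendsto_const_nhds h (fun _ => zero_le) ?_
  intro n
  simp only [eLpNorm_congr_ae (hc n)]
  exact eLpNorm_add_le (ha n) (hb n) (by norm_num)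

theorem tendsto_eLpNorm_smul {α E : Type*} [MeasurableSpace α] [NormedAddCommGroup E]
    [NormedSpace ℝ E] {μ : Measure α} {a c : ℕ → α → E} (r : ℝ)
    (hc : ∀ n, c n =ᵐ[μ] r • a n)
    (h1 : Tendsto (fun n => eLpNorm (a n) 2 μ) atTop (𝓝 0)) :
    Tendsto (fun n => eLpNorm (c n) 2 μ) atTop (𝓝 0) := by
  have h := ENNReal.Tendsto.const_mul (a := ‖r‖ₑ) h1 (Or.inr (by simp))
  rw [mul_zero] at h
  refine h.congr fun n => ?_
  rw [eLpNorm_congr_ae (hc n), eLpNorm_const_smul]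

theorem gradient_add' {f g : Plane → ℝ} (hf : ContDiff ℝ ∞ f) (hg : ContDiff ℝ ∞ g) (x : Plane) :
    gradient (fun y => f y + g y) x = gradient f x + gradient g x := by
  ext i
  simp only [PiLp.add_apply, gradient_apply]
  rw [fderiv_fun_add (hf.differentiable (by simp) x) (hg.differentiable (by simp) x)]
  rfl

theorem gradient_smul' {f : Plane → ℝ} (hf : ContDiff ℝ ∞ f) (r : ℝ) (x : Plane) :
    gradient (fun y => r * f y) x = r • gradient f x := by
  ext i
  simp only [PiLp.smul_apply, gradient_apply]
  rw [fderiv_const_mul (hf.differentiable (by simp) x)]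
  rfl

theorem IsTrace.add {v w : H1 K.carrier} {f g : Fin (K.m + 3) → ℝ → ℝ}
    (hfc : ∀ i, Continuous (f i)) (hgc : ∀ i, Continuous (g i))
    (hf : K.IsTrace v f) (hg : K.IsTrace w g) : K.IsTrace (v + w) (f + g) := by
  obtain ⟨a, ha, ha1, ha2, ha3⟩ := hf
  obtain ⟨b, hb, hb1, hb2, hb3⟩ := hg
  refine ⟨fun n x => a n x + b n x, fun n => (ha n).add (hb n), ?_, ?_, fun i => ?_⟩
  · refine tendsto_eLpNorm_add
      (fun n => (ha n).continuous.aestronglyMeasurable.sub (Lp.aestronglyMeasurable _))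
      (fun n => (hb n).continuous.aestronglyMeasurable.sub (Lp.aestronglyMeasurable _))
      (fun n => ?_) ha1 hb1
    filter_upwards [Lp.coeFn_add (H1val v) (H1val w)] with x hx
    change a n x + b n x - (H1val v + H1val w : L2 K.carrier) x = _
    rw [hx]
    simp only [Pi.add_apply, Pi.sub_apply]
    ring
  · refine tendsto_eLpNorm_add
      (fun n => (continuous_gradient (ha n)).aestronglyMeasurable.sub (Lp.aestronglyMeasurable _))
      (fun n => (continuous_gradient (hb n)).aestronglyMeasurable.sub (Lp.aestronglyMeasurable _))
      (fun n => ?_) ha2 hb2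
    filter_upwards [Lp.coeFn_add (H1grad v) (H1grad w)] with x hx
    change gradient (fun y => a n y + b n y) x - (H1grad v + H1grad w : L2Vec K.carrier) x = _
    rw [hx, gradient_add' (ha n) (hb n)]
    simp only [Pi.add_apply, Pi.sub_apply]
    abel
  · refine tendsto_eLpNorm_add
      (fun n => (((ha n).continuous.comp (K.continuous_edgeMap i)).sub
        (hfc i)).aestronglyMeasurable)
      (fun n => (((hb n).continuous.comp (K.continuous_edgeMap i)).sub
        (hgc i)).aestronglyMeasurable)
      (fun n => ?_) (ha3 i) (hb3 i)
    refine Eventually.of_forall fun t => ?_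
    change a n (K.edgeMap i t) + b n (K.edgeMap i t) - (f i t + g i t)
      = (a n (K.edgeMap i t) - f i t) + (b n (K.edgeMap i t) - g i t)
    ring

theorem IsTrace.smul {v : H1 K.carrier} {f : Fin (K.m + 3) → ℝ → ℝ} (r : ℝ)
    (hf : K.IsTrace v f) : K.IsTrace (r • v) (r • f) := by
  obtain ⟨a, ha, ha1, ha2, ha3⟩ := hf
  refine ⟨fun n x => r * a n x, fun n => contDiff_const.mul (ha n), ?_, ?_, fun i => ?_⟩
  · refine tendsto_eLpNorm_smul r (fun n => ?_) ha1
    filter_upwards [Lp.coeFn_smul r (H1val v)] with x hx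
    change r * a n x - (r • H1val v : L2 K.carrier) x = _
    rw [hx]
    simp only [Pi.smul_apply, smul_eq_mul]
    ring
  · refine tendsto_eLpNorm_smul r (fun n => ?_) ha2
    filter_upwards [Lp.coeFn_smul r (H1grad v)] with x hx
    change gradient (fun y => r * a n y) x - (r • H1grad v : L2Vec K.carrier) x = _
    rw [hx, gradient_smul' (ha n)]
    simp only [Pi.smul_apply, smul_sub]
  · refine tendsto_eLpNorm_smul r (fun n => ?_) (ha3 i)
    refine Eventually.of_forall fun t => ?_
    simp only [onBoundary, Pi.smul_apply, smul_eq_mul]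
    ring

theorem HasWeakLaplacian.zero : K.HasWeakLaplacian 0 0 := by
  intro ψ hψ
  have h1 : ∫ x in K.carrier, inner ℝ (H1grad (0 : H1 K.carrier) x) (gradient ψ x) = 0 := by
    apply integral_eq_zero_of_ae
    filter_upwards [Lp.coeFn_zero Plane 2 (volume.restrict K.carrier)] with x hx
    change inner ℝ ((0 : L2Vec K.carrier) x) (gradient ψ x) = 0
    rw [hx, Pi.zero_apply, inner_zero_left]
  rw [h1]
  simp only [Pi.zero_apply, zero_mul, integral_zero, neg_zero]

theorem integrable_inner_gradient (v : H1 K.carrier) {ψ : Plane → ℝ}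
    (hψ : IsTestFun K.carrier ψ) :
    IntegrableOn (fun x => inner ℝ (H1grad v x) (gradient ψ x)) K.carrier := by
  have h := (integrable_L2Vec_mul (H1grad v) (hψ.continuous_gradient 0)
    (hψ.compact_gradient 0) 0).add (integrable_L2Vec_mul (H1grad v)
    (hψ.continuous_gradient 1) (hψ.compact_gradient 1) 1)
  refine h.congr (Eventually.of_forall fun x => ?_)
  change _ = inner ℝ (H1grad v x) (gradient ψ x)
  rw [PiLp.inner_apply, Fin.sum_univ_two]
  simp only [Pi.add_apply, RCLike.inner_apply, conj_trivial, mul_comm]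

theorem HasWeakLaplacian.add {v w : H1 K.carrier} {f g : Plane → ℝ} (hfc : Continuous f)
    (hgc : Continuous g) (hf : K.HasWeakLaplacian v f) (hg : K.HasWeakLaplacian w g) :
    K.HasWeakLaplacian (v + w) (f + g) := by
  intro ψ hψ
  have h1 : ∫ x in K.carrier, inner ℝ (H1grad (v + w) x) (gradient ψ x)
      = (∫ x in K.carrier, inner ℝ (H1grad v x) (gradient ψ x))
        + ∫ x in K.carrier, inner ℝ (H1grad w x) (gradient ψ x) := by
    rw [← integral_add (integrable_inner_gradient v hψ) (integrable_inner_gradient w hψ)]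
    apply integral_congr_ae
    filter_upwards [Lp.coeFn_add (H1grad v) (H1grad w)] with x hx
    change inner ℝ ((H1grad v + H1grad w : L2Vec K.carrier) x) (gradient ψ x) = _
    rw [hx, Pi.add_apply, inner_add_left]
  have i1 : IntegrableOn (fun x => f x * ψ x) K.carrier :=
    ((hfc.mul hψ.1.continuous).integrable_of_hasCompactSupport hψ.2.1.mul_left).integrableOn
  have i2 : IntegrableOn (fun x => g x * ψ x) K.carrier :=
    ((hgc.mul hψ.1.continuous).integrable_of_hasCompactSupport hψ.2.1.mul_left).integrableOn
  simp only [Pi.add_apply, add_mul]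
  rw [h1, hf ψ hψ, hg ψ hψ, integral_add i1 i2]
  ring

theorem HasWeakLaplacian.smul {v : H1 K.carrier} {f : Plane → ℝ} (r : ℝ)
    (hf : K.HasWeakLaplacian v f) : K.HasWeakLaplacian (r • v) (r • f) := by
  intro ψ hψ
  have h1 : ∫ x in K.carrier, inner ℝ (H1grad (r • v) x) (gradient ψ x)
      = r * ∫ x in K.carrier, inner ℝ (H1grad v x) (gradient ψ x) := by
    rw [← integral_const_mul]
    apply integral_congr_ae
    filter_upwards [Lp.coeFn_smul r (H1grad v)] with x hx
    change inner ℝ ((r • H1grad v : L2Vec K.carrier) x) (gradient ψ x) = _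
    rw [hx, Pi.smul_apply, real_inner_smul_left]
  simp only [Pi.smul_apply, smul_eq_mul, mul_assoc]
  rw [h1, hf ψ hψ, integral_const_mul]
  ring

/-- The element of `H¹(K)` given by a polynomial. -/
def polyH1 (K : PolygonalElement) (q : MvPolynomial (Fin 2) ℝ) : H1 K.carrier :=
  smoothH1 K.isOpen.measurableSet K.bounded (polyFun q) (contDiff_polyFun q)

/-- The local virtual element space `V_h(K)` of order `p`: functions in `H¹(K)` whose Laplacian is
a polynomial of degree at most `p - 2` and whose trace on `∂K` is continuous and a polynomial of
degree at most `p` on every edge. -/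
def VESpace (K : PolygonalElement) (p : ℕ) : Submodule ℝ (H1 K.carrier) where
  carrier := {v | (∃ f ∈ PolyDeg (p - 2), K.HasWeakLaplacian v (polyFun f)) ∧
    ∃ q ∈ K.boundaryPoly p, K.IsTrace v (polyOnBoundary q)}
  zero_mem' := by
    refine ⟨⟨0, Submodule.zero_mem _, ?_⟩, ⟨0, Submodule.zero_mem _, ?_⟩⟩
    · have h : polyFun 0 = 0 := by funext x; simp [polyFun]
      rw [h]; exact HasWeakLaplacian.zero
    · have h : polyOnBoundary (0 : Fin (K.m + 3) → Polynomial ℝ) = 0 := by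
        funext i t; simp [polyOnBoundary]
      rw [h]; exact IsTrace.zero
  add_mem' := by
    rintro v w ⟨⟨f, hf, hf'⟩, q, hq, hq'⟩ ⟨⟨g, hg, hg'⟩, s, hs, hs'⟩
    refine ⟨⟨f + g, Submodule.add_mem _ hf hg, ?_⟩, ⟨q + s, Submodule.add_mem _ hq hs, ?_⟩⟩
    · have h : polyFun (f + g) = polyFun f + polyFun g := by funext x; simp [polyFun]
      rw [h]
      exact hf'.add (contDiff_polyFun f).continuous (contDiff_polyFun g).continuous hg'
    · have h : polyOnBoundary (q + s) = polyOnBoundary q + polyOnBoundary s := by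
        funext i t; simp [polyOnBoundary]
      rw [h]
      exact hq'.add (fun i => (q i).continuous) (fun i => (s i).continuous) hs'
  smul_mem' := by
    rintro r v ⟨⟨f, hf, hf'⟩, q, hq, hq'⟩
    refine ⟨⟨r • f, Submodule.smul_mem _ r hf, ?_⟩, ⟨r • q, Submodule.smul_mem _ r hq, ?_⟩⟩
    · have h : polyFun (r • f) = r • polyFun f := by
        funext x
        exact MvPolynomial.smul_eval _ _ _
      have h2 := HasWeakLaplacian.smul r hf'
      rw [← h] at h2
      exact h2
    · have h : polyOnBoundary (r • q) = r • polyOnBoundary q := by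
        funext i t
        simp [polyOnBoundary]
      have h2 := IsTrace.smul r hq'
      rw [← h] at h2
      exact h2

theorem isTrace_polyH1 (K : PolygonalElement) (q : MvPolynomial (Fin 2) ℝ) :
    K.IsTrace (K.polyH1 q) (K.onBoundary (polyFun q)) := by
  refine ⟨fun _ => polyFun q, fun _ => contDiff_polyFun q, ?_, ?_, fun i => by simp⟩
  · have h := MemLp.coeFn_toLp (memLp_of_continuous K.isOpen.measurableSet K.bounded
      (contDiff_polyFun q).continuous)
    have : eLpNorm (fun x => polyFun q x - H1val (K.polyH1 q) x) 2
        (volume.restrict K.carrier) = 0 := by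
      rw [eLpNorm_congr_ae (g := fun _ => (0 : ℝ))]
      · exact eLpNorm_zero
      · filter_upwards [h] with x hx
        exact sub_eq_zero.mpr hx.symm
    simp only [this, tendsto_const_nhds]
  · have h := MemLp.coeFn_toLp (memLp_of_continuous K.isOpen.measurableSet K.bounded
      (continuous_gradient (contDiff_polyFun q)))
    have : eLpNorm (fun x => gradient (polyFun q) x - H1grad (K.polyH1 q) x) 2
        (volume.restrict K.carrier) = 0 := by
      rw [eLpNorm_congr_ae (g := fun _ => (0 : Plane))]
      · exact eLpNorm_zero
      · filter_upwards [h] with x hx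
        exact sub_eq_zero.mpr hx.symm
    simp only [this, tendsto_const_nhds]

theorem polyH1_mem (K : PolygonalElement) {p : ℕ} {q : MvPolynomial (Fin 2) ℝ}
    (hq : q ∈ PolyDeg p) : K.polyH1 q ∈ K.VESpace p := by
  rw [MvPolynomial.mem_restrictTotalDegree] at hq
  refine ⟨⟨∑ i, MvPolynomial.pderiv i (MvPolynomial.pderiv i q), ?_, ?_⟩, ?_⟩
  · refine Submodule.sum_mem _ fun i _ => ?_
    rw [MvPolynomial.mem_restrictTotalDegree]
    exact totalDegree_pderiv _ i _ (totalDegree_pderiv _ i _ hq)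
  · intro ψ hψ
    have h := MemLp.coeFn_toLp (memLp_of_continuous K.isOpen.measurableSet K.bounded
      (continuous_gradient (contDiff_polyFun q)))
    have e1 : ∫ x in K.carrier, inner ℝ (H1grad (K.polyH1 q) x) (gradient ψ x)
        = ∫ x in K.carrier, (polyFun (MvPolynomial.pderiv 0 q) x * gradient ψ x 0
          + polyFun (MvPolynomial.pderiv 1 q) x * gradient ψ x 1) := by
      apply integral_congr_ae
      filter_upwards [h] with x hx
      have hx' : H1grad (K.polyH1 q) x = gradient (polyFun q) x := hx
      rw [hx']
      rw [PiLp.inner_apply, Fin.sum_univ_two]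
      simp only [gradient_polyFun, RCLike.inner_apply, conj_trivial, mul_comm]
    have i1 : ∀ i, IntegrableOn
        (fun x => polyFun (MvPolynomial.pderiv i q) x * gradient ψ x i) K.carrier := fun i =>
      (((contDiff_polyFun _).continuous.mul
        (hψ.continuous_gradient i)).integrable_of_hasCompactSupport
        (hψ.compact_gradient i).mul_left).integrableOn
    have i2 : ∀ i, IntegrableOn
        (fun x => polyFun (MvPolynomial.pderiv i (MvPolynomial.pderiv i q)) x * ψ x)
        K.carrier := fun i =>
      (((contDiff_polyFun _).continuous.mul hψ.1.continuous).integrable_of_hasCompactSupport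
        hψ.2.1.mul_left).integrableOn
    have e2 : (fun x => polyFun (∑ i, MvPolynomial.pderiv i (MvPolynomial.pderiv i q)) x * ψ x)
        = fun x => polyFun (MvPolynomial.pderiv 0 (MvPolynomial.pderiv 0 q)) x * ψ x
          + polyFun (MvPolynomial.pderiv 1 (MvPolynomial.pderiv 1 q)) x * ψ x := by
      funext x
      simp [polyFun, add_mul]
    rw [e1, e2, integral_add (i1 0) (i1 1), integral_add (i2 0) (i2 1),
      integral_by_parts (contDiff_polyFun _) hψ 0, integral_by_parts (contDiff_polyFun _) hψ 1]
    simp only [gradient_polyFun]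
    ring
  · let l : Fin (K.m + 3) → Fin 2 → Polynomial ℝ := fun i j =>
      Polynomial.C (K.vertex (i + 1) j - K.vertex i j) * Polynomial.X
        + Polynomial.C (K.vertex i j)
    have hl : ∀ i t, (MvPolynomial.aeval (l i) q).eval t = polyFun q (K.edgeMap i t) := by
      intro i t
      have h1 : (MvPolynomial.aeval (l i) q).eval t
          = MvPolynomial.eval (fun j => (l i j).eval t) q := by
        have := MvPolynomial.eval₂_comp_left (Polynomial.evalRingHom t)
          (algebraMap ℝ (Polynomial ℝ)) (l i) q
        rw [MvPolynomial.aeval_def, ← Polynomial.coe_evalRingHom, this]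
        have hc : (Polynomial.evalRingHom t).comp (algebraMap ℝ (Polynomial ℝ))
            = RingHom.id ℝ := by
          ext; simp
        rw [hc]
        rfl
      rw [h1, polyFun]
      have hj : (fun j => (l i j).eval t) = fun j => K.edgeMap i t j := by
        funext j
        simp [l, edgeMap, AffineMap.lineMap_apply]
        ring
      rw [hj]
    refine ⟨fun i => MvPolynomial.aeval (l i) q, fun i => ⟨?_, ?_⟩, ?_⟩
    · have := MvPolynomial.aeval_natDegree_le q hq (l i) (n := 1) fun j =>
        Polynomial.natDegree_linear_le
      simpa using this
    · simp [hl, edgeMap]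
    · have h : polyOnBoundary (fun i => MvPolynomial.aeval (l i) q)
          = K.onBoundary (polyFun q) := by
        funext i t
        exact hl i t
      rw [h]
      exact isTrace_polyH1 K q

/-- A polynomial of degree at most `p`, as an element of `V_h(K)`. -/
def polyVE (K : PolygonalElement) {p : ℕ} (q : PolyDeg p) : K.VESpace p :=
  ⟨K.polyH1 q.1, polyH1_mem K q.2⟩

/-- The constant function `1`, as an element of `V_h(K)`. -/
def oneVE (K : PolygonalElement) (p : ℕ) : K.VESpace p :=
  K.polyVE ⟨1, by simp [MvPolynomial.mem_restrictTotalDegree]⟩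

/-- The gradient of an element of `V_h(K)`. -/
abbrev grad {p : ℕ} (v : K.VESpace p) : L2Vec K.carrier := H1grad v.1

/-! ### The local bilinear form -/

variable {p : ℕ}

/-- The assumptions on a stabilisation `S : V_h(K) × V_h(K) → ℝ`. -/
structure IsStabilisation (S : LinearMap.BilinForm ℝ (K.VESpace p)) : Prop where
  one_pos : 0 < S (K.oneVE p) (K.oneVE p)
  bounds : ∃ α β : ℝ, 0 < α ∧ α < β ∧ ∀ v : K.VESpace p,
    (∫ x in K.carrier, H1val v.1 x) = 0 →
      α * ‖grad v‖ ^ 2 ≤ S v v ∧ S v v ≤ β * ‖grad v‖ ^ 2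

/-- `P` is the projection `Π^∇_p v`: `(∇(v - P), ∇q)_K = 0` for all polynomials `q` of degree at
most `p`, and `S(v - P, 1) = 0`. -/
def IsPiNabla (S : LinearMap.BilinForm ℝ (K.VESpace p)) (v : K.VESpace p) (P : PolyDeg p) :
    Prop :=
  (∀ q : PolyDeg p, inner ℝ (grad (v - K.polyVE P)) (grad (K.polyVE q)) = 0) ∧
    S (v - K.polyVE P) (K.oneVE p) = 0

/-- The projection `Π^∇_p v`. -/
def piNabla (S : LinearMap.BilinForm ℝ (K.VESpace p)) (v : K.VESpace p) : PolyDeg p :=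
  Classical.epsilon (IsPiNabla S v)

/-- `(I - Π^∇_p) v`, an element of `V_h(K)`. -/
def complProj (S : LinearMap.BilinForm ℝ (K.VESpace p)) (v : K.VESpace p) : K.VESpace p :=
  v - K.polyVE (piNabla S v)

/-- The local discrete bilinear form
`a_h^K(φ, v) = (∇ Π φ, ∇ Π v)_K + S((I - Π) φ, (I - Π) v)`. -/
def localForm (S : LinearMap.BilinForm ℝ (K.VESpace p)) (φ v : K.VESpace p) : ℝ :=
  inner ℝ (grad (K.polyVE (piNabla S φ))) (grad (K.polyVE (piNabla S v)))
    + S (complProj S φ) (complProj S v)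

/-! ### The generalised gradient -/

/-- `s` is a stabilisation lift of `φ`:
`(∇ s, ∇ q)_K = S((I - Π) φ, q)` for all polynomials `q` of degree at most `p`. -/
def IsStabLift (S : LinearMap.BilinForm ℝ (K.VESpace p)) (φ : K.VESpace p) (s : PolyDeg p) :
    Prop :=
  ∀ q : PolyDeg p, inner ℝ (grad (K.polyVE s)) (grad (K.polyVE q)) = S (complProj S φ) (K.polyVE q)

/-- `(μ, r)`, with `μ` a continuous piecewise polynomial of degree at most `p` on `∂K` and `r` a
polynomial of degree at most `p - 2`, represents the stabilisation:
`S((I - Π) φ, v) = (μ, v)_{∂K} - (r, v)_K` for all `v ∈ V_h(K)`. Here `g` is the trace of `v`. -/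
def IsLiftData (S : LinearMap.BilinForm ℝ (K.VESpace p)) (φ : K.VESpace p)
    (μ : K.boundaryPoly p) (r : PolyDeg (p - 2)) : Prop :=
  ∀ (v : K.VESpace p) (g : K.boundaryPoly p), K.IsTrace v.1 (polyOnBoundary g.1) →
    S (complProj S φ) v = K.boundaryInner (polyOnBoundary μ.1) (polyOnBoundary g.1)
      - ∫ x in K.carrier, polyFun r.1 x * H1val v.1 x

/-- The vector field `x ↦ a(x) + b(x) x`. -/
def rtFun (a : Fin 2 → MvPolynomial (Fin 2) ℝ) (b : MvPolynomial (Fin 2) ℝ) (x : Plane) : Plane :=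
  WithLp.toLp 2 fun j => polyFun (a j) x + polyFun b x * x j

/-- `τ` is a piecewise Raviart-Thomas field of degree `k` on the subtriangulation of `K`. -/
def IsPiecewiseRT (k : ℕ) (τ : L2Vec K.carrier) : Prop :=
  ∀ i, ∃ (a : Fin 2 → PolyDeg k) (b : PolyDeg k),
    τ =ᵐ[volume.restrict (K.subTriangle i)] rtFun (fun j => (a j).1) b.1

/-- The weak divergence of `τ` in `K` is `d`. -/
def HasWeakDiv (τ : L2Vec K.carrier) (d : Plane → ℝ) : Prop :=
  ∀ ψ : Plane → ℝ, IsTestFun K.carrier ψ →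
    ∫ x in K.carrier, inner ℝ (τ x) (gradient ψ x) = - ∫ x in K.carrier, d x * ψ x

/-- The normal trace `τ · n` on `∂K` of a field `τ` in `H(div, K)` with divergence `d` is `g`;
as usual the normal trace is the functional
`w ↦ (τ, ∇w)_K + (d, w)_K` on functions that are smooth up to the boundary. -/
def HasNormalTrace (τ : L2Vec K.carrier) (d : Plane → ℝ) (g : Fin (K.m + 3) → ℝ → ℝ) : Prop :=
  ∀ w : Plane → ℝ, ContDiff ℝ ∞ w →
    (∫ x in K.carrier, inner ℝ (τ x) (gradient w x)) + ∫ x in K.carrier, d x * w x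
      = K.boundaryInner g (K.onBoundary w)

/-- The fields `τ` in `RT_k` on the subtriangulation, `τ ∈ H(div, K)`, with `div τ = r` in `K` and
`τ · n = μ` on `∂K`. -/
def admissible (k : ℕ) (μ : K.boundaryPoly p) (r : PolyDeg (p - 2)) : Set (L2Vec K.carrier) :=
  {τ | IsPiecewiseRT k τ ∧ HasWeakDiv τ (polyFun r.1) ∧
    HasNormalTrace τ (polyFun r.1) (polyOnBoundary μ.1)}

/-- `G = ∇(Π^∇_p φ - s) + θ` is a generalised gradient of `φ`: `s` is a stabilisation lift of `φ`
and `θ` has minimal `L²` norm among the `RT_k` fields with `τ · n = μ` and `div τ = r`, where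
`(μ, r)` represents the stabilisation. -/
def IsGenGradient (k : ℕ) (S : LinearMap.BilinForm ℝ (K.VESpace p)) (φ : K.VESpace p)
    (G : L2Vec K.carrier) : Prop :=
  ∃ (s : PolyDeg p) (μ : K.boundaryPoly p) (r : PolyDeg (p - 2)) (θ : L2Vec K.carrier),
    IsStabLift S φ s ∧ IsLiftData S φ μ r ∧
    (θ ∈ admissible k μ r ∧ IsMinOn (fun τ : L2Vec K.carrier => ‖τ‖) (admissible k μ r) θ) ∧
    G = grad (K.polyVE (piNabla S φ) - K.polyVE s) + θ

end PolygonalElement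

open PolygonalElement

/-- A conforming, shape-regular polygonal mesh of `Ω`. -/
structure PolygonalMesh (Ω : Set Plane) where
  ι : Type
  [fintype : Fintype ι]
  elem : ι → PolygonalElement
  subset : ∀ i, (elem i).carrier ⊆ Ω
  disjoint : ∀ i j, i ≠ j → Disjoint (elem i).carrier (elem j).carrier
  cover : closure Ω = ⋃ i, closure (elem i).carrier
  /-- The closures of two elements meet only in common vertices and common edges. -/
  conforming : ∀ i j, i ≠ j → ∀ x ∈ closure (elem i).carrier ∩ closure (elem j).carrier,
    (∃ a b, x = (elem i).vertex a ∧ x = (elem j).vertex b) ∨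
      ∃ a b, x ∈ (elem i).edge a ∧ (elem i).edge a = (elem j).edge b
  /-- The shape-regularity parameter. -/
  γ : ℝ
  γ_pos : 0 < γ
  γ_le : γ ≤ 1
  radius_ge : ∀ i, γ * Metric.diam (elem i).carrier ≤ (elem i).radius
  edge_ge : ∀ i a, γ * Metric.diam (elem i).carrier ≤ (elem i).edgeLength a

attribute [instance] PolygonalMesh.fintype

namespace PolygonalMesh

variable {Ω : Set Plane} (T : PolygonalMesh Ω) {p : ℕ}

/-- The global virtual element space: functions in `H¹(Ω)` whose restriction to every element is
in the local space. -/
def globalSpace (p : ℕ) : Set (H1 Ω) :=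
  {v | ∀ i, H1restr (T.subset i) v ∈ (T.elem i).VESpace p}

variable {T}

/-- The restriction of a global function to an element. -/
def localPart (v : T.globalSpace p) (i : T.ι) : (T.elem i).VESpace p :=
  ⟨H1restr (T.subset i) v.1, v.2 i⟩

/-- The global discrete bilinear form `a_h`, the sum of the local ones. -/
def globalForm (S : ∀ i, LinearMap.BilinForm ℝ ((T.elem i).VESpace p))
    (φ v : T.globalSpace p) : ℝ :=
  ∑ i, localForm (S i) (localPart φ i) (localPart v i)

/-- `G ∈ L²(Ω)²` restricts on every element to a generalised gradient of `φ|_K`. -/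
def IsGlobalGenGradient (k : ℕ) (S : ∀ i, LinearMap.BilinForm ℝ ((T.elem i).VESpace p))
    (φ : T.globalSpace p) (G : L2Vec Ω) : Prop :=
  ∀ i, IsGenGradient k (S i) (localPart φ i) (restrictLp (T.subset i) G)

/-- `G` is piecewise in `RT_k` over the union of the subtriangulations. -/
def IsGlobalPiecewiseRT (T : PolygonalMesh Ω) (k : ℕ) (G : L2Vec Ω) : Prop :=
  ∀ i, IsPiecewiseRT (K := T.elem i) k (restrictLp (T.subset i) G)

end PolygonalMesh

end VEM

end

open VEM VEM.PolygonalElement VEM.PolygonalMesh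

/-!
The identity itself is linear algebra. Write `Π` for the projection `Π^∇_p`, `s` for the
stabilisation lift of `φ` and `θ` for the field attached to the data `(μ, r)`. Green's formula and
the definition of the data give `(θ, ∇v) = S((I - Π) φ, v)`, and the lift gives
`(∇s, ∇Πv) = S((I - Π) φ, Πv)`. Subtracting, and replacing `∇v` by `∇Πv` against gradients of
polynomials, yields `a_h(φ, v) = (∇(Πφ - s) + θ, ∇v)` (`inner_eq_of_admissible`, `inner_identity`).
The work lies in Green's formula for functions whose trace is a limit of smooth boundary values, and
in the existence of `μ`, `r` and `θ`.

*Green's formula.* Star-shapedness implies that every ray from the centre meets the boundary once.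
So the edges are never on lines through the centre (`jac_ne_zero`), consecutive triangles have the
same orientation (`jac_mul_jac_pos`), and the open triangles are disjoint and fill the polygon up to
a null set (`carrier_ae_eq`). The divergence theorem on a triangle is the one on the unit square,
transported by `(s, t) ↦ c + s (x(t) - c)`, where `x` parametrises the edge; the contributions of
the sides at the centre cancel in the sum (`sum_integral_divergence`). Approximation by smooth
functions extends Green's formula to functions with a trace (`green_of_isTrace`).

*Traces.* With the radial field `w² (x - c)`, whose normal component on the boundary has a strict
sign, the divergence theorem controls the trace of `w` by the `H¹` norm (`radial_identity`). Hence
traces are unique (`IsTrace.unique`), and the piecewise polynomial trace is a linear map on the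
virtual element space.

*Boundary and interior data.* A function `v` with zero trace and polynomial Laplacian `f` satisfies
the energy identity `‖∇v‖² = -(f, v)`: the extension of `v` by zero commutes with differentiation,
and since the polygon is star-shaped with respect to a ball, contracting the extension towards the
centre and mollifying gives test functions that converge weakly to `v` (`energy_identity`). If in
addition the moments of `v` against `P_{p-2}` vanish, then so does `v`
(`eq_zero_of_trace_of_moments`). Thus trace and moments separate virtual functions, and by duality
in finite dimension every functional on the virtual element space has the form
`v ↦ (μ, v)_{∂K} - (r, v)_K` (`exists_pairing_eq`, `exists_isLiftData`). The projection and the lift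
are obtained from Riesz' theorem on the gradients of polynomials, whose kernel, the constants, is
taken care of by `S(1, 1) > 0` and by `S((I - Π) φ, 1) = 0` (`exists_gradPoly_inner_eq`,
`existsUnique_projection`).

*Admissible fields.* Testing the data with `v = 1` gives the compatibility condition
`∫_{∂K} μ = ∫_K r` (`IsLiftData.compat`). The Euler operator `b ↦ div (b (x - c))` is bijective on
`P_{p-2}` (`exists_eulerOp_eq`), so `b (x - c)` has divergence `r` for some `b`; its normal component
vanishes on the sides at the centre. The remaining flux through the boundary is supplied by rotated
gradients of stream functions. Its mean values on the edges sum to zero, hence are the differences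
of values `α` at the vertices (`exists_cyclic_potential`); on each triangle the stream function is
linear along the sides at the centre, from `0` to these values, plus a bubble that adjusts the flux
on the edge (`exists_bubble`, `exists_flux`). Its degree is at most `p + 1`, so the resulting field
is Raviart-Thomas of order `p ≤ k` (`exists_rt_field`). The admissible fields form a non-empty closed
convex subset of a finite-dimensional space, so one of them has minimal norm
(`exists_isMinOn_admissible`).

*The mesh.* The elements fill the domain up to a null set (`domain_ae_eq`), so fields on them glue
(`exists_restrictLp_eq`) and the inner product splits (`inner_eq_sum`).
-/

noncomputable section

namespace VEM

/-! ### Plane geometry of star-shaped polygons -/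

/-- The determinant of two plane vectors. -/
def cross (a b : Plane) : ℝ := a 0 * b 1 - a 1 * b 0

theorem volume_segment (a b : Plane) : volume (segment ℝ a b) = 0 := by
  have hsub : segment ℝ a b ⊆ (line[ℝ, a, b] : Set Plane) := by
    rw [← convexHull_pair]
    exact convexHull_subset_affineSpan _
  refine measure_mono_null hsub (Measure.addHaar_affineSubspace _ _ ?_)
  intro h
  have h1 : Module.finrank ℝ (vectorSpan ℝ ({a, b} : Set Plane)) ≤ 1 :=
    collinear_iff_finrank_le_one.mp (collinear_pair ℝ a b)
  rw [← direction_affineSpan, h, AffineSubspace.direction_top, finrank_top,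
    finrank_euclideanSpace_fin] at h1
  omega

/-- Cramer's rule in the plane. -/
theorem cross_smul_eq (a b x : Plane) :
    cross a b • x = cross x b • a + cross a x • b := by
  ext i
  fin_cases i <;> simp [cross] <;> ring

namespace PolygonalElement

variable (K : PolygonalElement)

/-- The signed Jacobian of the parametrisation of the `i`-th triangle, twice its signed area. -/
def jac (i : Fin (K.m + 3)) : ℝ :=
  cross (K.vertex i - K.centre) (K.vertex (i + 1) - K.centre)

/-- The parametrisation of the `i`-th triangle over the unit square which maps the segments
`t = const` onto the segments from the centre to the points of the `i`-th edge. -/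
def coneMap (i : Fin (K.m + 3)) (s t : ℝ) : Plane :=
  K.centre + s • (K.edgeMap i t - K.centre)

/-- The image of the open unit square under `coneMap`, which is the open `i`-th triangle. -/
def openTri (i : Fin (K.m + 3)) : Set Plane :=
  (fun z : ℝ × ℝ => K.coneMap i z.1 z.2) '' (Set.Ioo 0 1 ×ˢ Set.Ioo 0 1)

theorem edgeMap_sub_centre (i : Fin (K.m + 3)) (t : ℝ) :
    K.edgeMap i t - K.centre
      = (1 - t) • (K.vertex i - K.centre) + t • (K.vertex (i + 1) - K.centre) := by
  ext j
  simp [edgeMap, AffineMap.lineMap_apply]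
  ring

theorem edgeMap_mem_edge (i : Fin (K.m + 3)) {t : ℝ} (ht : t ∈ Set.Icc (0 : ℝ) 1) :
    K.edgeMap i t ∈ K.edge i := by
  rw [edge, segment_eq_image_lineMap]
  exact ⟨t, ht, rfl⟩

theorem edgeMap_mem_frontier (i : Fin (K.m + 3)) {t : ℝ} (ht : t ∈ Set.Icc (0 : ℝ) 1) :
    K.edgeMap i t ∈ frontier K.carrier := by
  rw [K.frontier_eq]
  exact Set.mem_iUnion.mpr ⟨i, K.edgeMap_mem_edge i ht⟩

theorem exists_edgeMap_of_mem_frontier {x : Plane} (hx : x ∈ frontier K.carrier) :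
    ∃ i, ∃ t ∈ Set.Icc (0 : ℝ) 1, x = K.edgeMap i t := by
  rw [K.frontier_eq] at hx
  obtain ⟨i, hi⟩ := Set.mem_iUnion.mp hx
  rw [segment_eq_image_lineMap] at hi
  obtain ⟨t, ht, rfl⟩ := hi
  exact ⟨i, t, ht, rfl⟩

theorem edgeMap_zero (i : Fin (K.m + 3)) : K.edgeMap i 0 = K.vertex i := by simp [edgeMap]

theorem edgeMap_one (i : Fin (K.m + 3)) : K.edgeMap i 1 = K.vertex (i + 1) := by simp [edgeMap]

theorem vertex_mem_frontier (i : Fin (K.m + 3)) : K.vertex i ∈ frontier K.carrier := by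
  rw [← K.edgeMap_zero i]
  exact K.edgeMap_mem_frontier i (by simp)

theorem add_one_ne (i : Fin (K.m + 3)) : i + 1 ≠ i := by
  intro h
  simp at h

theorem vertex_add_one_ne (i : Fin (K.m + 3)) : K.vertex (i + 1) ≠ K.vertex i :=
  fun h => K.add_one_ne i (K.vertex_injective h)

theorem carrier_nonempty : K.carrier.Nonempty := by
  by_contra h
  have := K.vertex_mem_frontier 0
  rw [Set.not_nonempty_iff_eq_empty.mp h] at this
  simp at this

theorem centre_mem : K.centre ∈ K.carrier := by
  obtain ⟨x, hx⟩ := K.carrier_nonempty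
  have := K.starShaped K.centre (Metric.mem_ball_self K.radius_pos) hx
    (zero_le_one) le_rfl (by norm_num : (1 : ℝ) + 0 = 1)
  simpa using this

/-- Contracting the closed polygon towards the centre of the ball leaves room for a ball around
every point. -/
theorem contraction_add_mem {x z : Plane} (hx : x ∈ closure K.carrier) {s : ℝ} (hs0 : 0 ≤ s)
    (hs1 : s < 1) (hz : ‖z‖ < (1 - s) * K.radius) :
    K.centre + s • (x - K.centre) + z ∈ K.carrier := by
  set δ := (1 - s) * K.radius - ‖z‖ with hδ
  have hδ0 : 0 < δ := by simp only [hδ]; linarith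
  obtain ⟨x', hx', hd⟩ := Metric.mem_closure_iff.mp hx δ hδ0
  have h1s : 0 < 1 - s := by linarith
  set w : Plane := (1 - s)⁻¹ • (s • (x - x') + z) with hw
  have hwn : ‖w‖ < K.radius := by
    rw [hw, norm_smul, norm_inv, Real.norm_of_nonneg h1s.le, inv_mul_lt_iff₀ h1s]
    calc ‖s • (x - x') + z‖ ≤ ‖s • (x - x')‖ + ‖z‖ := norm_add_le _ _
      _ = s * ‖x - x'‖ + ‖z‖ := by rw [norm_smul, Real.norm_of_nonneg hs0]
      _ ≤ ‖x - x'‖ + ‖z‖ := by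
        gcongr
        exact mul_le_of_le_one_left (norm_nonneg _) hs1.le
      _ < δ + ‖z‖ := by
        rw [dist_eq_norm] at hd
        gcongr
      _ = (1 - s) * K.radius := by simp only [hδ]; ring
  have hb : K.centre + w ∈ Metric.ball K.centre K.radius := by simpa using hwn
  have := K.starShaped _ hb hx' h1s.le hs0 (by ring)
  convert this using 1
  rw [hw, smul_add (1 - s), smul_smul, mul_inv_cancel₀ h1s.ne', one_smul]
  module

theorem contraction_mem {x : Plane} (hx : x ∈ closure K.carrier) {s : ℝ} (hs0 : 0 ≤ s)
    (hs1 : s < 1) : K.centre + s • (x - K.centre) ∈ K.carrier := by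
  have := K.contraction_add_mem (z := 0) hx hs0 hs1 (by
    rw [norm_zero]; exact mul_pos (by linarith) K.radius_pos)
  simpa using this

theorem notMem_of_mem_frontier {x : Plane} (hx : x ∈ frontier K.carrier) : x ∉ K.carrier := by
  rw [K.isOpen.frontier_eq] at hx
  exact hx.2

/-- A ray from the centre meets the boundary in at most one point. -/
theorem eq_of_mem_frontier_ray {x y : Plane} (hx : x ∈ frontier K.carrier)
    (hy : y ∈ frontier K.carrier) {s : ℝ} (hs : 0 < s)
    (h : y - K.centre = s • (x - K.centre)) : y = x := by
  rcases lt_trichotomy s 1 with h1 | h1 | h1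
  · refine absurd (K.contraction_mem (frontier_subset_closure hx) hs.le h1) ?_
    rw [← h, add_sub_cancel]
    exact K.notMem_of_mem_frontier hy
  · rw [h1, one_smul] at h
    exact sub_left_injective h
  · refine absurd (K.contraction_mem (frontier_subset_closure hy) (inv_pos.mpr hs).le
      (inv_lt_one_of_one_lt₀ h1)) ?_
    rw [h, smul_smul, inv_mul_cancel₀ hs.ne', one_smul, add_sub_cancel]
    exact K.notMem_of_mem_frontier hx

/-- The polygon is the union of the half-open segments from the centre to the boundary points. -/
theorem exists_coneMap {y : Plane} (hy : y ∈ K.carrier) :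
    ∃ i, ∃ s ∈ Set.Ico (0 : ℝ) 1, ∃ t ∈ Set.Icc (0 : ℝ) 1, y = K.coneMap i s t := by
  rcases eq_or_ne y K.centre with rfl | hne
  · exact ⟨0, 0, by simp, 0, by simp, by simp [coneMap]⟩
  obtain ⟨R, hR⟩ := K.bounded.subset_closedBall K.centre
  have hn : 0 < ‖y - K.centre‖ := norm_pos_iff.mpr (sub_ne_zero.mpr hne)
  have hR0 : 0 ≤ R := by
    have := hR hy
    rw [Metric.mem_closedBall, dist_eq_norm] at this
    linarith
  set S := (R + 1) / ‖y - K.centre‖ with hS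
  -- a point of the ray through `y` outside the bounded polygon; the ray then meets the frontier
  -- between `y` and this point
  have hfar : K.centre + S • (y - K.centre) ∉ K.carrier := by
    intro h
    have := hR h
    rw [Metric.mem_closedBall, dist_eq_norm, add_sub_cancel_left, norm_smul, hS,
      Real.norm_of_nonneg (by positivity), div_mul_cancel₀ _ hn.ne'] at this
    linarith
  have hcont : Continuous fun s : ℝ => K.centre + s • (y - K.centre) := by fun_prop
  have hconn : IsPreconnected ((fun s : ℝ => K.centre + s • (y - K.centre)) '' Set.Icc 1 S) :=
    isPreconnected_Icc.image _ hcont.continuousOn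
  have hS1 : 1 ≤ S := by
    have := hR hy
    rw [Metric.mem_closedBall, dist_eq_norm] at this
    rw [hS, le_div_iff₀ hn]
    linarith
  obtain ⟨x, ⟨s, hs, rfl⟩, hx⟩ : (((fun s : ℝ => K.centre + s • (y - K.centre)) '' Set.Icc 1 S)
      ∩ frontier K.carrier).Nonempty := by
    by_contra hemp
    rw [Set.not_nonempty_iff_eq_empty] at hemp
    have hsub := hconn.subset_left_of_subset_union (u := K.carrier) (v := (closure K.carrier)ᶜ)
      K.isOpen isClosed_closure.isOpen_compl
      (Set.disjoint_left.mpr fun a ha ha' => ha' (subset_closure ha)) (by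
        intro a ha
        by_contra h
        simp only [Set.mem_union, Set.mem_compl_iff, not_or, not_not] at h
        have : a ∈ frontier K.carrier := by
          rw [K.isOpen.frontier_eq]; exact ⟨h.2, h.1⟩
        exact (Set.eq_empty_iff_forall_notMem.mp hemp a) ⟨ha, this⟩)
      ⟨y, by exact ⟨1, ⟨le_rfl, hS1⟩, by simp⟩, hy⟩
    exact hfar (hsub ⟨S, ⟨hS1, le_rfl⟩, rfl⟩)
  have hs0 : 0 < s := lt_of_lt_of_le one_pos hs.1
  have hs1 : s ≠ 1 := by
    rintro rfl
    exact K.notMem_of_mem_frontier hx (by simpa using hy)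
  obtain ⟨i, t, ht, hit⟩ := K.exists_edgeMap_of_mem_frontier hx
  refine ⟨i, s⁻¹, ⟨(inv_pos.mpr hs0).le, inv_lt_one_of_one_lt₀ (lt_of_le_of_ne hs.1 hs1.symm)⟩,
    t, ht, ?_⟩
  simp only at hit
  rw [coneMap, ← hit, add_sub_cancel_left, smul_smul, inv_mul_cancel₀ hs0.ne', one_smul,
    add_sub_cancel]

theorem coneMap_mem (i : Fin (K.m + 3)) {s t : ℝ} (hs0 : 0 ≤ s) (hs1 : s < 1)
    (ht : t ∈ Set.Icc (0 : ℝ) 1) : K.coneMap i s t ∈ K.carrier :=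
  K.contraction_mem (frontier_subset_closure (K.edgeMap_mem_frontier i ht)) hs0 hs1

theorem openTri_subset (i : Fin (K.m + 3)) : K.openTri i ⊆ K.carrier := by
  rintro _ ⟨z, ⟨hz1, hz2⟩, rfl⟩
  exact K.coneMap_mem i hz1.1.le hz1.2 ⟨hz2.1.le, hz2.2.le⟩

/-- No edge lies on a line through the centre: if the vertices were on opposite sides of it, the
centre would be on the edge, and otherwise one ray from the centre would meet the boundary
twice. -/
theorem jac_ne_zero (i : Fin (K.m + 3)) : K.jac i ≠ 0 := by
  intro hJ
  set a := K.vertex i - K.centre with ha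
  set b := K.vertex (i + 1) - K.centre with hb
  have hJ' : a 0 * b 1 - a 1 * b 0 = 0 := hJ
  have hc : ∀ j, K.vertex j - K.centre ≠ 0 := by
    intro j h
    apply K.notMem_of_mem_frontier (K.vertex_mem_frontier j)
    rw [sub_eq_zero.mp h]
    exact K.centre_mem
  have ha0 : 0 < a 0 ^ 2 + a 1 ^ 2 := by
    by_contra hcon
    have h0 : a 0 = 0 := by nlinarith [sq_nonneg (a 0), sq_nonneg (a 1)]
    have h1 : a 1 = 0 := by nlinarith [sq_nonneg (a 0), sq_nonneg (a 1)]
    apply hc i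
    ext j
    fin_cases j
    · exact h0
    · exact h1
  -- the two vertices lie on a line through the centre: `b = r a`
  set r := (a 0 * b 0 + a 1 * b 1) / (a 0 ^ 2 + a 1 ^ 2) with hr
  have hba : b = r • a := by
    ext j
    fin_cases j
    · simp [hr]; field_simp; linear_combination (-a 1) * hJ'
    · simp [hr]; field_simp; linear_combination (a 0) * hJ'
  have hr0 : r ≠ 0 := by
    intro h
    rw [h, zero_smul] at hba
    exact hc (i + 1) hba
  rcases lt_or_gt_of_ne hr0 with hneg | hpos
  · -- the centre would lie on the edge
    have h1r : 0 < 1 - r := by linarith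
    have hm := K.edgeMap_mem_frontier i (t := 1 / (1 - r))
      ⟨by positivity, by rw [div_le_one h1r]; linarith⟩
    apply K.notMem_of_mem_frontier hm
    have : K.edgeMap i (1 / (1 - r)) - K.centre = 0 := by
      rw [edgeMap_sub_centre, ← ha, ← hb, hba, smul_smul, ← add_smul]
      have : 1 - 1 / (1 - r) + 1 / (1 - r) * r = 0 := by field_simp; ring
      rw [this, zero_smul]
    rw [sub_eq_zero.mp this]
    exact K.centre_mem
  · exact K.vertex_add_one_ne i (K.eq_of_mem_frontier_ray (K.vertex_mem_frontier i)
      (K.vertex_mem_frontier (i + 1)) hpos hba)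

theorem coneMap_sub_centre (i : Fin (K.m + 3)) (s t : ℝ) :
    K.coneMap i s t - K.centre = (s * (1 - t)) • (K.vertex i - K.centre)
      + (s * t) • (K.vertex (i + 1) - K.centre) := by
  rw [coneMap, add_sub_cancel_left, edgeMap_sub_centre, smul_add, smul_smul, smul_smul]

theorem cross_coneMap_right (i : Fin (K.m + 3)) (s t : ℝ) :
    cross (K.coneMap i s t - K.centre) (K.vertex (i + 1) - K.centre) = s * (1 - t) * K.jac i := by
  rw [coneMap_sub_centre]
  simp [cross, jac]
  ring

theorem cross_coneMap_left (i : Fin (K.m + 3)) (s t : ℝ) :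
    cross (K.vertex i - K.centre) (K.coneMap i s t - K.centre) = s * t * K.jac i := by
  rw [coneMap_sub_centre]
  simp [cross, jac]
  ring

theorem injOn_coneMap (i : Fin (K.m + 3)) :
    Set.InjOn (fun z : ℝ × ℝ => K.coneMap i z.1 z.2) (Set.Ioo 0 1 ×ˢ Set.Ioo 0 1) := by
  rintro ⟨s, t⟩ ⟨hs, ht⟩ ⟨s', t'⟩ ⟨hs', ht'⟩ h
  simp only at h hs ht hs' ht'
  have h1 := K.cross_coneMap_right i s t
  have h2 := K.cross_coneMap_left i s t
  rw [h, K.cross_coneMap_right i s' t'] at h1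
  rw [h, K.cross_coneMap_left i s' t'] at h2
  have e1 := mul_right_cancel₀ (K.jac_ne_zero i) h1
  have e2 := mul_right_cancel₀ (K.jac_ne_zero i) h2
  have hss : s = s' := by linarith
  subst hss
  have : t = t' := (mul_left_cancel₀ hs.1.ne' e2).symm
  rw [this]

/-- A point of the cone spanned by the relative interior of an edge. -/
theorem mem_ray_edgeMap (i : Fin (K.m + 3)) {x : Plane} {a b : ℝ} (ha : 0 < a) (hb : 0 < b)
    (hx : x = a • (K.vertex i - K.centre) + b • (K.vertex (i + 1) - K.centre)) :
    ∃ t ∈ Set.Ioo (0 : ℝ) 1, x = (a + b) • (K.edgeMap i t - K.centre) := by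
  have hab : 0 < a + b := by positivity
  refine ⟨b / (a + b), ⟨by positivity, by rw [div_lt_one hab]; linarith⟩, ?_⟩
  rw [edgeMap_sub_centre, smul_add, smul_smul, smul_smul, hx]
  congr 2
  · field_simp; ring
  · field_simp

/-- Relative interiors of two different edges are not met by the same ray from the centre. -/
theorem not_same_ray {i j : Fin (K.m + 3)} (hij : i ≠ j) {t t' : ℝ} (ht : t ∈ Set.Ioo (0 : ℝ) 1)
    (ht' : t' ∈ Set.Ioo (0 : ℝ) 1) {s s' : ℝ} (hs : 0 < s) (hs' : 0 < s')
    (h : s • (K.edgeMap i t - K.centre) = s' • (K.edgeMap j t' - K.centre)) : False := by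
  have hti : t ∈ Set.Icc (0 : ℝ) 1 := ⟨ht.1.le, ht.2.le⟩
  have htj : t' ∈ Set.Icc (0 : ℝ) 1 := ⟨ht'.1.le, ht'.2.le⟩
  have he : K.edgeMap j t' = K.edgeMap i t :=
    K.eq_of_mem_frontier_ray (K.edgeMap_mem_frontier i hti) (K.edgeMap_mem_frontier j htj)
      (s := s'⁻¹ * s) (by positivity) (by
        rw [mul_smul, h, smul_smul, inv_mul_cancel₀ hs'.ne', one_smul])
  have hmem := K.simple i j hij ⟨K.edgeMap_mem_edge i hti, he ▸ K.edgeMap_mem_edge j htj⟩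
  have hinj : Function.Injective (K.edgeMap i) :=
    AffineMap.lineMap_injective ℝ (K.vertex_add_one_ne i).symm
  rcases hmem.1 with h0 | h1
  · rw [← K.edgeMap_zero i] at h0
    exact ht.1.ne' (hinj h0)
  · rw [Set.mem_singleton_iff, ← K.edgeMap_one i] at h1
    exact ht.2.ne (hinj h1)

theorem openTri_disjoint {i j : Fin (K.m + 3)} (hij : i ≠ j) :
    Disjoint (K.openTri i) (K.openTri j) := by
  rw [Set.disjoint_left]
  rintro _ ⟨z, ⟨hz1, hz2⟩, rfl⟩ ⟨z', ⟨hz1', hz2'⟩, h⟩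
  simp only [coneMap, add_right_inj] at h
  exact K.not_same_ray hij hz2 hz2' hz1.1 hz1'.1 h.symm

/-- Consecutive triangles have the same orientation, since otherwise they would overlap. -/
theorem jac_mul_jac_pos (i : Fin (K.m + 3)) : 0 < K.jac i * K.jac (i + 1) := by
  by_contra hcon
  have hne : K.jac i * K.jac (i + 1) ≠ 0 := mul_ne_zero (K.jac_ne_zero i) (K.jac_ne_zero (i + 1))
  have hneg : K.jac i * K.jac (i + 1) < 0 := lt_of_le_of_ne (not_lt.mp hcon) hne
  set a := K.vertex i - K.centre with ha
  set b := K.vertex (i + 1) - K.centre with hb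
  set d := K.vertex (i + 1 + 1) - K.centre with hd
  have hJ : K.jac i = cross a b := rfl
  have hJ' : K.jac (i + 1) = cross b d := rfl
  have hJ0 := K.jac_ne_zero i
  -- express the third vertex in the basis given by the first two
  set α := cross d b / K.jac i with hα
  set β := cross a d / K.jac i with hβ
  have hdab : d = α • a + β • b := by
    have := cross_smul_eq a b d
    rw [← hJ] at this
    rw [hα, hβ, div_eq_inv_mul, div_eq_inv_mul, mul_smul, mul_smul, ← smul_add, ← this, smul_smul,
      inv_mul_cancel₀ hJ0, one_smul]
  have hαpos : 0 < α := by
    have : cross d b = - K.jac (i + 1) := by rw [hJ']; simp [cross]; ring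
    rw [hα, this, ← mul_div_mul_left _ _ hJ0]
    apply div_pos
    · nlinarith
    · exact mul_self_pos.mpr hJ0
  -- `b + ε d` is in the cone over the second edge and equals `(ε α) a + (1 + ε β) b`, which is in
  -- the cone over the first edge as soon as `1 + ε β > 0`
  set ε := 1 / (2 * (1 + |β|)) with hε
  have hε0 : 0 < ε := by positivity
  have hεβ : 0 < 1 + ε * β := by
    have h1 : ε * |β| ≤ 1 / 2 := by
      rw [hε, div_mul_eq_mul_div, div_le_div_iff₀ (by positivity) (by positivity)]
      nlinarith [abs_nonneg β]
    have h2 : -(ε * |β|) ≤ ε * β := by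
      have := mul_le_mul_of_nonneg_left (neg_abs_le β) hε0.le
      linarith
    linarith
  obtain ⟨t, ht, h1⟩ := K.mem_ray_edgeMap i (x := b + ε • d) (a := ε * α) (b := 1 + ε * β)
    (by positivity) hεβ (by rw [hdab]; module)
  obtain ⟨t', ht', h2⟩ := K.mem_ray_edgeMap (i + 1) (x := b + ε • d) (a := 1) (b := ε)
    one_pos hε0 (by rw [one_smul])
  exact K.not_same_ray (K.add_one_ne i).symm ht ht' (by positivity) (by positivity)
    (h1.symm.trans h2)

/-- The orientation `±1` of the boundary curve. -/
def orient : ℝ := SignType.sign (K.jac 0)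

theorem abs_jac (i : Fin (K.m + 3)) : |K.jac i| = K.orient * K.jac i := by
  have hsign : ∀ n : ℕ, SignType.sign (K.jac (Fin.ofNat (K.m + 3) n))
      = SignType.sign (K.jac 0) := by
    intro n
    induction n with
    | zero => rfl
    | succ n ih =>
      rw [← ih]
      have := K.jac_mul_jac_pos (Fin.ofNat (K.m + 3) n)
      have hsucc : Fin.ofNat (K.m + 3) (n + 1) = Fin.ofNat (K.m + 3) n + 1 := by
        ext
        simp [Fin.val_add]
      rw [hsucc]
      rcases pos_and_pos_or_neg_and_neg_of_mul_pos this with ⟨h1, h2⟩ | ⟨h1, h2⟩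
      · rw [sign_pos h1, sign_pos h2]
      · rw [sign_neg h1, sign_neg h2]
  have := hsign i
  have hi : Fin.ofNat (K.m + 3) i = i := by
    ext
    simp
  rw [hi] at this
  rw [orient, ← this, sign_mul_self]

theorem orient_mul_self : K.orient * K.orient = 1 := by
  rw [orient]
  rcases lt_or_gt_of_ne (K.jac_ne_zero 0) with h | h
  · simp [sign_neg h]
  · simp [sign_pos h]

theorem sum_shift (f : Fin (K.m + 3) → ℝ) : ∑ i, f (i + 1) = ∑ i, f i :=
  Equiv.sum_comp (Equiv.addRight (1 : Fin (K.m + 3))) f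

theorem coneMap_mem_segment_of_boundary (i : Fin (K.m + 3)) {s t : ℝ} (hs : s ∈ Set.Icc (0 : ℝ) 1)
    (ht : t ∈ Set.Icc (0 : ℝ) 1) (h : ¬ (s ∈ Set.Ioo (0 : ℝ) 1 ∧ t ∈ Set.Ioo (0 : ℝ) 1))
    (hs1 : s ≠ 1) :
    K.coneMap i s t ∈ segment ℝ K.centre (K.vertex i) ∪ segment ℝ K.centre (K.vertex (i + 1)) := by
  have key : ∀ x : Plane, K.centre + s • (x - K.centre) ∈ segment ℝ K.centre x := by
    intro x
    rw [segment_eq_image']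
    exact ⟨s, hs, rfl⟩
  rcases eq_or_ne s 0 with rfl | hs0
  · left
    have : K.coneMap i 0 t = K.centre := by simp [coneMap]
    rw [this]
    exact left_mem_segment _ _ _
  have hs' : s ∈ Set.Ioo (0 : ℝ) 1 := ⟨lt_of_le_of_ne hs.1 hs0.symm, lt_of_le_of_ne hs.2 hs1⟩
  have : t = 0 ∨ t = 1 := by
    by_contra hcon
    push Not at hcon
    exact h ⟨hs', lt_of_le_of_ne ht.1 hcon.1.symm, lt_of_le_of_ne ht.2 hcon.2⟩
  rcases this with rfl | rfl
  · left; rw [coneMap, edgeMap_zero]; exact key _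
  · right; rw [coneMap, edgeMap_one]; exact key _

theorem carrier_ae_eq : K.carrier =ᵐ[volume] ⋃ i, K.openTri i := by
  refine (ae_eq_set (μ := volume)).mpr ⟨?_, ?_⟩
  · refine measure_mono_null (t := ⋃ i, (segment ℝ K.centre (K.vertex i)
      ∪ segment ℝ K.centre (K.vertex (i + 1)))) ?_ ?_
    · rintro y ⟨hy, hy'⟩
      obtain ⟨i, s, hs, t, ht, rfl⟩ := K.exists_coneMap hy
      refine Set.mem_iUnion.mpr ⟨i, K.coneMap_mem_segment_of_boundary i ⟨hs.1, hs.2.le⟩ ht ?_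
        hs.2.ne⟩
      intro h
      exact hy' (Set.mem_iUnion.mpr ⟨i, ⟨(s, t), ⟨h.1, h.2⟩, rfl⟩⟩)
    · rw [measure_iUnion_null_iff]
      intro i
      exact measure_union_null (volume_segment _ _) (volume_segment _ _)
  · rw [Set.sdiff_eq_empty.mpr (Set.iUnion_subset K.openTri_subset)]
    exact measure_empty

theorem openTri_ae_eq (i : Fin (K.m + 3)) : K.openTri i =ᵐ[volume] K.subTriangle i := by
  set C := convexHull ℝ {K.centre, K.vertex i, K.vertex (i + 1)} with hC
  have hmem : ∀ y, y ∈ C ↔ ∃ s ∈ Set.Icc (0 : ℝ) 1, ∃ t ∈ Set.Icc (0 : ℝ) 1,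
      y = K.coneMap i s t := by
    intro y
    rw [hC, convexHull_insert (Set.insert_nonempty _ _), convexHull_pair, mem_convexJoin]
    constructor
    · rintro ⟨a, ha, b, hb, hy⟩
      rw [Set.mem_singleton_iff] at ha
      subst ha
      rw [segment_eq_image_lineMap] at hb
      obtain ⟨t, ht, rfl⟩ := hb
      rw [segment_eq_image'] at hy
      obtain ⟨s, hs, rfl⟩ := hy
      exact ⟨s, hs, t, ht, rfl⟩
    · rintro ⟨s, hs, t, ht, rfl⟩
      refine ⟨K.centre, rfl, K.edgeMap i t, K.edgeMap_mem_edge i ht, ?_⟩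
      rw [segment_eq_image']
      exact ⟨s, hs, rfl⟩
  have h1 : K.openTri i =ᵐ[volume] C := by
    refine (ae_eq_set (μ := volume)).mpr ⟨?_, ?_⟩
    · rw [Set.sdiff_eq_empty.mpr, measure_empty]
      rintro _ ⟨z, ⟨hz1, hz2⟩, rfl⟩
      exact (hmem _).mpr ⟨z.1, ⟨hz1.1.le, hz1.2.le⟩, z.2, ⟨hz2.1.le, hz2.2.le⟩, rfl⟩
    · refine measure_mono_null (t := (segment ℝ K.centre (K.vertex i)
        ∪ segment ℝ K.centre (K.vertex (i + 1))) ∪ segment ℝ (K.vertex i) (K.vertex (i + 1)))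
        ?_ (measure_union_null (measure_union_null (volume_segment _ _) (volume_segment _ _))
          (volume_segment _ _))
      rintro y ⟨hy, hy'⟩
      obtain ⟨s, hs, t, ht, rfl⟩ := (hmem y).mp hy
      rcases eq_or_ne s 1 with rfl | hs1
      · right
        have : K.coneMap i 1 t = K.edgeMap i t := by simp [coneMap]
        rw [this]
        exact K.edgeMap_mem_edge i ht
      · left
        exact K.coneMap_mem_segment_of_boundary i hs ht (fun h => hy' ⟨(s, t), h, rfl⟩) hs1
  have h2 : interior C =ᵐ[volume] C :=
    interior_ae_eq_of_null_frontier ((convex_convexHull ℝ _).addHaar_frontier volume)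
  exact h1.trans h2.symm

end PolygonalElement

/-! ### The divergence theorem -/

/-- The divergence of a plane vector field. -/
def divergence (η : Plane → Plane) (x : Plane) : ℝ :=
  ∑ j, fderiv ℝ η x (EuclideanSpace.single j 1) j

theorem continuous_divergence {η : Plane → Plane} (hη : ContDiff ℝ 1 η) :
    Continuous (divergence η) := by
  refine continuous_finsetSum _ fun j _ => ?_
  exact (EuclideanSpace.proj j : Plane →L[ℝ] ℝ).continuous.comp
    ((hη.continuous_fderiv (by simp)).clm_apply continuous_const)

/-- The coordinates of the plane as a pair. -/
def planeEquiv : Plane ≃ᵐ ℝ × ℝ :=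
  (MeasurableEquiv.toLp 2 (Fin 2 → ℝ)).symm.trans MeasurableEquiv.finTwoArrow

theorem planeEquiv_apply (x : Plane) : planeEquiv x = (x 0, x 1) := rfl

theorem measurePreserving_planeEquiv : MeasurePreserving planeEquiv :=
  (volume_preserving_finTwoArrow ℝ).comp
    (EuclideanSpace.volume_preserving_symm_measurableEquiv_toLp (Fin 2))

namespace PolygonalElement

variable (K : PolygonalElement)

theorem coneMap_apply (i : Fin (K.m + 3)) (s t : ℝ) (j : Fin 2) :
    K.coneMap i s t j = K.centre j
      + s * ((K.vertex i j - K.centre j) + t * (K.vertex (i + 1) j - K.vertex i j)) := by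
  simp only [coneMap, edgeMap, AffineMap.lineMap_apply, PiLp.add_apply, PiLp.smul_apply,
    PiLp.sub_apply, smul_eq_mul, vadd_eq_add, vsub_eq_sub]
  ring

theorem contDiff_coneMap (i : Fin (K.m + 3)) :
    ContDiff ℝ ∞ (fun z : ℝ × ℝ => K.coneMap i z.1 z.2) := by
  rw [contDiff_piLp]
  intro j
  simp only [coneMap_apply]
  fun_prop

theorem measurableSet_openTri (i : Fin (K.m + 3)) : MeasurableSet (K.openTri i) :=
  (measurableSet_Ioo.prod measurableSet_Ioo).image_of_continuousOn_injOn
    (K.contDiff_coneMap i).continuous.continuousOn (K.injOn_coneMap i)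

/-- Change of variables from a triangle of the subtriangulation to the unit square. -/
theorem integral_openTri (i : Fin (K.m + 3)) (f : Plane → ℝ) :
    ∫ x in K.openTri i, f x
      = ∫ z in Set.Ioo (0 : ℝ) 1 ×ˢ Set.Ioo (0 : ℝ) 1,
          |z.1 * K.jac i| * f (K.coneMap i z.1 z.2) := by
  set p := K.vertex i - K.centre with hp
  set q := K.vertex (i + 1) - K.vertex i with hq
  set F : ℝ × ℝ → ℝ × ℝ := fun z => planeEquiv (K.coneMap i z.1 z.2) with hF
  set F' : ℝ × ℝ → ℝ × ℝ →L[ℝ] ℝ × ℝ := fun z =>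
    (Matrix.toLin (.finTwoProd ℝ) (.finTwoProd ℝ)
      !![p 0 + z.2 * q 0, z.1 * q 0; p 1 + z.2 * q 1, z.1 * q 1]).toContinuousLinearMap with hF'
  have hFd : ∀ z, HasFDerivAt F (F' z) z := by
    intro z
    have hFeq : F = fun z : ℝ × ℝ => (K.centre 0 + z.1 * (p 0 + z.2 * q 0),
        K.centre 1 + z.1 * (p 1 + z.2 * q 1)) := by
      funext z
      simp only [hF, planeEquiv_apply, coneMap_apply]
      rfl
    have hd : ∀ j : Fin 2, HasFDerivAt (fun z : ℝ × ℝ => K.centre j + z.1 * (p j + z.2 * q j))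
        ((p j + z.2 * q j) • ContinuousLinearMap.fst ℝ ℝ ℝ
          + (z.1 * q j) • ContinuousLinearMap.snd ℝ ℝ ℝ) z := by
      intro j
      have h1 : HasFDerivAt (fun z : ℝ × ℝ => p j + z.2 * q j)
          (q j • ContinuousLinearMap.snd ℝ ℝ ℝ) z :=
        (hasFDerivAt_snd.mul_const (q j)).const_add (p j)
      refine ((hasFDerivAt_fst.mul h1).const_add (K.centre j)).congr_fderiv ?_
      ext <;> simp
    rw [hFeq]
    simp only [hF']
    rw [Matrix.toLin_finTwoProd_toContinuousLinearMap]
    exact (hd 0).prodMk (hd 1)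
  have hdet : ∀ z, (F' z).det = z.1 * K.jac i := by
    intro z
    simp only [hF', LinearMap.det_toContinuousLinearMap, LinearMap.det_toLin,
      Matrix.det_fin_two_of, jac, cross, hp, hq, PiLp.sub_apply]
    ring
  have hpre : planeEquiv ⁻¹' (F '' (Set.Ioo 0 1 ×ˢ Set.Ioo 0 1)) = K.openTri i := by
    rw [hF, ← Set.image_image planeEquiv (fun z : ℝ × ℝ => K.coneMap i z.1 z.2),
      Set.preimage_image_eq _ planeEquiv.injective]
    rfl
  have h1 := measurePreserving_planeEquiv.setIntegral_preimage_emb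
    planeEquiv.measurableEmbedding (fun y => f (planeEquiv.symm y))
    (F '' (Set.Ioo 0 1 ×ˢ Set.Ioo 0 1))
  rw [hpre] at h1
  simp only [MeasurableEquiv.symm_apply_apply] at h1
  rw [h1, integral_image_eq_integral_abs_det_fderiv_smul volume
    (measurableSet_Ioo.prod measurableSet_Ioo) (fun z _ => (hFd z).hasFDerivWithinAt)
    (fun z hz w hw h => K.injOn_coneMap i hz hw (planeEquiv.injective h))]
  simp only [hdet, smul_eq_mul, hF, MeasurableEquiv.symm_apply_apply]

/-- The divergence theorem on a triangle of the subtriangulation: the flux through the outer edge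
plus the fluxes through the two sides that issue from the centre. -/
theorem integral_openTri_divergence (i : Fin (K.m + 3)) {η : Plane → Plane}
    (hη : ContDiff ℝ 1 η) :
    ∫ x in K.openTri i, divergence η x = K.orient *
      ((∫ s in (0 : ℝ)..1, cross (K.vertex (i + 1) - K.centre)
          (η (K.centre + s • (K.vertex (i + 1) - K.centre))))
        - (∫ s in (0 : ℝ)..1, cross (K.vertex i - K.centre)
          (η (K.centre + s • (K.vertex i - K.centre))))
        + ∫ t in (0 : ℝ)..1, cross (η (K.edgeMap i t)) (K.vertex (i + 1) - K.vertex i)) := by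
  set p := K.vertex i - K.centre with hp
  set q := K.vertex (i + 1) - K.vertex i with hq
  set Φ : ℝ × ℝ → Plane := fun z => K.coneMap i z.1 z.2 with hΦ
  have hΦc : ContDiff ℝ ∞ Φ := K.contDiff_coneMap i
  have hηd : Differentiable ℝ η := hη.differentiable (by simp)
  -- the components of the Piola transform of `η`
  set f : ℝ × ℝ → ℝ := fun z => z.1 * cross (η (Φ z)) q with hf
  set g : ℝ × ℝ → ℝ := fun z => cross (p + z.2 • q) (η (Φ z)) with hg
  have hfc : ContDiff ℝ 1 f := by
    have h1 : ContDiff ℝ 1 Φ := hΦc.of_le (by exact_mod_cast le_top)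
    have h2 : ∀ j, ContDiff ℝ 1 (fun z => η (Φ z) j) := fun j =>
      (contDiff_piLp 2).mp (hη.comp h1) j
    simp only [hf, cross]
    exact contDiff_fst.mul (((h2 0).mul contDiff_const).sub ((h2 1).mul contDiff_const))
  have hgc : ContDiff ℝ 1 g := by
    have h1 : ContDiff ℝ 1 Φ := hΦc.of_le (by exact_mod_cast le_top)
    have h2 : ∀ j, ContDiff ℝ 1 (fun z => η (Φ z) j) := fun j =>
      (contDiff_piLp 2).mp (hη.comp h1) j
    simp only [hg, cross, PiLp.add_apply, PiLp.smul_apply, smul_eq_mul]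
    exact ((contDiff_const.add (contDiff_snd.mul contDiff_const)).mul (h2 1)).sub
      ((contDiff_const.add (contDiff_snd.mul contDiff_const)).mul (h2 0))
  have hΦs : ∀ s t, HasDerivAt (fun s => Φ (s, t)) (p + t • q) s := by
    intro s t
    have : (fun s => Φ (s, t)) = fun s => K.centre + s • (p + t • q) := by
      funext s
      ext j
      simp only [hΦ, coneMap_apply, hp, hq, PiLp.add_apply, PiLp.smul_apply, PiLp.sub_apply,
        smul_eq_mul]
    rw [this]
    simpa using ((hasDerivAt_id s).smul_const (p + t • q)).const_add K.centre
  have hΦt : ∀ s t, HasDerivAt (fun t => Φ (s, t)) (s • q) t := by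
    intro s t
    have : (fun t => Φ (s, t)) = fun t => (K.centre + s • p) + t • (s • q) := by
      funext t
      ext j
      simp [hΦ, coneMap_apply, hp, hq]
      ring
    rw [this]
    simpa using ((hasDerivAt_id t).smul_const (s • q)).const_add (K.centre + s • p)
  have hdir : ∀ x v : Plane, ∀ j, fderiv ℝ η x v j
      = v 0 * fderiv ℝ η x (EuclideanSpace.single 0 1) j
        + v 1 * fderiv ℝ η x (EuclideanSpace.single 1 1) j := by
    intro x v j
    have hv : v = v 0 • EuclideanSpace.single 0 (1 : ℝ) + v 1 • EuclideanSpace.single 1 (1 : ℝ) := by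
      ext k
      fin_cases k <;> simp
    conv_lhs => rw [hv]
    simp
  -- the Piola identity
  have hpiola : ∀ z : ℝ × ℝ, fderiv ℝ f z (1, 0) + fderiv ℝ g z (0, 1)
      = z.1 * K.jac i * divergence η (Φ z) := by
    rintro ⟨s, t⟩
    have e1 : HasDerivAt (fun s => f (s, t)) (fderiv ℝ f (s, t) (1, 0)) s := by
      have h1 : HasDerivAt (fun s : ℝ => (s, t)) ((1 : ℝ), (0 : ℝ)) s :=
        (hasDerivAt_id s).prodMk (hasDerivAt_const s t)
      exact ((hfc.differentiable (by simp)) (s, t)).hasFDerivAt.comp_hasDerivAt s h1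
    have e2 : HasDerivAt (fun t => g (s, t)) (fderiv ℝ g (s, t) (0, 1)) t := by
      have h1 : HasDerivAt (fun t : ℝ => (s, t)) ((0 : ℝ), (1 : ℝ)) t :=
        (hasDerivAt_const t s).prodMk (hasDerivAt_id t)
      exact ((hgc.differentiable (by simp)) (s, t)).hasFDerivAt.comp_hasDerivAt t h1
    have c1 : ∀ j, HasDerivAt (fun s => η (Φ (s, t)) j)
        (fderiv ℝ η (Φ (s, t)) (p + t • q) j) s := fun j =>
      (EuclideanSpace.proj j : Plane →L[ℝ] ℝ).hasFDerivAt.comp_hasDerivAt s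
        ((hηd (Φ (s, t))).hasFDerivAt.comp_hasDerivAt s (hΦs s t))
    have c2 : ∀ j, HasDerivAt (fun t => η (Φ (s, t)) j)
        (fderiv ℝ η (Φ (s, t)) (s • q) j) t := fun j =>
      (EuclideanSpace.proj j : Plane →L[ℝ] ℝ).hasFDerivAt.comp_hasDerivAt t
        ((hηd (Φ (s, t))).hasFDerivAt.comp_hasDerivAt t (hΦt s t))
    have d1 : HasDerivAt (fun s => f (s, t)) _ s :=
      (hasDerivAt_id s).mul (((c1 0).mul_const (q 1)).sub ((c1 1).mul_const (q 0)))
    have l : ∀ j, HasDerivAt (fun t : ℝ => p j + t * q j) (q j) t := fun j => by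
      simpa using ((hasDerivAt_id t).mul_const (q j)).const_add (p j)
    have d2 : HasDerivAt (fun t => g (s, t)) _ t := ((l 0).mul (c2 1)).sub ((l 1).mul (c2 0))
    rw [e1.unique d1, e2.unique d2]
    have hj : K.jac i = p 0 * q 1 - p 1 * q 0 := by
      simp only [jac, cross, hp, hq, PiLp.sub_apply]
      ring
    simp only [hdir _ (p + t • q), hdir _ (s • q), hj, divergence, Fin.sum_univ_two,
      PiLp.add_apply, PiLp.smul_apply, smul_eq_mul, id, cross]
    ring
  have hcont : Continuous fun z : ℝ × ℝ => fderiv ℝ f z (1, 0) + fderiv ℝ g z (0, 1) :=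
    ((hfc.continuous_fderiv (by simp)).clm_apply continuous_const).add
      ((hgc.continuous_fderiv (by simp)).clm_apply continuous_const)
  have hdivthm := integral_divergence_prod_Icc_of_hasFDerivAt_of_le f g (fderiv ℝ f) (fderiv ℝ g)
    (0, 0) (1, 1) (by simp) hfc.continuous.continuousOn hgc.continuous.continuousOn
    (fun z _ => ((hfc.differentiable (by simp)) z).hasFDerivAt)
    (fun z _ => ((hgc.differentiable (by simp)) z).hasFDerivAt)
    (hcont.continuousOn.integrableOn_compact isCompact_Icc)
  have hsq : (Set.Ioo (0 : ℝ) 1 ×ˢ Set.Ioo (0 : ℝ) 1 : Set (ℝ × ℝ))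
      =ᵐ[volume] Set.Icc ((0 : ℝ), (0 : ℝ)) (1, 1) := by
    rw [← Set.Icc_prod_Icc]
    exact Measure.set_prod_ae_eq Ioo_ae_eq_Icc Ioo_ae_eq_Icc
  have e1 : ∫ z in Set.Ioo (0 : ℝ) 1 ×ˢ Set.Ioo (0 : ℝ) 1,
      |z.1 * K.jac i| * divergence η (K.coneMap i z.1 z.2)
      = ∫ z in Set.Ioo (0 : ℝ) 1 ×ˢ Set.Ioo (0 : ℝ) 1,
        K.orient * (fderiv ℝ f z (1, 0) + fderiv ℝ g z (0, 1)) := by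
    refine setIntegral_congr_fun (measurableSet_Ioo.prod measurableSet_Ioo) fun z hz => ?_
    simp only [hpiola, abs_mul, K.abs_jac, abs_of_pos hz.1.1]
    ring
  rw [integral_openTri, e1, integral_const_mul, setIntegral_congr_set hsq, hdivthm]
  congr 1
  have hb1 : ∀ s, g (s, 1) = cross (K.vertex (i + 1) - K.centre)
      (η (K.centre + s • (K.vertex (i + 1) - K.centre))) := by
    intro s
    have h1 : p + (1 : ℝ) • q = K.vertex (i + 1) - K.centre := by rw [hp, hq]; module
    simp only [hg, h1, hΦ, coneMap, edgeMap_one]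
  have hb0 : ∀ s, g (s, 0) = cross p (η (K.centre + s • p)) := by
    intro s
    simp only [hg, zero_smul, add_zero, hΦ, coneMap, edgeMap_zero, hp]
  have hf1 : ∀ t, f (1, t) = cross (η (K.edgeMap i t)) q := by
    intro t
    simp [hf, hΦ, coneMap]
  have hf0 : ∀ t, f (0, t) = 0 := by
    intro t
    simp [hf]
  simp only [hb1, hb0, hf1, hf0, intervalIntegral.integral_zero, sub_zero]

theorem continuous_cross {X : Type*} [TopologicalSpace X] {a b : X → Plane} (ha : Continuous a)
    (hb : Continuous b) : Continuous fun x => cross (a x) (b x) := by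
  unfold cross
  fun_prop

/-- The divergence theorem for a field that is smooth on every triangle and has continuous normal
components across the sides that issue from the centre. -/
theorem sum_integral_divergence (η : Fin (K.m + 3) → Plane → Plane)
    (hη : ∀ i, ContDiff ℝ 1 (η i))
    (hmatch : ∀ i, ∀ s : ℝ, cross (K.vertex (i + 1) - K.centre)
        (η i (K.centre + s • (K.vertex (i + 1) - K.centre)))
      = cross (K.vertex (i + 1) - K.centre)
        (η (i + 1) (K.centre + s • (K.vertex (i + 1) - K.centre)))) :
    ∑ i, ∫ x in K.openTri i, divergence (η i) x
      = K.orient * ∑ i, ∫ t in (0 : ℝ)..1,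
          cross (η i (K.edgeMap i t)) (K.vertex (i + 1) - K.vertex i) := by
  simp only [K.integral_openTri_divergence _ (hη _), ← Finset.mul_sum, Finset.sum_add_distrib,
    Finset.sum_sub_distrib, hmatch]
  rw [K.sum_shift fun i => ∫ s in (0 : ℝ)..1, cross (K.vertex i - K.centre)
    (η i (K.centre + s • (K.vertex i - K.centre)))]
  ring

/-- An integral over the polygon is the sum of the integrals over the triangles. -/
theorem integral_carrier_eq_sum {f : Plane → ℝ} (hf : IntegrableOn f K.carrier) :
    ∫ x in K.carrier, f x = ∑ i, ∫ x in K.openTri i, f x := by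
  rw [setIntegral_congr_set K.carrier_ae_eq, integral_iUnion_fintype K.measurableSet_openTri
    (fun i j hij => K.openTri_disjoint hij) fun i => hf.mono_set (K.openTri_subset i)]

theorem integrableOn_of_continuous {f : Plane → ℝ} (hf : Continuous f) :
    IntegrableOn f K.carrier :=
  (hf.continuousOn.integrableOn_compact K.bounded.isCompact_closure).mono_set subset_closure

/-- The divergence theorem on the polygon. -/
theorem integral_divergence {η : Plane → Plane} (hη : ContDiff ℝ 1 η) :
    ∫ x in K.carrier, divergence η x = K.orient * ∑ i, ∫ t in (0 : ℝ)..1,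
      cross (η (K.edgeMap i t)) (K.vertex (i + 1) - K.vertex i) := by
  rw [K.integral_carrier_eq_sum (K.integrableOn_of_continuous (continuous_divergence hη)),
    K.sum_integral_divergence (fun _ => η) (fun _ => hη) fun _ _ => rfl]

end PolygonalElement

/-! ### Traces -/

theorem tendsto_integral_inner {α E : Type*} [MeasurableSpace α] [NormedAddCommGroup E]
    [InnerProductSpace ℝ E] {μ : Measure α} {a b : ℕ → α → E} {f g : α → E}
    (ha : ∀ n, MemLp (a n) 2 μ) (hb : ∀ n, MemLp (b n) 2 μ) (hf : MemLp f 2 μ) (hg : MemLp g 2 μ)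
    (haf : Tendsto (fun n => eLpNorm (fun x => a n x - f x) 2 μ) atTop (𝓝 0))
    (hbg : Tendsto (fun n => eLpNorm (fun x => b n x - g x) 2 μ) atTop (𝓝 0)) :
    Tendsto (fun n => ∫ x, inner ℝ (a n x) (b n x) ∂μ) atTop (𝓝 (∫ x, inner ℝ (f x) (g x) ∂μ)) := by
  have key : ∀ {u v : α → E} (hu : MemLp u 2 μ) (hv : MemLp v 2 μ),
      ∫ x, inner ℝ (u x) (v x) ∂μ = inner ℝ (hu.toLp u) (hv.toLp v) := by
    intro u v hu hv
    rw [L2.inner_def]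
    apply integral_congr_ae
    filter_upwards [hu.coeFn_toLp, hv.coeFn_toLp] with x h1 h2
    rw [h1, h2]
  simp only [key (ha _) (hb _), key hf hg]
  exact ((Lp.tendsto_Lp_iff_tendsto_eLpNorm'' a ha f hf).mpr haf).inner
    ((Lp.tendsto_Lp_iff_tendsto_eLpNorm'' b hb g hg).mpr hbg)

theorem tendsto_integral_mul {α : Type*} [MeasurableSpace α] {μ : Measure α} {a b : ℕ → α → ℝ}
    {f g : α → ℝ} (ha : ∀ n, MemLp (a n) 2 μ) (hb : ∀ n, MemLp (b n) 2 μ) (hf : MemLp f 2 μ)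
    (hg : MemLp g 2 μ)
    (haf : Tendsto (fun n => eLpNorm (fun x => a n x - f x) 2 μ) atTop (𝓝 0))
    (hbg : Tendsto (fun n => eLpNorm (fun x => b n x - g x) 2 μ) atTop (𝓝 0)) :
    Tendsto (fun n => ∫ x, a n x * b n x ∂μ) atTop (𝓝 (∫ x, f x * g x ∂μ)) := by
  have := tendsto_integral_inner hb ha hg hf hbg haf
  simpa using this

theorem tendsto_eLpNorm_sub_self {α E : Type*} [MeasurableSpace α] [NormedAddCommGroup E]
    {μ : Measure α} (f : α → E) :
    Tendsto (fun _ : ℕ => eLpNorm (fun x => f x - f x) 2 μ) atTop (𝓝 0) := by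
  simp

theorem inner_gradient_eq (f : Plane → ℝ) (x v : Plane) :
    inner ℝ v (gradient f x) = fderiv ℝ f x v := by
  rw [inner_gradient_right]
  simp

theorem divergence_smul {w : Plane → ℝ} {η : Plane → Plane} {x : Plane}
    (hw : DifferentiableAt ℝ w x) (hη : DifferentiableAt ℝ η x) :
    divergence (fun y => w y • η y) x
      = inner ℝ (η x) (gradient w x) + w x * divergence η x := by
  simp only [divergence, fderiv_fun_smul hw hη, PiLp.inner_apply, gradient_apply]
  simp [Fin.sum_univ_two]
  ring

theorem divergence_sub_const (c x : Plane) : divergence (fun y => y - c) x = 2 := by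
  simp only [divergence, fderiv_sub_const, fderiv_fun_id]
  simp

namespace PolygonalElement

variable {K : PolygonalElement}

theorem edgeLength_pos (i : Fin (K.m + 3)) : 0 < K.edgeLength i :=
  dist_pos.mpr (K.vertex_add_one_ne i).symm

theorem memLp_carrier {E : Type*} [NormedAddCommGroup E] [SecondCountableTopology E]
    {f : Plane → E} (hf : Continuous f) : MemLp f 2 (volume.restrict K.carrier) :=
  memLp_of_continuous K.isOpen.measurableSet K.bounded hf

theorem memLp_Icc {f : ℝ → ℝ} (hf : Continuous f) :
    MemLp f 2 (volume.restrict (Set.Icc (0 : ℝ) 1)) := by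
  obtain ⟨C, hC⟩ := (isCompact_Icc (a := (0 : ℝ)) (b := 1)).exists_bound_of_continuousOn
    hf.continuousOn
  refine MemLp.of_bound hf.aestronglyMeasurable C ?_
  filter_upwards [ae_restrict_mem measurableSet_Icc] with x hx using hC x hx

theorem intervalIntegral_eq_Icc (f : ℝ → ℝ) :
    ∫ t in (0 : ℝ)..1, f t = ∫ t in Set.Icc (0 : ℝ) 1, f t := by
  rw [intervalIntegral.integral_of_le zero_le_one, integral_Icc_eq_integral_Ioc]

theorem continuous_onBoundary {w : Plane → ℝ} (hw : Continuous w) (i : Fin (K.m + 3)) :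
    Continuous (K.onBoundary w i) :=
  hw.comp (K.continuous_edgeMap i)

/-- An integration by parts formula for functions that are smooth up to the boundary extends to
all functions with a trace. -/
theorem green_of_isTrace {τ : Plane → Plane} {d : Plane → ℝ} {ν : Fin (K.m + 3) → ℝ → ℝ}
    (hτ : MemLp τ 2 (volume.restrict K.carrier)) (hd : MemLp d 2 (volume.restrict K.carrier))
    (hν : ∀ i, Continuous (ν i))
    (hgreen : ∀ w : Plane → ℝ, ContDiff ℝ ∞ w →
      (∫ x in K.carrier, inner ℝ (τ x) (gradient w x)) + ∫ x in K.carrier, d x * w x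
        = K.boundaryInner ν (K.onBoundary w))
    {v : H1 K.carrier} {g : Fin (K.m + 3) → ℝ → ℝ} (hg : ∀ i, Continuous (g i))
    (h : K.IsTrace v g) :
    (∫ x in K.carrier, inner ℝ (τ x) (H1grad v x)) + ∫ x in K.carrier, d x * H1val v x
      = K.boundaryInner ν g := by
  obtain ⟨w, hw, h1, h2, h3⟩ := h
  have t1 := tendsto_integral_inner (fun _ => hτ)
    (fun n => memLp_carrier (K := K) (continuous_gradient (hw n))) hτ (Lp.memLp (H1grad v))
    (tendsto_eLpNorm_sub_self τ) h2
  have t2 := tendsto_integral_mul (fun _ => hd)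
    (fun n => memLp_carrier (K := K) (hw n).continuous) hd (Lp.memLp (H1val v))
    (tendsto_eLpNorm_sub_self d) h1
  have t3 : Tendsto (fun n => K.boundaryInner ν (K.onBoundary (w n))) atTop
      (𝓝 (K.boundaryInner ν g)) := by
    unfold boundaryInner
    refine tendsto_finsetSum _ fun i _ => Tendsto.const_mul _ ?_
    simp only [intervalIntegral_eq_Icc]
    exact tendsto_integral_mul (fun _ => memLp_Icc (hν i))
      (fun n => memLp_Icc (continuous_onBoundary (hw n).continuous i)) (memLp_Icc (hν i))
      (memLp_Icc (hg i)) (tendsto_eLpNorm_sub_self (ν i)) (h3 i)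
  refine tendsto_nhds_unique (t1.add t2) (t3.congr fun n => ?_)
  exact (hgreen (w n) (hw n)).symm

/-- Testing with a field that is smooth up to the boundary sees only the trace on the boundary;
in particular the extension by zero of a function with zero trace is weakly differentiable. -/
theorem integral_of_trace_zero {v : H1 K.carrier} (h : K.IsTrace v 0) {η : Plane → Plane}
    (hη : ContDiff ℝ ∞ η) :
    (∫ x in K.carrier, inner ℝ (η x) (H1grad v x))
      + ∫ x in K.carrier, divergence η x * H1val v x = 0 := by
  have hη1 : ContDiff ℝ 1 η := hη.of_le (by exact_mod_cast le_top)
  have hdiv : Continuous (divergence η) := continuous_divergence hη1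
  set ν : Fin (K.m + 3) → ℝ → ℝ := fun i t => K.orient *
    cross (η (K.edgeMap i t)) (K.vertex (i + 1) - K.vertex i) / K.edgeLength i with hν
  have hνc : ∀ i, Continuous (ν i) := fun i =>
    (continuous_const.mul (continuous_cross (hη.continuous.comp (K.continuous_edgeMap i))
      continuous_const)).div_const _
  rw [green_of_isTrace (K := K) (memLp_carrier hη.continuous) (memLp_carrier hdiv) hνc ?_
    (g := 0) (fun i => continuous_zero) h]
  · simp [boundaryInner]
  · intro w hw
    have hw1 : ContDiff ℝ 1 w := hw.of_le (by exact_mod_cast le_top)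
    have hgauss := K.integral_divergence (hw1.smul hη1)
    have e : ∀ x, divergence (fun y => w y • η y) x
        = inner ℝ (η x) (gradient w x) + divergence η x * w x := fun x => by
      rw [divergence_smul (hw.differentiable (by simp) x) (hη.differentiable (by simp) x)]
      ring
    have hgw := continuous_gradient hw
    simp only [Pi.smul_def', e] at hgauss
    have i1 : IntegrableOn (fun x => inner ℝ (η x) (gradient w x)) K.carrier :=
      K.integrableOn_of_continuous (hη.continuous.inner hgw)
    have i2 : IntegrableOn (fun x => divergence η x * w x) K.carrier :=
      K.integrableOn_of_continuous (hdiv.mul hw.continuous)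
    rw [integral_add i1 i2] at hgauss
    rw [hgauss, boundaryInner, Finset.mul_sum]
    refine Finset.sum_congr rfl fun i _ => ?_
    rw [← intervalIntegral.integral_const_mul, ← intervalIntegral.integral_const_mul]
    refine intervalIntegral.integral_congr fun t _ => ?_
    have := (edgeLength_pos (K := K) i).ne'
    simp only [hν, onBoundary, cross, PiLp.smul_apply, smul_eq_mul]
    field_simp

/-- The Rellich-type identity obtained from the radial field `w² (x - c)`: it controls the trace of
a function by its `H¹` norm, and the function by its trace and gradient. -/
theorem radial_identity {v : H1 K.carrier} {g : Fin (K.m + 3) → ℝ → ℝ}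
    (hg : ∀ i, Continuous (g i)) (h : K.IsTrace v g) :
    2 * (∫ x in K.carrier, H1val v x * H1val v x)
      + 2 * ∫ x in K.carrier, inner ℝ (H1val v x • (x - K.centre)) (H1grad v x)
      = ∑ i, |K.jac i| * ∫ t in (0 : ℝ)..1, g i t * g i t := by
  obtain ⟨w, hw, h1, h2, h3⟩ := h
  have hwL : ∀ n, MemLp (w n) 2 (volume.restrict K.carrier) := fun n =>
    memLp_carrier (hw n).continuous
  obtain ⟨C, hC⟩ := K.bounded.isCompact_closure.exists_bound_of_continuousOn
    (f := fun x => x - K.centre) (by fun_prop)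
  have hbound : ∀ u : Plane → ℝ, ∀ᵐ x ∂(volume.restrict K.carrier),
      ‖u x • (x - K.centre)‖ ≤ C * ‖u x‖ := by
    intro u
    filter_upwards [ae_restrict_mem K.isOpen.measurableSet] with x hx
    rw [norm_smul, mul_comm]
    exact mul_le_mul_of_nonneg_right (hC x (subset_closure hx)) (norm_nonneg _)
  have hmul : ∀ {u : Plane → ℝ}, MemLp u 2 (volume.restrict K.carrier) →
      MemLp (fun x => u x • (x - K.centre)) 2 (volume.restrict K.carrier) := fun {u} hu =>
    hu.of_le_mul (hu.1.smul (by fun_prop : Continuous fun x : Plane =>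
      x - K.centre).aestronglyMeasurable) (hbound u)
  have t1 := tendsto_integral_mul hwL hwL (Lp.memLp (H1val v)) (Lp.memLp (H1val v)) h1 h1
  have t2 := tendsto_integral_inner (fun n => hmul (hwL n))
    (fun n => memLp_carrier (K := K) (continuous_gradient (hw n))) (hmul (Lp.memLp (H1val v)))
    (Lp.memLp (H1grad v)) (by
      have hz : Tendsto (fun n => ENNReal.ofReal C * eLpNorm (fun x => w n x - H1val v x) 2
          (volume.restrict K.carrier)) atTop (𝓝 0) := by
        simpa using ENNReal.Tendsto.const_mul h1 (Or.inr ENNReal.ofReal_ne_top)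
      refine tendsto_of_tendsto_of_tendsto_of_le_of_le tendsto_const_nhds hz
        (fun _ => zero_le) fun n => ?_
      refine eLpNorm_le_mul_eLpNorm_of_ae_le_mul ?_ 2
      filter_upwards [hbound fun x => w n x - H1val v x] with x hx
      rw [← sub_smul]
      exact hx) h2
  have t3 : Tendsto (fun n => ∑ i, |K.jac i| * ∫ t in (0 : ℝ)..1,
      K.onBoundary (w n) i t * K.onBoundary (w n) i t) atTop
      (𝓝 (∑ i, |K.jac i| * ∫ t in (0 : ℝ)..1, g i t * g i t)) := by
    refine tendsto_finsetSum _ fun i _ => Tendsto.const_mul _ ?_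
    simp only [intervalIntegral_eq_Icc]
    exact tendsto_integral_mul
      (fun n => memLp_Icc (continuous_onBoundary (hw n).continuous i))
      (fun n => memLp_Icc (continuous_onBoundary (hw n).continuous i)) (memLp_Icc (hg i))
      (memLp_Icc (hg i)) (h3 i) (h3 i)
  refine tendsto_nhds_unique ((t1.const_mul 2).add (t2.const_mul 2)) (t3.congr fun n => ?_)
  have hwd : Differentiable ℝ (w n) := (hw n).differentiable (by simp)
  have hw1 : ContDiff ℝ 1 (w n) := (hw n).of_le (by exact_mod_cast le_top)
  have hgauss := K.integral_divergence (η := fun y => (w n y * w n y) • (y - K.centre))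
    ((hw1.mul hw1).smul (contDiff_id.sub contDiff_const))
  have e : ∀ x, divergence (fun y => (w n y * w n y) • (y - K.centre)) x
      = 2 * (w n x * w n x) + 2 * inner ℝ (w n x • (x - K.centre)) (gradient (w n) x) := fun x => by
    rw [divergence_smul (w := fun y => w n y * w n y) ((hwd x).fun_mul (hwd x)) (by fun_prop),
      divergence_sub_const,
      inner_gradient_eq, inner_gradient_eq, fderiv_fun_mul (hwd x) (hwd x)]
    simp
    ring
  have hgw := continuous_gradient (hw n)
  have hwc := (hw n).continuous
  simp only [e] at hgauss
  rw [integral_add, integral_const_mul, integral_const_mul] at hgauss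
  · rw [hgauss, Finset.mul_sum]
    refine Finset.sum_congr rfl fun i _ => ?_
    rw [K.abs_jac, mul_assoc, ← intervalIntegral.integral_const_mul (K.jac i)]
    congr 1
    refine intervalIntegral.integral_congr fun t _ => ?_
    have := K.edgeMap_sub_centre i t
    simp only [this, onBoundary, cross, jac, PiLp.smul_apply, PiLp.add_apply, PiLp.sub_apply,
      smul_eq_mul]
    ring
  · exact K.integrableOn_of_continuous (by fun_prop)
  · exact K.integrableOn_of_continuous (continuous_const.mul
      (Continuous.inner (hwc.smul (continuous_id.sub continuous_const)) hgw))

theorem polynomial_eq_zero_of_integral {q : Polynomial ℝ}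
    (h : ∫ t in (0 : ℝ)..1, q.eval t * q.eval t = 0) : q = 0 := by
  refine Polynomial.eq_zero_of_infinite_isRoot q
    ((Set.Icc_infinite (zero_lt_one' ℝ)).mono fun t ht => ?_)
  by_contra hne
  have hpos := intervalIntegral.integral_pos (zero_lt_one' ℝ)
    (f := fun t => q.eval t * q.eval t) (by fun_prop) (fun t _ => mul_self_nonneg _)
    ⟨t, ht, mul_self_pos.mpr hne⟩
  exact hpos.ne' h

/-- A function with zero gradient and zero trace vanishes. -/
theorem eq_zero_of_grad_eq_zero {v : H1 K.carrier} (h : K.IsTrace v 0) (hv : H1grad v = 0) :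
    v = 0 := by
  have hr := radial_identity (g := 0) (fun i => continuous_zero) h
  have hz : ∫ x in K.carrier, inner ℝ (H1val v x • (x - K.centre)) (H1grad v x) = 0 := by
    apply integral_eq_zero_of_ae
    rw [hv]
    filter_upwards [Lp.coeFn_zero Plane 2 (volume.restrict K.carrier)] with x hx
    rw [hx]
    simp
  have hn : inner ℝ (H1val v) (H1val v) = 0 := by
    rw [L2.inner_def]
    simp only [hz, Pi.zero_apply, mul_zero, intervalIntegral.integral_zero,
      Finset.sum_const_zero, add_zero] at hr
    simp only [RCLike.inner_apply, conj_trivial]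
    linarith
  exact Subtype.ext (Prod.ext (inner_self_eq_zero.mp hn) hv)

/-- Only the zero function is a trace of zero, by the radial identity. -/
theorem eq_zero_of_isTrace_zero {q : Fin (K.m + 3) → Polynomial ℝ}
    (h : K.IsTrace 0 (polyOnBoundary q)) : q = 0 := by
  have hr := radial_identity (fun i => (q i).continuous) h
  have e1 : ∫ x in K.carrier, H1val (0 : H1 K.carrier) x * H1val (0 : H1 K.carrier) x = 0 := by
    apply integral_eq_zero_of_ae
    filter_upwards [Lp.coeFn_zero ℝ 2 (volume.restrict K.carrier)] with x hx
    change (0 : L2 K.carrier) x * (0 : L2 K.carrier) x = 0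
    rw [hx, Pi.zero_apply, mul_zero]
  have e2 : ∫ x in K.carrier, inner ℝ (H1val (0 : H1 K.carrier) x • (x - K.centre))
      (H1grad (0 : H1 K.carrier) x) = 0 := by
    apply integral_eq_zero_of_ae
    filter_upwards [Lp.coeFn_zero ℝ 2 (volume.restrict K.carrier)] with x hx
    change inner ℝ ((0 : L2 K.carrier) x • (x - K.centre)) _ = (0 : ℝ)
    rw [hx, Pi.zero_apply, zero_smul, inner_zero_left]
  rw [e1, e2, mul_zero, add_zero, eq_comm, Finset.sum_eq_zero_iff_of_nonneg] at hr
  · funext i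
    exact polynomial_eq_zero_of_integral ((mul_eq_zero.mp (hr i (Finset.mem_univ i))).resolve_left
      (abs_ne_zero.mpr (K.jac_ne_zero i)))
  · intro i _
    exact mul_nonneg (abs_nonneg _) (intervalIntegral.integral_nonneg zero_le_one
      fun t _ => mul_self_nonneg _)

/-- The trace of a function is unique. -/
theorem IsTrace.unique {v : H1 K.carrier} {q s : Fin (K.m + 3) → Polynomial ℝ}
    (hq : K.IsTrace v (polyOnBoundary q)) (hs : K.IsTrace v (polyOnBoundary s)) : q = s := by
  have hsc : ∀ i, Continuous (((-1 : ℝ) • polyOnBoundary s) i) := fun i =>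
    (s i).continuous.const_smul (-1 : ℝ)
  have h := IsTrace.add (f := polyOnBoundary q) (fun i => (q i).continuous) hsc hq (hs.smul (-1))
  have e0 : v + (-1 : ℝ) • v = 0 := by module
  have e : polyOnBoundary q + (-1 : ℝ) • polyOnBoundary s = polyOnBoundary (q - s) := by
    funext i t
    change (q i).eval t + (-1) * (s i).eval t = (q i - s i).eval t
    rw [Polynomial.eval_sub]
    ring
  rw [e0, e] at h
  exact sub_eq_zero.mp (eq_zero_of_isTrace_zero h)

end PolygonalElement

/-! ### Mollified dilations -/

theorem abs_integral_mul_le {α : Type*} [MeasurableSpace α] {μ : Measure α} {f g : α → ℝ}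
    (hf : MemLp f 2 μ) (hg : MemLp g 2 μ) :
    |∫ x, f x * g x ∂μ| ≤ (eLpNorm f 2 μ).toReal * (eLpNorm g 2 μ).toReal := by
  have key : ∫ x, f x * g x ∂μ = inner ℝ (hf.toLp f) (hg.toLp g) := by
    rw [L2.inner_def]
    apply integral_congr_ae
    filter_upwards [hf.coeFn_toLp, hg.coeFn_toLp] with x h1 h2
    rw [h1, h2]
    simp [mul_comm]
  rw [key, ← Lp.norm_toLp f hf, ← Lp.norm_toLp g hg]
  exact abs_real_inner_le_norm _ _

theorem integrable_mul_of_memLp {α : Type*} [MeasurableSpace α] {μ : Measure α} {f g : α → ℝ}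
    (hf : MemLp f 2 μ) (hg : MemLp g 2 μ) : Integrable (fun x => f x * g x) μ :=
  hf.integrable_mul hg

/-- The homothety of ratio `q` about `c`, followed by a translation by `-w`. -/
def homTrans (c : Plane) (q : ℝ) (w x : Plane) : Plane := c + q • (x - c) - w

theorem continuous_homTrans (c : Plane) (q : ℝ) (w : Plane) : Continuous (homTrans c q w) := by
  unfold homTrans
  fun_prop

/-- The inverse of a homothety of ratio at least `1 / 2` enlarges areas at most fourfold. -/
theorem map_homTrans_le (c : Plane) {q : ℝ} (hq : 1 / 2 ≤ q) (w : Plane) :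
    Measure.map (homTrans c q w) volume ≤ (4 : ℝ≥0∞) • (volume : Measure Plane) := by
  have hq0 : 0 < q := by linarith
  have h1 : homTrans c q w = (fun y => (c - q • c - w) + y) ∘ fun x => q • x := by
    funext x
    simp only [homTrans, Function.comp]
    module
  have h2 : Measure.map (fun y => (c - q • c - w) + y) (volume : Measure Plane) = volume :=
    map_add_left_eq_self _ _
  rw [h1, ← Measure.map_map (by fun_prop) (by fun_prop), Measure.map_addHaar_smul _ hq0.ne',
    Measure.map_smul, h2, finrank_euclideanSpace_fin]
  refine Measure.le_iff'.mpr fun s => ?_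
  simp only [Measure.smul_apply, smul_eq_mul]
  gcongr
  rw [show (4 : ℝ≥0∞) = ENNReal.ofReal 4 by norm_num]
  apply ENNReal.ofReal_le_ofReal
  rw [abs_of_pos (by positivity), inv_le_comm₀ (by positivity) (by norm_num)]
  nlinarith

theorem eLpNorm_comp_homTrans_le (c : Plane) {q : ℝ} (hq : 1 / 2 ≤ q) (w : Plane)
    {u : Plane → ℝ} (hu : AEStronglyMeasurable u volume) :
    AEStronglyMeasurable (u ∘ homTrans c q w) volume ∧
      eLpNorm (u ∘ homTrans c q w) 2 volume ≤ 2 * eLpNorm u 2 volume := by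
  have hA := (continuous_homTrans c q w).measurable
  have hle := map_homTrans_le c hq w
  have hac : Measure.map (homTrans c q w) volume ≪ (volume : Measure Plane) :=
    hle.absolutelyContinuous.trans (Measure.smul_absolutelyContinuous)
  have hu' : AEStronglyMeasurable u (Measure.map (homTrans c q w) volume) := hu.mono_ac hac
  refine ⟨hu'.comp_measurable hA, ?_⟩
  rw [← eLpNorm_map_measure hu' hA.aemeasurable]
  refine (eLpNorm_mono_measure u hle).trans ?_
  rw [eLpNorm_smul_measure_of_ne_top (by norm_num)]
  have h4 : (4 : ℝ≥0∞) ^ (1 / (2 : ℝ≥0∞)).toReal = 2 := by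
    rw [show (4 : ℝ≥0∞) = 2 ^ (2 : ℝ) by norm_num, ← ENNReal.rpow_mul]
    simp
  rw [h4, smul_eq_mul]

/-- Weak continuity in `L²` of homotheties and translations. -/
theorem tendsto_integral_mul_homTrans {g h : Plane → ℝ} (hg : MemLp g 2 volume)
    (hg1 : Integrable g) (hh : MemLp h 2 volume) (c : Plane) :
    Tendsto (fun z : ℝ × Plane => ∫ x, g x * h (homTrans c z.1 z.2 x)) (𝓝 (1, 0))
      (𝓝 (∫ x, g x * h x)) := by
  rw [Metric.tendsto_nhds]
  intro δ hδ
  set N := (eLpNorm g 2 volume).toReal with hN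
  have hN0 : 0 ≤ N := ENNReal.toReal_nonneg
  set ε := δ / (4 * (N + 1)) with hε
  have hε0 : 0 < ε := by positivity
  obtain ⟨k, hkc, hke, hkcont, hkL⟩ := hh.exists_hasCompactSupport_eLpNorm_sub_le
    (by norm_num) (ε := ENNReal.ofReal ε) (by simpa using hε0)
  have hhk : MemLp (h - k) 2 volume := hh.sub hkL
  have hke' : (eLpNorm (h - k) 2 volume).toReal ≤ ε :=
    ENNReal.toReal_le_of_le_ofReal hε0.le hke
  obtain ⟨C, hC⟩ := hkc.exists_bound_of_continuous hkcont
  -- the continuous part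
  have hcont : Tendsto (fun z : ℝ × Plane => ∫ x, g x * k (homTrans c z.1 z.2 x)) (𝓝 (1, 0))
      (𝓝 (∫ x, g x * k x)) := by
    refine tendsto_integral_filter_of_dominated_convergence (fun x => ‖g x‖ * C) ?_ ?_
      (hg1.norm.mul_const C) ?_
    · exact Eventually.of_forall fun z => hg.1.mul
        (hkcont.comp (continuous_homTrans c z.1 z.2)).aestronglyMeasurable
    · refine Eventually.of_forall fun z => Eventually.of_forall fun x => ?_
      rw [norm_mul]
      exact mul_le_mul_of_nonneg_left (hC _) (norm_nonneg _)
    · refine Eventually.of_forall fun x => ?_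
      have : Continuous fun z : ℝ × Plane => g x * k (homTrans c z.1 z.2 x) := by
        unfold homTrans
        fun_prop
      have h2 := this.tendsto (1, 0)
      simpa [homTrans] using h2
  have hev1 := (Metric.tendsto_nhds.mp hcont) (δ / 4) (by positivity)
  have hev2 : ∀ᶠ z : ℝ × Plane in 𝓝 (1, 0), 1 / 2 ≤ z.1 :=
    (continuous_fst.tendsto ((1 : ℝ), (0 : Plane))).eventually (Ici_mem_nhds (by norm_num))
  filter_upwards [hev1, hev2] with z hz1 hz2
  obtain ⟨hm1, hm2⟩ := eLpNorm_comp_homTrans_le c hz2 z.2 hhk.1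
  obtain ⟨hk1, hk2⟩ := eLpNorm_comp_homTrans_le c hz2 z.2 hkL.1
  have hmL : MemLp ((h - k) ∘ homTrans c z.1 z.2) 2 volume :=
    ⟨hm1, hm2.trans_lt (ENNReal.mul_lt_top (by norm_num) hhk.2)⟩
  have hkL' : MemLp (k ∘ homTrans c z.1 z.2) 2 volume :=
    ⟨hk1, hk2.trans_lt (ENNReal.mul_lt_top (by norm_num) hkL.2)⟩
  have hmε : (eLpNorm ((h - k) ∘ homTrans c z.1 z.2) 2 volume).toReal ≤ 2 * ε := by
    refine (ENNReal.toReal_mono (ENNReal.mul_ne_top (by norm_num) hhk.2.ne) hm2).trans ?_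
    rw [ENNReal.toReal_mul]
    simpa using hke'
  have b1 := abs_integral_mul_le hg hmL
  have b2 := abs_integral_mul_le hg hhk
  have e1 : ∫ x, g x * h (homTrans c z.1 z.2 x)
      = (∫ x, g x * ((h - k) ∘ homTrans c z.1 z.2) x)
        + ∫ x, g x * k (homTrans c z.1 z.2 x) := by
    have i1 : Integrable (fun x => g x * k (homTrans c z.1 z.2 x)) :=
      integrable_mul_of_memLp hg hkL'
    rw [← integral_add (integrable_mul_of_memLp hg hmL) i1]
    refine integral_congr_ae (Eventually.of_forall fun x => ?_)
    simp only [Function.comp, Pi.sub_apply]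
    ring
  have e2 : ∫ x, g x * h x = (∫ x, g x * (h - k) x) + ∫ x, g x * k x := by
    rw [← integral_add (integrable_mul_of_memLp hg hhk) (integrable_mul_of_memLp hg hkL)]
    refine integral_congr_ae (Eventually.of_forall fun x => ?_)
    simp only [Pi.sub_apply]
    ring
  have hNε : N * ε ≤ δ / 4 := by
    rw [hε, mul_div_assoc', div_le_div_iff₀ (by positivity) (by norm_num)]
    nlinarith
  rw [Real.dist_eq] at hz1 ⊢
  rw [e1, e2]
  have b1' : |∫ x, g x * ((h - k) ∘ homTrans c z.1 z.2) x| ≤ N * (2 * ε) :=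
    b1.trans (mul_le_mul_of_nonneg_left hmε hN0)
  have b2' : |∫ x, g x * (h - k) x| ≤ N * ε :=
    b2.trans (mul_le_mul_of_nonneg_left hke' hN0)
  rw [abs_le] at b1' b2'
  rw [abs_lt] at hz1 ⊢
  constructor <;> linarith [b1'.1, b1'.2, b2'.1, b2'.2, hz1.1, hz1.2]

/-- Mollification of dilated functions is weakly convergent in `L²`. -/
theorem tendsto_integral_mul_mollified {g h : Plane → ℝ} (hg : MemLp g 2 volume)
    (hg1 : Integrable g) (hh : MemLp h 2 volume) (hh1 : Integrable h) (c : Plane)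
    {q : ℕ → ℝ} (hq : Tendsto q atTop (𝓝 1)) {φ : ℕ → ContDiffBump (0 : Plane)}
    (hφ : Tendsto (fun n => (φ n).rOut) atTop (𝓝 0)) :
    Tendsto (fun n => ∫ x, g x * ∫ y, h y * (φ n).normed volume (c + q n • (x - c) - y)) atTop
      (𝓝 (∫ x, g x * h x)) := by
  rw [Metric.tendsto_atTop']
  intro δ hδ
  obtain ⟨ρ, hρ, hball⟩ := Metric.eventually_nhds_iff.mp
    ((Metric.tendsto_nhds.mp (tendsto_integral_mul_homTrans hg hg1 hh c)) (δ / 2) (by positivity))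
  have hev := ((Metric.tendsto_nhds.mp hq) ρ hρ).and ((Metric.tendsto_nhds.mp hφ) ρ hρ)
  obtain ⟨n₀, hn₀⟩ := eventually_atTop.mp hev
  refine ⟨n₀, fun n hn => ?_⟩
  obtain ⟨h1, h2⟩ := hn₀ n hn.le
  set k := (φ n).normed (volume : Measure Plane) with hk
  set I := ∫ x, g x * h x with hI
  have hkc : Continuous k := (φ n).continuous_normed
  have hki : Integrable k := (φ n).integrable_normed
  obtain ⟨C, hC⟩ := ((φ n).hasCompactSupport_normed (μ := volume)).exists_bound_of_continuous hkc
  -- the integrand in the variables `(x, y)`, then in the variables `(x, w)`, `w = A x - y`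
  have hF : Integrable (fun z : Plane × Plane =>
      g z.1 * (h z.2 * k (c + q n • (z.1 - c) - z.2))) (volume.prod volume) := by
    have hb := (hg1.mul_prod hh1).mul_bdd (c := C)
      (g := fun z : Plane × Plane => k (c + q n • (z.1 - c) - z.2))
      (hkc.comp (by fun_prop)).aestronglyMeasurable (Eventually.of_forall fun z => hC _)
    refine hb.congr (Eventually.of_forall fun z => ?_)
    simp only []
    ring
  have hshear : MeasurePreserving (fun z : Plane × Plane => (z.1, c + q n • (z.1 - c) - z.2))
      (volume.prod volume) (volume.prod volume) := by
    refine (MeasurePreserving.id volume).skew_product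
      (g := fun x w : Plane => c + q n • (x - c) - w) (by fun_prop)
      (Eventually.of_forall fun x => ?_)
    exact (Measure.measurePreserving_sub_left volume (c + q n • (x - c))).map_eq
  have hG : Integrable (fun z : Plane × Plane => g z.1 * (h (homTrans c (q n) z.2 z.1) * k z.2))
      (volume.prod volume) := by
    have := (hshear.integrable_comp hF.1).mpr hF
    refine this.congr (Eventually.of_forall fun z => ?_)
    simp only [Function.comp, homTrans, sub_sub_cancel]
  have e1 : ∫ x, g x * ∫ y, h y * k (c + q n • (x - c) - y)
      = ∫ w, k w * ∫ x, g x * h (homTrans c (q n) w x) := by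
    calc ∫ x, g x * ∫ y, h y * k (c + q n • (x - c) - y)
        = ∫ x, ∫ w, g x * (h (homTrans c (q n) w x) * k w) := by
          refine integral_congr_ae (Eventually.of_forall fun x => ?_)
          simp only []
          rw [integral_const_mul,
            ← integral_sub_left_eq_self _ volume (c + q n • (x - c))]
          simp only [sub_sub_cancel, homTrans]
      _ = ∫ w, ∫ x, g x * (h (homTrans c (q n) w x) * k w) := integral_integral_swap hG
      _ = ∫ w, k w * ∫ x, g x * h (homTrans c (q n) w x) := by
          refine integral_congr_ae (Eventually.of_forall fun w => ?_)
          simp only []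
          rw [← integral_const_mul]
          refine integral_congr_ae (Eventually.of_forall fun x => ?_)
          simp only []
          ring
  have hkA : Integrable (fun w => k w * ∫ x, g x * h (homTrans c (q n) w x)) := by
    refine hG.integral_prod_right.congr (Eventually.of_forall fun w => ?_)
    simp only []
    rw [← integral_const_mul]
    refine integral_congr_ae (Eventually.of_forall fun x => ?_)
    simp only []
    ring
  have e2 : I = ∫ w, k w * I := by
    rw [integral_mul_const, (φ n).integral_normed, one_mul]
  rw [dist_eq_norm, e1, e2, ← integral_sub hkA (hki.mul_const I)]
  refine lt_of_le_of_lt (b := δ / 2) ?_ (by linarith)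
  have hbound : ∀ w, ‖k w * (∫ x, g x * h (homTrans c (q n) w x)) - k w * I‖ ≤ k w * (δ / 2) := by
    intro w
    rw [← mul_sub, norm_mul, Real.norm_of_nonneg ((φ n).nonneg_normed w)]
    by_cases hw : k w = 0
    · have hw' : (φ n).normed volume w = 0 := hw
      rw [hw', hw]
      simp
    · refine mul_le_mul_of_nonneg_left ?_ ((φ n).nonneg_normed w)
      have hw' : w ∈ Function.support k := hw
      rw [hk, (φ n).support_normed_eq, Metric.mem_ball, dist_zero_right] at hw'
      have hr : (φ n).rOut < ρ := by
        have := h2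
        rw [Real.dist_eq, sub_zero, abs_of_pos (φ n).rOut_pos] at this
        exact this
      have := hball (y := (q n, w)) (by
        rw [Prod.dist_eq, max_lt_iff]
        exact ⟨h1, by rw [dist_zero_right]; exact hw'.trans hr⟩)
      rw [dist_eq_norm] at this
      exact this.le
  refine (norm_integral_le_of_norm_le (hki.mul_const (δ / 2))
    (Eventually.of_forall hbound)).trans ?_
  rw [integral_mul_const, (φ n).integral_normed, one_mul]

/-! ### The energy identity for functions with zero trace -/

namespace PolygonalElement

variable {K : PolygonalElement}

theorem memLp_indicator {u : Plane → ℝ} (hu : MemLp u 2 (volume.restrict K.carrier)) :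
    MemLp (K.carrier.indicator u) 2 volume :=
  (memLp_indicator_iff_restrict K.isOpen.measurableSet).mpr hu

theorem isFiniteMeasure_carrier : IsFiniteMeasure (volume.restrict K.carrier) :=
  ⟨by rw [Measure.restrict_apply_univ]; exact K.bounded.measure_lt_top⟩

theorem integrable_indicator {u : Plane → ℝ} (hu : MemLp u 2 (volume.restrict K.carrier)) :
    Integrable (K.carrier.indicator u) := by
  have := isFiniteMeasure_carrier (K := K)
  exact (integrable_indicator_iff K.isOpen.measurableSet).mpr (hu.integrable (by norm_num))

theorem integral_indicator_mul (u f : Plane → ℝ) :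
    ∫ x, K.carrier.indicator u x * f x = ∫ x in K.carrier, u x * f x := by
  rw [← integral_indicator K.isOpen.measurableSet]
  congr 1
  funext x
  by_cases hx : x ∈ K.carrier <;> simp [hx]

/-- The mollification of the extension of a function by zero. -/
def mollified (u : Plane → ℝ) (k : Plane → ℝ) (x : Plane) : ℝ :=
  ∫ y, K.carrier.indicator u y * k (x - y)

theorem contDiff_mollified {u k : Plane → ℝ} (hu : MemLp u 2 (volume.restrict K.carrier))
    (hk : ContDiff ℝ ∞ k) (hc : HasCompactSupport k) : ContDiff ℝ ∞ (mollified (K := K) u k) :=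
  hc.contDiff_convolution_right (ContinuousLinearMap.mul ℝ ℝ)
    (integrable_indicator hu).locallyIntegrable hk

theorem fderiv_mollified {u k : Plane → ℝ} (hu : MemLp u 2 (volume.restrict K.carrier))
    (hk : ContDiff ℝ ∞ k) (hc : HasCompactSupport k) (x e : Plane) :
    fderiv ℝ (mollified (K := K) u k) x e = ∫ y in K.carrier, u y * fderiv ℝ k (x - y) e := by
  have hk1 : ContDiff ℝ 1 k := hk.of_le (by exact_mod_cast le_top)
  have h := hc.hasFDerivAt_convolution_right (ContinuousLinearMap.mul ℝ ℝ)
    (integrable_indicator hu).locallyIntegrable hk1 x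
  have h' : HasFDerivAt (mollified (K := K) u k) _ x := h
  rw [h'.fderiv, convolution_precompR_apply _ (integrable_indicator hu).locallyIntegrable
    (hc.fderiv ℝ) (hk1.continuous_fderiv (by simp)), ← integral_indicator_mul]
  rfl

/-- For a function with zero trace, differentiation commutes with extension by zero and
mollification. -/
theorem fderiv_mollified_of_trace_zero {v : H1 K.carrier} (h : K.IsTrace v 0) {k : Plane → ℝ}
    (hk : ContDiff ℝ ∞ k) (hc : HasCompactSupport k) (x : Plane) (j : Fin 2) :
    fderiv ℝ (mollified (K := K) (H1val v) k) x (EuclideanSpace.single j 1)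
      = mollified (K := K) (fun y => H1grad v y j) k x := by
  rw [fderiv_mollified (Lp.memLp _) hk hc, mollified, integral_indicator_mul]
  have hkx : ContDiff ℝ ∞ fun y => k (x - y) := hk.comp (contDiff_const.sub contDiff_id)
  have hz := integral_of_trace_zero h
    (η := fun y => k (x - y) • EuclideanSpace.single j (1 : ℝ)) (hkx.smul contDiff_const)
  have hdiv : ∀ y, divergence (fun y => k (x - y) • EuclideanSpace.single j (1 : ℝ)) y
      = - fderiv ℝ k (x - y) (EuclideanSpace.single j 1) := by
    intro y
    have hd : HasFDerivAt (fun y => k (x - y))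
        ((fderiv ℝ k (x - y)).comp (-ContinuousLinearMap.id ℝ Plane)) y :=
      ((hk.differentiable (by simp)) (x - y)).hasFDerivAt.comp y ((hasFDerivAt_id y).const_sub x)
    rw [divergence_smul (hkx.differentiable (by simp) y) (by fun_prop), inner_gradient_eq,
      hd.fderiv]
    simp [divergence]
  have hin : ∀ y, inner ℝ (k (x - y) • EuclideanSpace.single j (1 : ℝ)) (H1grad v y)
      = H1grad v y j * k (x - y) := by
    intro y
    rw [real_inner_smul_left, EuclideanSpace.inner_single_left]
    simp [mul_comm]
  simp only [hdiv, hin, neg_mul] at hz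
  rw [integral_neg] at hz
  have : ∫ y in K.carrier, fderiv ℝ k (x - y) (EuclideanSpace.single j 1) * H1val v y
      = ∫ y in K.carrier, H1val v y * fderiv ℝ k (x - y) (EuclideanSpace.single j 1) := by
    simp only [mul_comm]
  linarith

theorem isCompact_contracted (K : PolygonalElement) (s ρ : ℝ) :
    IsCompact ((fun z : Plane × Plane => K.centre + s • (z.1 - K.centre) + z.2) ''
      (closure K.carrier ×ˢ Metric.closedBall 0 ρ)) :=
  (K.bounded.isCompact_closure.prod (isCompact_closedBall 0 ρ)).image (by fun_prop)

/-- A mollified and slightly dilated function is a test function. -/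
theorem isTestFun_mollified {u k : Plane → ℝ} (hu : MemLp u 2 (volume.restrict K.carrier))
    (hk : ContDiff ℝ ∞ k) {s ρ : ℝ} (hs0 : 0 < s) (hs1 : s < 1)
    (hkρ : ∀ x, k x ≠ 0 → ‖x‖ ≤ ρ) (hρ : s * ρ < (1 - s) * K.radius) :
    IsTestFun K.carrier (fun x => mollified (K := K) u k (K.centre + s⁻¹ • (x - K.centre))) := by
  have hc : HasCompactSupport k := HasCompactSupport.of_support_subset_isCompact
    (isCompact_closedBall 0 ρ) fun x hx => by
      rw [Metric.mem_closedBall, dist_zero_right]; exact hkρ x hx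
  have hQ := isCompact_contracted K s (s * ρ)
  set Q := (fun z : Plane × Plane => K.centre + s • (z.1 - K.centre) + z.2) ''
      (closure K.carrier ×ˢ Metric.closedBall 0 (s * ρ)) with hQdef
  have hsupp : Function.support
      (fun x => mollified (K := K) u k (K.centre + s⁻¹ • (x - K.centre))) ⊆ Q := by
    intro x hx
    have hne : ∃ y, K.carrier.indicator u y * k (K.centre + s⁻¹ • (x - K.centre) - y) ≠ 0 := by
      by_contra hcon
      push Not at hcon
      apply hx
      simp only [mollified, hcon, integral_zero]
    obtain ⟨y, hy⟩ := hne
    have hyK : y ∈ K.carrier := by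
      by_contra hyK
      simp [hyK] at hy
    have hky := hkρ _ (right_ne_zero_of_mul hy)
    refine ⟨(y, s • (K.centre + s⁻¹ • (x - K.centre) - y)), ⟨subset_closure hyK, ?_⟩, ?_⟩
    · rw [Metric.mem_closedBall, dist_zero_right, norm_smul, Real.norm_of_nonneg hs0.le]
      exact mul_le_mul_of_nonneg_left hky hs0.le
    · simp only [smul_sub, smul_add, smul_smul, mul_inv_cancel₀ hs0.ne', one_smul]
      abel
  have hts := closure_minimal hsupp hQ.isClosed
  refine ⟨(contDiff_mollified hu hk hc).comp (contDiff_const.add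
    ((contDiff_id.sub contDiff_const).const_smul s⁻¹)), hQ.of_isClosed_subset
      isClosed_closure hts, hts.trans ?_⟩
  rintro _ ⟨⟨y, z⟩, ⟨hy, hz⟩, rfl⟩
  rw [Metric.mem_closedBall, dist_zero_right] at hz
  exact K.contraction_add_mem hy hs0.le hs1 (hz.trans_lt hρ)

/-- The energy identity for functions with zero trace: such a function may be used as a test
function in the weak form of its Poisson equation. -/
theorem energy_identity {v : H1 K.carrier} {f : Plane → ℝ} (hf : Continuous f)
    (h : K.IsTrace v 0) (hΔ : K.HasWeakLaplacian v f) :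
    ∫ x in K.carrier, inner ℝ (H1grad v x) (H1grad v x)
      = - ∫ x in K.carrier, f x * H1val v x := by
  have hGj : ∀ j, MemLp (fun y => H1grad v y j) 2 (volume.restrict K.carrier) := fun j =>
    (Lp.memLp (H1grad v)).continuousLinearMap_comp (EuclideanSpace.proj j : Plane →L[ℝ] ℝ)
  have hV : MemLp (H1val v) 2 (volume.restrict K.carrier) := Lp.memLp _
  have hfL : MemLp f 2 (volume.restrict K.carrier) := memLp_carrier hf
  have hR := K.radius_pos
  -- contraction factors `s` tending to one and mollification radii tending to zero, small enough
  -- for the support to stay in the open polygon: `s (1 - s) R < (1 - s) R`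
  set s : ℕ → ℝ := fun n => 1 - 1 / ((n : ℝ) + 2) with hs
  have hn2 : ∀ n : ℕ, 0 < 1 / ((n : ℝ) + 2) ∧ 1 / ((n : ℝ) + 2) ≤ 1 / 2 := fun n =>
    ⟨by positivity, by
      rw [div_le_div_iff₀ (by positivity) (by norm_num)]
      have : (0 : ℝ) ≤ n := n.cast_nonneg
      linarith⟩
  have hs0 : ∀ n, 0 < s n := fun n => by have := (hn2 n).2; simp only [hs]; linarith
  have hs1 : ∀ n, s n < 1 := fun n => by have := (hn2 n).1; simp only [hs]; linarith
  have hlim : Tendsto (fun n : ℕ => 1 / ((n : ℝ) + 2)) atTop (𝓝 0) := by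
    have := tendsto_one_div_add_atTop_nhds_zero_nat (𝕜 := ℝ)
    have h2 := this.comp (tendsto_add_atTop_nat 1)
    refine h2.congr fun n => ?_
    simp only [Function.comp, Nat.cast_add, Nat.cast_one]
    ring
  have hslim : Tendsto s atTop (𝓝 1) := by
    simpa only [sub_zero] using hlim.const_sub 1
  have hsinv : Tendsto (fun n => (s n)⁻¹) atTop (𝓝 1) := by
    simpa using hslim.inv₀ one_ne_zero
  let φ : ℕ → ContDiffBump (0 : Plane) := fun n =>
    { rIn := (1 - s n) * K.radius / 2
      rOut := (1 - s n) * K.radius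
      rIn_pos := by have := hs1 n; have : 0 < 1 - s n := by linarith
                    positivity
      rIn_lt_rOut := by
        have := hs1 n; have : 0 < (1 - s n) * K.radius := mul_pos (by linarith) hR
        linarith }
  have hφlim : Tendsto (fun n => (φ n).rOut) atTop (𝓝 0) := by
    have : Tendsto (fun n => (1 - s n) * K.radius) atTop (𝓝 ((1 - 1) * K.radius)) :=
      (hslim.const_sub 1).mul_const _
    simpa using this
  set k : ℕ → Plane → ℝ := fun n => (φ n).normed volume with hk
  have hkc : ∀ n, ContDiff ℝ ∞ (k n) := fun n => (φ n).contDiff_normed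
  have hkcs : ∀ n, HasCompactSupport (k n) := fun n => (φ n).hasCompactSupport_normed
  -- the weak equation tested with the mollified dilations
  have heq : ∀ n, (s n)⁻¹ * ∑ j, ∫ x, K.carrier.indicator (fun y => H1grad v y j) x
        * ∫ y, K.carrier.indicator (fun y => H1grad v y j) y
          * k n (K.centre + (s n)⁻¹ • (x - K.centre) - y)
      = - ∫ x, K.carrier.indicator f x * ∫ y, K.carrier.indicator (H1val v) y
          * k n (K.centre + (s n)⁻¹ • (x - K.centre) - y) := by
    intro n
    have htest := isTestFun_mollified hV (hkc n) (hs0 n) (hs1 n) (ρ := (φ n).rOut)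
      (by
        intro x hx
        have hx' : x ∈ Function.support ((φ n).normed volume) := hx
        rw [(φ n).support_normed_eq, Metric.mem_ball, dist_zero_right] at hx'
        exact hx'.le)
      (by
        change s n * ((1 - s n) * K.radius) < (1 - s n) * K.radius
        have h1 : 0 < (1 - s n) * K.radius := mul_pos (by linarith [hs1 n]) hR
        exact mul_lt_of_lt_one_left h1 (hs1 n))
    have hw := hΔ _ htest
    have hgrad : ∀ x j, gradient (fun x => mollified (K := K) (H1val v) (k n)
        (K.centre + (s n)⁻¹ • (x - K.centre))) x j
        = (s n)⁻¹ * mollified (K := K) (fun y => H1grad v y j) (k n)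
          (K.centre + (s n)⁻¹ • (x - K.centre)) := by
      intro x j
      rw [gradient_apply, ← fderiv_mollified_of_trace_zero h (hkc n) (hkcs n)]
      have hA : HasFDerivAt (fun x : Plane => K.centre + (s n)⁻¹ • (x - K.centre))
          ((s n)⁻¹ • ContinuousLinearMap.id ℝ Plane) x :=
        (((hasFDerivAt_id x).sub_const K.centre).const_smul (s n)⁻¹).const_add K.centre
      have hM := ((contDiff_mollified hV (hkc n) (hkcs n)).differentiable (by simp)
        (K.centre + (s n)⁻¹ • (x - K.centre))).hasFDerivAt.comp x hA
      have hM' : HasFDerivAt (fun x => mollified (K := K) (H1val v) (k n)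
        (K.centre + (s n)⁻¹ • (x - K.centre))) _ x := hM
      rw [hM'.fderiv]
      simp
    have hint : ∀ j, Integrable (fun x => H1grad v x j * gradient (fun x =>
        mollified (K := K) (H1val v) (k n) (K.centre + (s n)⁻¹ • (x - K.centre))) x j)
        (volume.restrict K.carrier) := fun j =>
      integrable_L2Vec_mul _ (htest.continuous_gradient j) (htest.compact_gradient j) j
    have e1 : ∫ x in K.carrier, inner ℝ (H1grad v x) (gradient (fun x =>
        mollified (K := K) (H1val v) (k n) (K.centre + (s n)⁻¹ • (x - K.centre))) x)
        = ∑ j, ∫ x in K.carrier, H1grad v x j * gradient (fun x =>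
        mollified (K := K) (H1val v) (k n) (K.centre + (s n)⁻¹ • (x - K.centre))) x j := by
      rw [← integral_finsetSum _ fun j _ => hint j]
      refine integral_congr_ae (Eventually.of_forall fun x => ?_)
      simp only [PiLp.inner_apply, RCLike.inner_apply, conj_trivial, mul_comm]
    rw [e1] at hw
    rw [Finset.mul_sum]
    have e2 : ∫ x, K.carrier.indicator f x * ∫ y, K.carrier.indicator (H1val v) y
          * k n (K.centre + (s n)⁻¹ • (x - K.centre) - y)
        = ∫ x in K.carrier, f x * mollified (K := K) (H1val v) (k n)
          (K.centre + (s n)⁻¹ • (x - K.centre)) := integral_indicator_mul _ _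
    rw [e2, ← hw]
    refine Finset.sum_congr rfl fun j _ => ?_
    rw [integral_indicator_mul, ← integral_const_mul]
    refine integral_congr_ae (Eventually.of_forall fun x => ?_)
    simp only []
    rw [hgrad, mollified]
    ring
  have hl : Tendsto (fun n => (s n)⁻¹ * ∑ j, ∫ x, K.carrier.indicator (fun y => H1grad v y j) x
        * ∫ y, K.carrier.indicator (fun y => H1grad v y j) y
          * k n (K.centre + (s n)⁻¹ • (x - K.centre) - y)) atTop
      (𝓝 (1 * ∑ j, ∫ x, K.carrier.indicator (fun y => H1grad v y j) x
        * K.carrier.indicator (fun y => H1grad v y j) x)) := by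
    refine hsinv.mul (tendsto_finsetSum _ fun j _ => ?_)
    exact tendsto_integral_mul_mollified (memLp_indicator (hGj j)) (integrable_indicator (hGj j))
      (memLp_indicator (hGj j)) (integrable_indicator (hGj j)) K.centre hsinv hφlim
  have hr := (tendsto_integral_mul_mollified (memLp_indicator hfL) (integrable_indicator hfL)
    (memLp_indicator hV) (integrable_indicator hV) K.centre hsinv hφlim).neg
  have hfin := tendsto_nhds_unique hl (hr.congr fun n => (heq n).symm)
  have hsq : ∀ a b : Plane → ℝ, ∫ x, K.carrier.indicator a x * K.carrier.indicator b x
      = ∫ x in K.carrier, a x * b x := by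
    intro a b
    rw [integral_indicator_mul]
    refine setIntegral_congr_fun K.isOpen.measurableSet fun x hx => ?_
    simp only [Set.indicator_of_mem hx]
  rw [one_mul, hsq] at hfin
  simp only [hsq] at hfin
  rw [← hfin, ← integral_finsetSum _ fun j _ => integrable_mul_of_memLp (hGj j) (hGj j)]
  refine integral_congr_ae (Eventually.of_forall fun x => ?_)
  simp only [PiLp.inner_apply, RCLike.inner_apply, conj_trivial]

end PolygonalElement

/-! ### Unisolvence and the representation of functionals -/

/-- A bivariate polynomial that vanishes on a non-empty open set is zero. -/
theorem eq_zero_of_polyFun_eq_zero {D : Set Plane} (hD : IsOpen D) (hne : D.Nonempty)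
    {q : MvPolynomial (Fin 2) ℝ} (h : ∀ x ∈ D, polyFun q x = 0) : q = 0 := by
  obtain ⟨c, hc⟩ := hne
  have hopen : IsOpen ((fun y : Fin 2 → ℝ => (WithLp.toLp 2 y : Plane)) ⁻¹' D) :=
    hD.preimage (PiLp.continuous_toLp 2 _)
  obtain ⟨r, hr, hball⟩ := Metric.isOpen_iff.mp hopen (fun i => c i) hc
  refine MvPolynomial.funext_set (fun i => Metric.ball (c i) r) (fun i => ?_) fun x hx => ?_
  · rw [Real.ball_eq_Ioo]
    exact Set.Ioo_infinite (by linarith)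
  · rw [← ball_pi _ hr] at hx
    rw [map_zero]
    exact h _ (hball hx)

/-- A polynomial whose partial derivatives vanish is constant. -/
theorem eq_C_of_pderiv_eq_zero {q : MvPolynomial (Fin 2) ℝ}
    (h : ∀ i, MvPolynomial.pderiv i q = 0) : q = MvPolynomial.C (MvPolynomial.coeff 0 q) := by
  ext m
  rw [MvPolynomial.coeff_C]
  split_ifs with hm
  · rw [hm]
  · obtain ⟨i, hi⟩ : ∃ i, m i ≠ 0 := by
      by_contra hcon
      push Not at hcon
      exact hm (Finsupp.ext fun i => (hcon i).symm)
    have h1 := congrArg (MvPolynomial.coeff (m - Finsupp.single i 1)) (h i)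
    have hle : Finsupp.single i 1 ≤ m := by
      rw [Finsupp.single_le_iff]
      omega
    rw [MvPolynomial.coeff_pderiv, tsub_add_cancel_of_le hle, MvPolynomial.coeff_zero] at h1
    exact (mul_eq_zero.mp h1).resolve_right (by positivity)

namespace PolygonalElement

variable {K : PolygonalElement} {p : ℕ}

theorem coeFn_H1val_polyH1 (K : PolygonalElement) (q : MvPolynomial (Fin 2) ℝ) :
    H1val (K.polyH1 q) =ᵐ[volume.restrict K.carrier] polyFun q :=
  MemLp.coeFn_toLp (memLp_of_continuous K.isOpen.measurableSet K.bounded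
      (contDiff_polyFun q).continuous)

theorem coeFn_H1grad_polyH1 (K : PolygonalElement) (q : MvPolynomial (Fin 2) ℝ) :
    H1grad (K.polyH1 q) =ᵐ[volume.restrict K.carrier] gradient (polyFun q) :=
  MemLp.coeFn_toLp (memLp_of_continuous K.isOpen.measurableSet K.bounded
      (continuous_gradient (contDiff_polyFun q)))

theorem polyFun_add (a b : MvPolynomial (Fin 2) ℝ) (x : Plane) :
    polyFun (a + b) x = polyFun a x + polyFun b x := by simp [polyFun]

theorem polyFun_smul (r : ℝ) (a : MvPolynomial (Fin 2) ℝ) (x : Plane) :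
    polyFun (r • a) x = r * polyFun a x := MvPolynomial.smul_eval _ _ _

/-- The embedding of polynomials into `H¹(K)` as a linear map. -/
def polyH1Lin (K : PolygonalElement) : MvPolynomial (Fin 2) ℝ →ₗ[ℝ] H1 K.carrier where
  toFun := K.polyH1
  map_add' a b := by
    refine Subtype.ext (Prod.ext (Lp.ext ?_) (Lp.ext ?_))
    · refine (coeFn_H1val_polyH1 K (a + b)).trans ?_
      refine EventuallyEq.trans ?_ (Lp.coeFn_add (H1val (K.polyH1 a)) (H1val (K.polyH1 b))).symm
      filter_upwards [coeFn_H1val_polyH1 K a, coeFn_H1val_polyH1 K b] with x h1 h2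
      rw [Pi.add_apply, h1, h2, polyFun_add]
    · refine (coeFn_H1grad_polyH1 K (a + b)).trans ?_
      refine EventuallyEq.trans ?_ (Lp.coeFn_add (H1grad (K.polyH1 a)) (H1grad (K.polyH1 b))).symm
      filter_upwards [coeFn_H1grad_polyH1 K a, coeFn_H1grad_polyH1 K b] with x h1 h2
      ext i
      rw [Pi.add_apply, h1, h2, PiLp.add_apply, gradient_polyFun, gradient_polyFun,
        gradient_polyFun, map_add, polyFun_add]
  map_smul' r a := by
    refine Subtype.ext (Prod.ext (Lp.ext ?_) (Lp.ext ?_))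
    · refine (coeFn_H1val_polyH1 K (r • a)).trans ?_
      refine EventuallyEq.trans ?_ (Lp.coeFn_smul r (H1val (K.polyH1 a))).symm
      filter_upwards [coeFn_H1val_polyH1 K a] with x h1
      rw [Pi.smul_apply, h1, polyFun_smul, smul_eq_mul]
    · refine (coeFn_H1grad_polyH1 K (r • a)).trans ?_
      refine EventuallyEq.trans ?_ (Lp.coeFn_smul r (H1grad (K.polyH1 a))).symm
      filter_upwards [coeFn_H1grad_polyH1 K a] with x h1
      ext i
      rw [Pi.smul_apply, h1, PiLp.smul_apply, gradient_polyFun, gradient_polyFun, Derivation.map_smul,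
        polyFun_smul, smul_eq_mul]

/-- The embedding of polynomials into the virtual element space as a linear map. -/
def polyVELin (K : PolygonalElement) (p : ℕ) : PolyDeg p →ₗ[ℝ] K.VESpace p where
  toFun := K.polyVE
  map_add' a b := Subtype.ext (K.polyH1Lin.map_add a.1 b.1)
  map_smul' r a := Subtype.ext (K.polyH1Lin.map_smul r a.1)

/-- The gradient on the virtual element space as a linear map. -/
def gradLin (K : PolygonalElement) (p : ℕ) : K.VESpace p →ₗ[ℝ] L2Vec K.carrier where
  toFun v := grad v
  map_add' _ _ := rfl
  map_smul' _ _ := rfl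

/-- The gradient of polynomials as a linear map into `L²(K)²`. -/
def gradPoly (K : PolygonalElement) (p : ℕ) : PolyDeg p →ₗ[ℝ] L2Vec K.carrier :=
  (K.gradLin p).comp (K.polyVELin p)

/-- The constant polynomial `1`. -/
def onePoly (p : ℕ) : PolyDeg p := ⟨1, by simp [MvPolynomial.mem_restrictTotalDegree]⟩

theorem gradPoly_onePoly : K.gradPoly p (onePoly p) = 0 := by
  refine Lp.ext ((coeFn_H1grad_polyH1 K 1).trans ?_)
  refine EventuallyEq.trans ?_ (Lp.coeFn_zero Plane 2 (volume.restrict K.carrier)).symm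
  refine Eventually.of_forall fun x => ?_
  ext i
  rw [gradient_polyFun]
  simp [polyFun]

/-- The gradient seminorm on polynomials vanishes only on constants. -/
theorem exists_smul_onePoly {q : PolyDeg p} (h : K.gradPoly p q = 0) :
    ∃ a : ℝ, q = a • onePoly p := by
  have h1 : gradient (polyFun q.1) =ᵐ[volume.restrict K.carrier] fun _ => 0 := by
    refine (coeFn_H1grad_polyH1 K q.1).symm.trans ?_
    have h0 : H1grad (K.polyH1 q.1) = 0 := h
    rw [h0]
    exact Lp.coeFn_zero Plane 2 (volume.restrict K.carrier)
  have h2 := Measure.eqOn_open_of_ae_eq h1 K.isOpen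
    (continuous_gradient (contDiff_polyFun q.1)).continuousOn continuousOn_const
  have h3 : ∀ i, MvPolynomial.pderiv i q.1 = 0 := fun i =>
    eq_zero_of_polyFun_eq_zero K.isOpen K.carrier_nonempty fun x hx => by
      rw [← gradient_polyFun, h2 hx]
      rfl
  refine ⟨MvPolynomial.coeff 0 q.1, Subtype.ext ?_⟩
  conv_lhs => rw [eq_C_of_pderiv_eq_zero h3]
  change _ = _ • (1 : MvPolynomial (Fin 2) ℝ)
  rw [MvPolynomial.smul_eq_C_mul, mul_one]

/-- Riesz representation with respect to the gradient inner product: a functional on polynomials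
that vanishes on constants is represented by a polynomial. -/
theorem exists_gradPoly_inner_eq (K : PolygonalElement) (F : PolyDeg p →ₗ[ℝ] ℝ)
    (hF : F (onePoly p) = 0) :
    ∃ s : PolyDeg p, ∀ q, inner ℝ (K.gradPoly p s) (K.gradPoly p q) = F q := by
  set W := LinearMap.range (K.gradPoly p) with hW
  set f : PolyDeg p →ₗ[ℝ] W := (K.gradPoly p).rangeRestrict with hf
  have hmem : F ∈ LinearMap.range f.dualMap := by
    rw [LinearMap.range_dualMap_eq_dualAnnihilator_ker, Submodule.mem_dualAnnihilator]
    intro q hq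
    rw [hf, LinearMap.ker_rangeRestrict] at hq
    obtain ⟨a, rfl⟩ := exists_smul_onePoly (LinearMap.mem_ker.mp hq)
    rw [map_smul, hF, smul_zero]
  obtain ⟨φ, hφ⟩ := hmem
  obtain ⟨⟨w, s, rfl⟩, hw⟩ := (InnerProductSpace.toDual ℝ W).surjective
    (LinearMap.toContinuousLinearMap φ)
  refine ⟨s, fun q => ?_⟩
  have h1 := congrArg (fun L => L (f q)) hw
  simp only [InnerProductSpace.toDual_apply_apply, LinearMap.coe_toContinuousLinearMap'] at h1
  rw [← hφ]
  exact h1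


end PolygonalElement

namespace PolygonalElement

variable {K : PolygonalElement} {p : ℕ}

/-- Abstract form of the projection: `u` spans the kernel of the seminorm `‖G (e ·)‖`, and the
component along `u` is fixed by the condition `S (v - e P) (e u) = 0`. -/
theorem existsUnique_projection {V P W : Type*} [AddCommGroup V] [Module ℝ V] [AddCommGroup P]
    [Module ℝ P] [NormedAddCommGroup W] [InnerProductSpace ℝ W] (G : V →ₗ[ℝ] W) (e : P →ₗ[ℝ] V)
    {u : P} (hu : G (e u) = 0) (hker : ∀ q, G (e q) = 0 → ∃ a : ℝ, q = a • u)
    (S : LinearMap.BilinForm ℝ V) (hS : S (e u) (e u) ≠ 0) (v : V) {s : P}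
    (hs : ∀ q, inner ℝ (G (e s)) (G (e q)) = inner ℝ (G v) (G (e q))) :
    ∃! Q, (∀ q, inner ℝ (G (v - e Q)) (G (e q)) = 0) ∧ S (v - e Q) (e u) = 0 := by
  set a := S (v - e s) (e u) / S (e u) (e u) with ha
  have hS1 : ∀ b : ℝ, S (v - e (s + b • u)) (e u) = S (v - e s) (e u) - b * S (e u) (e u) := by
    intro b
    rw [map_add, map_smul, ← sub_sub, map_sub S (v - e s), LinearMap.sub_apply, map_smul S b,
      LinearMap.smul_apply, smul_eq_mul]
  refine ⟨s + a • u, ⟨fun q => ?_, ?_⟩, fun Q hQ => ?_⟩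
  · rw [map_sub, map_add, map_smul, map_add, map_smul, hu, smul_zero, add_zero, inner_sub_left,
      hs q, sub_self]
  · rw [hS1, ha, div_mul_cancel₀ _ hS, sub_self]
  · obtain ⟨hQ1, hQ2⟩ := hQ
    have hdg : G (e (Q - s)) = 0 := by
      rw [← inner_self_eq_zero (𝕜 := ℝ)]
      have e1 := hQ1 (Q - s)
      have e2 := hs (Q - s)
      rw [map_sub, inner_sub_left] at e1
      conv_lhs => enter [2]; rw [map_sub, map_sub]
      rw [inner_sub_left]
      linarith
    obtain ⟨b, hb⟩ := hker _ hdg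
    have hQs : Q = s + b • u := by rw [← hb]; abel
    rw [hQs, hS1, sub_eq_zero] at hQ2
    rw [hQs, ha, hQ2, mul_div_cancel_right₀ _ hS]

/-- The projection `Π^∇_p v` exists and is unique. -/
theorem existsUnique_isPiNabla {S : LinearMap.BilinForm ℝ (K.VESpace p)} (hS : IsStabilisation S)
    (v : K.VESpace p) : ∃! P, IsPiNabla S v P := by
  obtain ⟨s, hs⟩ := K.exists_gradPoly_inner_eq
    (((innerSL ℝ (grad v)).toLinearMap).comp (K.gradPoly p)) (by
      simp only [LinearMap.comp_apply, gradPoly_onePoly, map_zero])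
  exact existsUnique_projection (K.gradLin p) (K.polyVELin p) (u := onePoly p)
    gradPoly_onePoly (fun q hq => exists_smul_onePoly hq) S hS.one_pos.ne' v hs

theorem isPiNabla_piNabla {S : LinearMap.BilinForm ℝ (K.VESpace p)} (hS : IsStabilisation S)
    (v : K.VESpace p) : IsPiNabla S v (piNabla S v) :=
  Classical.epsilon_spec (existsUnique_isPiNabla hS v).exists

theorem exists_isStabLift {S : LinearMap.BilinForm ℝ (K.VESpace p)} (hS : IsStabilisation S)
    (φ : K.VESpace p) : ∃ s, IsStabLift S φ s :=
  K.exists_gradPoly_inner_eq ((S (complProj S φ)).comp (K.polyVELin p))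
    (isPiNabla_piNabla hS φ).2

theorem H1grad_eq_zero_of_integral {v : H1 K.carrier}
    (h : ∫ x in K.carrier, inner ℝ (H1grad v x) (H1grad v x) = 0) : H1grad v = 0 := by
  rw [← inner_self_eq_zero (𝕜 := ℝ), L2.inner_def]
  exact h

/-- A virtual function is determined by its trace and its moments up to degree `p - 2`. -/
theorem eq_zero_of_trace_of_moments {v : H1 K.carrier} {f : MvPolynomial (Fin 2) ℝ}
    (hΔ : K.HasWeakLaplacian v (polyFun f)) (h : K.IsTrace v 0)
    (hm : ∫ x in K.carrier, polyFun f x * H1val v x = 0) : v = 0 := by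
  have he := energy_identity (contDiff_polyFun f).continuous h hΔ
  rw [hm, neg_zero] at he
  exact eq_zero_of_grad_eq_zero h (H1grad_eq_zero_of_integral he)

/-- The trace of a virtual function, as a piecewise polynomial on the boundary. -/
def traceFun (K : PolygonalElement) (p : ℕ) (v : K.VESpace p) : K.boundaryPoly p :=
  ⟨v.2.2.choose, v.2.2.choose_spec.1⟩

theorem isTrace_traceFun (v : K.VESpace p) :
    K.IsTrace v.1 (polyOnBoundary (K.traceFun p v).1) :=
  v.2.2.choose_spec.2

theorem polyOnBoundary_add (a b : Fin (K.m + 3) → Polynomial ℝ) :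
    polyOnBoundary (a + b) = polyOnBoundary a + polyOnBoundary b := by
  funext i t
  exact Polynomial.eval_add

theorem polyOnBoundary_smul (r : ℝ) (a : Fin (K.m + 3) → Polynomial ℝ) :
    polyOnBoundary (r • a) = r • polyOnBoundary a := by
  funext i t
  exact Polynomial.eval_smul _ _ _

theorem traceFun_add (v w : K.VESpace p) :
    K.traceFun p (v + w) = K.traceFun p v + K.traceFun p w := by
  have h := IsTrace.add (f := polyOnBoundary (K.traceFun p v).1)
    (g := polyOnBoundary (K.traceFun p w).1) (fun i => ((K.traceFun p v).1 i).continuous)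
    (fun i => ((K.traceFun p w).1 i).continuous) (isTrace_traceFun v) (isTrace_traceFun w)
  rw [← polyOnBoundary_add] at h
  exact Subtype.ext ((isTrace_traceFun (v + w)).unique h)

theorem traceFun_smul (r : ℝ) (v : K.VESpace p) :
    K.traceFun p (r • v) = r • K.traceFun p v := by
  have h := IsTrace.smul (f := polyOnBoundary (K.traceFun p v).1) r (isTrace_traceFun v)
  rw [← polyOnBoundary_smul] at h
  exact Subtype.ext ((isTrace_traceFun (r • v)).unique h)

instance finite_boundaryPoly : Module.Finite ℝ (K.boundaryPoly p) := by
  let c : K.boundaryPoly p →ₗ[ℝ] (Fin (K.m + 3) → Fin (p + 1) → ℝ) :=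
    { toFun := fun q i j => (q.1 i).coeff j
      map_add' := fun a b => by funext i j; simp
      map_smul' := fun r a => by funext i j; simp }
  refine Module.Finite.of_injective c fun a b h => ?_
  refine Subtype.ext (funext fun i => Polynomial.ext fun n => ?_)
  by_cases hn : n < p + 1
  · exact congrFun (congrFun h i) ⟨n, hn⟩
  · rw [Polynomial.coeff_eq_zero_of_natDegree_lt (lt_of_le_of_lt (a.2 i).1 (by omega)),
      Polynomial.coeff_eq_zero_of_natDegree_lt (lt_of_le_of_lt (b.2 i).1 (by omega))]

theorem intervalIntegrable_eval_mul (a b : Polynomial ℝ) :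
    IntervalIntegrable (fun t => a.eval t * b.eval t) volume 0 1 :=
  (a.continuous.mul b.continuous).intervalIntegrable _ _

theorem boundaryInner_comm (f g : Fin (K.m + 3) → ℝ → ℝ) :
    K.boundaryInner f g = K.boundaryInner g f := by
  simp only [boundaryInner, mul_comm]

theorem boundaryInner_add_left (a b g : Fin (K.m + 3) → Polynomial ℝ) :
    K.boundaryInner (polyOnBoundary (a + b)) (polyOnBoundary g)
      = K.boundaryInner (polyOnBoundary a) (polyOnBoundary g)
        + K.boundaryInner (polyOnBoundary b) (polyOnBoundary g) := by
  simp only [boundaryInner, polyOnBoundary, Pi.add_apply, Polynomial.eval_add, add_mul,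
    intervalIntegral.integral_add (intervalIntegrable_eval_mul _ _)
      (intervalIntegrable_eval_mul _ _), mul_add, Finset.sum_add_distrib]

theorem boundaryInner_smul_left (r : ℝ) (a g : Fin (K.m + 3) → Polynomial ℝ) :
    K.boundaryInner (polyOnBoundary (r • a)) (polyOnBoundary g)
      = r * K.boundaryInner (polyOnBoundary a) (polyOnBoundary g) := by
  simp only [boundaryInner, polyOnBoundary, Pi.smul_apply, Polynomial.eval_smul, smul_eq_mul,
    mul_assoc, intervalIntegral.integral_const_mul, Finset.mul_sum]
  refine Finset.sum_congr rfl fun i _ => ?_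
  ring

theorem eq_zero_of_boundaryInner_self {q : Fin (K.m + 3) → Polynomial ℝ}
    (h : K.boundaryInner (polyOnBoundary q) (polyOnBoundary q) = 0) : q = 0 := by
  rw [boundaryInner, Finset.sum_eq_zero_iff_of_nonneg] at h
  · funext i
    exact polynomial_eq_zero_of_integral ((mul_eq_zero.mp (h i (Finset.mem_univ i))).resolve_left
      (edgeLength_pos i).ne')
  · intro i _
    exact mul_nonneg (edgeLength_pos i).le (intervalIntegral.integral_nonneg zero_le_one
      fun t _ => mul_self_nonneg _)

theorem integrable_poly_mul (r : MvPolynomial (Fin 2) ℝ) (u : L2 K.carrier) :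
    Integrable (fun x => polyFun r x * u x) (volume.restrict K.carrier) :=
  integrable_mul_of_memLp (memLp_carrier (contDiff_polyFun r).continuous) (Lp.memLp u)

theorem integral_poly_mul_add (r : MvPolynomial (Fin 2) ℝ) (u w : L2 K.carrier) :
    ∫ x in K.carrier, polyFun r x * (u + w) x
      = (∫ x in K.carrier, polyFun r x * u x) + ∫ x in K.carrier, polyFun r x * w x := by
  rw [← integral_add (integrable_poly_mul r u) (integrable_poly_mul r w)]
  apply integral_congr_ae
  filter_upwards [Lp.coeFn_add u w] with x hx
  rw [hx, Pi.add_apply, mul_add]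

theorem integral_poly_mul_smul (r : MvPolynomial (Fin 2) ℝ) (a : ℝ) (u : L2 K.carrier) :
    ∫ x in K.carrier, polyFun r x * (a • u) x = a * ∫ x in K.carrier, polyFun r x * u x := by
  rw [← integral_const_mul]
  apply integral_congr_ae
  filter_upwards [Lp.coeFn_smul a u] with x hx
  rw [hx, Pi.smul_apply, smul_eq_mul]
  ring

theorem integral_add_poly_mul (r s : MvPolynomial (Fin 2) ℝ) (u : L2 K.carrier) :
    ∫ x in K.carrier, polyFun (r + s) x * u x
      = (∫ x in K.carrier, polyFun r x * u x) + ∫ x in K.carrier, polyFun s x * u x := by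
  rw [← integral_add (integrable_poly_mul _ _) (integrable_poly_mul _ _)]
  refine integral_congr_ae (Eventually.of_forall fun x => ?_)
  simp only [polyFun_add, add_mul]

theorem integral_smul_poly_mul (a : ℝ) (r : MvPolynomial (Fin 2) ℝ) (u : L2 K.carrier) :
    ∫ x in K.carrier, polyFun (a • r) x * u x = a * ∫ x in K.carrier, polyFun r x * u x := by
  rw [← integral_const_mul]
  refine integral_congr_ae (Eventually.of_forall fun x => ?_)
  simp only [polyFun_smul, mul_assoc]

/-- The moments of `L²` functions against polynomials, as a bilinear map. -/
def momentPairing (K : PolygonalElement) (q : ℕ) : L2 K.carrier →ₗ[ℝ] PolyDeg q →ₗ[ℝ] ℝ :=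
  LinearMap.mk₂ ℝ (fun u r => ∫ x in K.carrier, polyFun r.1 x * u x)
    (fun u w r => integral_poly_mul_add r.1 u w) (fun a u r => integral_poly_mul_smul r.1 a u)
    (fun u r s => integral_add_poly_mul r.1 s.1 u) (fun a u r => integral_smul_poly_mul a r.1 u)

/-- The `L²(∂K)` inner product of piecewise polynomials, as a bilinear map. -/
def boundaryPairing (K : PolygonalElement) (p : ℕ) :
    K.boundaryPoly p →ₗ[ℝ] K.boundaryPoly p →ₗ[ℝ] ℝ :=
  LinearMap.mk₂ ℝ (fun g μ => K.boundaryInner (polyOnBoundary μ.1) (polyOnBoundary g.1))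
    (fun g g' μ => by
      simp only [boundaryInner_comm (polyOnBoundary μ.1)]
      exact boundaryInner_add_left g.1 g'.1 μ.1)
    (fun a g μ => by
      simp only [boundaryInner_comm (polyOnBoundary μ.1)]
      exact boundaryInner_smul_left a g.1 μ.1)
    (fun g μ μ' => boundaryInner_add_left μ.1 μ'.1 g.1)
    (fun a g μ => boundaryInner_smul_left a μ.1 g.1)

/-- The trace as a linear map on the virtual element space. -/
def traceLin (K : PolygonalElement) (p : ℕ) : K.VESpace p →ₗ[ℝ] K.boundaryPoly p where
  toFun := K.traceFun p
  map_add' := traceFun_add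
  map_smul' := traceFun_smul

/-- The inclusion of the virtual element space in `L²`, as a linear map. -/
def valVELin (K : PolygonalElement) (p : ℕ) : K.VESpace p →ₗ[ℝ] L2 K.carrier :=
  (LinearMap.fst ℝ (L2 K.carrier) (L2Vec K.carrier)).comp
    ((H1 K.carrier).subtype.comp (K.VESpace p).subtype)

/-- If `f` and `g` pair `V` with finite-dimensional spaces and jointly separate its points, then
every functional on `V` is a difference of a value of the first and a value of the second
pairing. -/
theorem exists_pairing_eq {V A B : Type*} [AddCommGroup V] [Module ℝ V] [AddCommGroup A]
    [Module ℝ A] [Module.Finite ℝ A] [AddCommGroup B] [Module ℝ B] [Module.Finite ℝ B]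
    (f : V →ₗ[ℝ] A →ₗ[ℝ] ℝ) (g : V →ₗ[ℝ] B →ₗ[ℝ] ℝ) (h : ∀ v, f v = 0 → g v = 0 → v = 0)
    (F : V →ₗ[ℝ] ℝ) : ∃ a b, ∀ v, F v = f v a - g v b := by
  let P : V →ₗ[ℝ] Module.Dual ℝ (A × B) :=
    (LinearMap.lcomp ℝ ℝ (LinearMap.fst ℝ A B)).comp f
      - (LinearMap.lcomp ℝ ℝ (LinearMap.snd ℝ A B)).comp g
  have hP : ∀ v a b, P v (a, b) = f v a - g v b := fun v a b => rfl
  have hinj : Function.Injective P := by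
    rw [injective_iff_map_eq_zero]
    intro v hv
    refine h v (LinearMap.ext fun a => ?_) (LinearMap.ext fun b => ?_)
    · have h1 := hP v a 0
      rw [hv, map_zero, sub_zero] at h1
      exact h1.symm
    · have h1 := hP v 0 b
      rw [hv, map_zero, zero_sub] at h1
      exact neg_eq_zero.mp h1.symm
  obtain ⟨ξ, hξ⟩ := LinearMap.dualMap_surjective_of_injective hinj F
  obtain ⟨⟨a, b⟩, hd⟩ := (Module.evalEquiv ℝ (A × B)).surjective ξ
  refine ⟨a, b, fun v => ?_⟩
  rw [← hP, ← hξ, ← hd]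
  rfl

theorem exists_hasWeakLaplacian (v : K.VESpace p) :
    ∃ f : PolyDeg (p - 2), K.HasWeakLaplacian v.1 (polyFun f.1) := by
  obtain ⟨⟨f, hf, h⟩, -⟩ := v.2
  exact ⟨⟨f, hf⟩, h⟩

theorem polyOnBoundary_zero : polyOnBoundary (0 : Fin (K.m + 3) → Polynomial ℝ) = 0 := by
  funext i t
  simp [polyOnBoundary]

theorem boundaryPairing_self {g : K.boundaryPoly p} (h : K.boundaryPairing p g g = 0) :
    g.1 = 0 := eq_zero_of_boundaryInner_self h

theorem isTrace_zero_of_traceFun {v : K.VESpace p} (h : (K.traceFun p v).1 = 0) :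
    K.IsTrace v.1 0 := by
  have h3 := isTrace_traceFun v
  rwa [h, polyOnBoundary_zero] at h3

/-- Unisolvence: the boundary values and the moments against `P_{p-2}` separate virtual
functions. -/
theorem eq_zero_of_pairings_eq_zero {v : K.VESpace p}
    (h1 : K.boundaryPairing p (K.traceFun p v) = 0)
    (h2 : K.momentPairing (p - 2) (H1val v.1) = 0) : v = 0 := by
  have h0 : (K.traceFun p v).1 = 0 :=
    boundaryPairing_self (LinearMap.congr_fun h1 (K.traceFun p v))
  obtain ⟨f, hΔ⟩ := exists_hasWeakLaplacian v
  have h3 : ∫ x in K.carrier, polyFun f.1 x * H1val v.1 x = 0 := LinearMap.congr_fun h2 f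
  exact Subtype.ext (eq_zero_of_trace_of_moments hΔ (isTrace_zero_of_traceFun h0) h3)

theorem exists_boundary_moment_data (F : K.VESpace p →ₗ[ℝ] ℝ) :
    ∃ (μ : K.boundaryPoly p) (r : PolyDeg (p - 2)), ∀ v : K.VESpace p,
      F v = K.boundaryPairing p (K.traceFun p v) μ - K.momentPairing (p - 2) (H1val v.1) r :=
  -- instances given explicitly: unifying through the subtype is slow
  @exists_pairing_eq (K.VESpace p) (K.boundaryPoly p) (PolyDeg (p - 2))
    (K.VESpace p).addCommGroup (K.VESpace p).module _ _ _ _ _ _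
    ((K.boundaryPairing p).comp (K.traceLin p)) ((K.momentPairing (p - 2)).comp (K.valVELin p))
    (fun v h1 h2 => eq_zero_of_pairings_eq_zero (v := v) h1 h2) F

/-- Every functional on the virtual element space is represented by boundary and interior data;
by finite dimensionality this is the dual form of unisolvence. -/
theorem exists_isLiftData (S : LinearMap.BilinForm ℝ (K.VESpace p)) (φ : K.VESpace p) :
    ∃ (μ : K.boundaryPoly p) (r : PolyDeg (p - 2)), IsLiftData S φ μ r := by
  obtain ⟨μ, r, h⟩ := exists_boundary_moment_data (S (complProj S φ))
  refine ⟨μ, r, fun v g hg => ?_⟩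
  have hgt : g.1 = (K.traceFun p v).1 := hg.unique (isTrace_traceFun v)
  rw [hgt]
  exact h v

end PolygonalElement

/-! ### Polynomial vector fields -/

theorem polyFun_mul (a b : MvPolynomial (Fin 2) ℝ) (x : Plane) :
    polyFun (a * b) x = polyFun a x * polyFun b x := by simp [polyFun]

theorem polyFun_sub (a b : MvPolynomial (Fin 2) ℝ) (x : Plane) :
    polyFun (a - b) x = polyFun a x - polyFun b x := by simp [polyFun]

theorem polyFun_neg (a : MvPolynomial (Fin 2) ℝ) (x : Plane) :
    polyFun (-a) x = -polyFun a x := by simp [polyFun]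

theorem polyFun_C (a : ℝ) (x : Plane) : polyFun (MvPolynomial.C a) x = a := by simp [polyFun]

theorem polyFun_X (j : Fin 2) (x : Plane) : polyFun (MvPolynomial.X j) x = x j := by
  simp [polyFun]

theorem polyFun_aeval (h : Polynomial ℝ) (q : MvPolynomial (Fin 2) ℝ) (x : Plane) :
    polyFun (Polynomial.aeval q h) x = h.eval (polyFun q x) := by
  have h1 := Polynomial.aeval_algHom_apply (MvPolynomial.aeval (R := ℝ) fun i => x i) q h
  simp only [MvPolynomial.aeval_eq_eval] at h1
  exact h1.symm

theorem totalDegree_aeval_le (h : Polynomial ℝ) {q : MvPolynomial (Fin 2) ℝ}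
    (hq : q.totalDegree ≤ 1) : (Polynomial.aeval q h).totalDegree ≤ h.natDegree := by
  rw [Polynomial.aeval_eq_sum_range]
  refine MvPolynomial.totalDegree_finsetSum_le fun i hi => ?_
  refine (MvPolynomial.totalDegree_smul_le _ _).trans ((MvPolynomial.totalDegree_pow _ _).trans ?_)
  have := Finset.mem_range.mp hi
  nlinarith

theorem pderiv_comm (i j : Fin 2) (q : MvPolynomial (Fin 2) ℝ) :
    MvPolynomial.pderiv i (MvPolynomial.pderiv j q)
      = MvPolynomial.pderiv j (MvPolynomial.pderiv i q) := by
  rcases eq_or_ne i j with rfl | hij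
  · rfl
  ext m
  simp only [MvPolynomial.coeff_pderiv, Finsupp.add_apply, Finsupp.single_eq_of_ne hij,
    Finsupp.single_eq_of_ne hij.symm, add_zero, add_right_comm m]
  ring

theorem hasDerivAt_polyFun_line (q : MvPolynomial (Fin 2) ℝ) (y u : Plane) (t : ℝ) :
    HasDerivAt (fun t : ℝ => polyFun q (y + t • u))
      (∑ j, polyFun (MvPolynomial.pderiv j q) (y + t • u) * u j) t := by
  have h1 : HasDerivAt (fun t : ℝ => y + t • u) u t := by
    simpa using ((hasDerivAt_id t).smul_const u).const_add y
  have h2 := (hasFDerivAt_polyFun q (y + t • u)).comp_hasDerivAt t h1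
  refine h2.congr_deriv ?_
  simp

/-- The rotated gradient of a polynomial, a divergence-free field. -/
def rotPoly (q : MvPolynomial (Fin 2) ℝ) : Fin 2 → MvPolynomial (Fin 2) ℝ :=
  ![MvPolynomial.pderiv 1 q, -MvPolynomial.pderiv 0 q]

/-- The coefficient `a` which makes `a + b x` equal to `rot q + b (x - c)`. -/
def rtCoeff (c : Plane) (b q : MvPolynomial (Fin 2) ℝ) (j : Fin 2) : MvPolynomial (Fin 2) ℝ :=
  rotPoly q j - MvPolynomial.C (c j) * b

/-- The Euler operator `b ↦ div (b (x - c))`. -/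
def eulerOp (c : Plane) (b : MvPolynomial (Fin 2) ℝ) : MvPolynomial (Fin 2) ℝ :=
  ∑ j, MvPolynomial.pderiv j ((MvPolynomial.X j - MvPolynomial.C (c j)) * b)

theorem contDiff_rtFun (a : Fin 2 → MvPolynomial (Fin 2) ℝ) (b : MvPolynomial (Fin 2) ℝ) :
    ContDiff ℝ ∞ (rtFun a b) := by
  rw [contDiff_piLp]
  intro j
  exact (contDiff_polyFun (a j)).add
    ((contDiff_polyFun b).mul (EuclideanSpace.proj j : Plane →L[ℝ] ℝ).contDiff)

theorem divergence_rtFun (a : Fin 2 → MvPolynomial (Fin 2) ℝ) (b : MvPolynomial (Fin 2) ℝ)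
    (x : Plane) : divergence (rtFun a b) x
      = polyFun (∑ j, MvPolynomial.pderiv j (a j + b * MvPolynomial.X j)) x := by
  have hsum : polyFun (∑ j, MvPolynomial.pderiv j (a j + b * MvPolynomial.X j)) x
      = ∑ j, polyFun (MvPolynomial.pderiv j (a j + b * MvPolynomial.X j)) x := by
    simp only [polyFun, map_sum]
  rw [hsum, divergence]
  refine Finset.sum_congr rfl fun j _ => ?_
  have hd := ((contDiff_rtFun a b).differentiable (by simp) x).hasFDerivAt
  have h1 := ((EuclideanSpace.proj j : Plane →L[ℝ] ℝ).hasFDerivAt.comp x hd).fderiv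
  have h2 : (⇑(EuclideanSpace.proj j : Plane →L[ℝ] ℝ) ∘ rtFun a b)
      = polyFun (a j + b * MvPolynomial.X j) := by
    funext y
    rw [polyFun_add, polyFun_mul, polyFun_X]
    rfl
  rw [h2] at h1
  rw [← gradient_polyFun, gradient_apply, h1]
  rfl

theorem divergence_rtFun_rtCoeff (c : Plane) (b q : MvPolynomial (Fin 2) ℝ) (x : Plane) :
    divergence (rtFun (rtCoeff c b q) b) x = polyFun (eulerOp c b) x := by
  rw [divergence_rtFun]
  congr 1
  have h : ∀ j, rtCoeff c b q j + b * MvPolynomial.X j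
      = rotPoly q j + (MvPolynomial.X j - MvPolynomial.C (c j)) * b := fun j => by
    rw [rtCoeff]; ring
  simp only [h, eulerOp, map_add, Finset.sum_add_distrib]
  have h0 : ∑ j, MvPolynomial.pderiv j (rotPoly q j) = 0 := by
    rw [Fin.sum_univ_two]
    simp only [rotPoly, Matrix.cons_val_zero, Matrix.cons_val_one, map_neg]
    rw [pderiv_comm 0 1]
    ring
  rw [h0, zero_add]

theorem rtFun_rtCoeff (c : Plane) (b q : MvPolynomial (Fin 2) ℝ) (x : Plane) :
    rtFun (rtCoeff c b q) b x
      = WithLp.toLp 2 (fun j => polyFun (rotPoly q j) x) + polyFun b x • (x - c) := by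
  ext j
  simp only [rtFun, rtCoeff, polyFun_sub, polyFun_mul, polyFun_C, PiLp.add_apply, PiLp.smul_apply,
    PiLp.sub_apply, smul_eq_mul]
  ring

/-- The component of `rot q + b (x - c)` normal to a direction `u`. -/
theorem cross_rtFun_rtCoeff (c : Plane) (b q : MvPolynomial (Fin 2) ℝ) (x u : Plane) :
    cross (rtFun (rtCoeff c b q) b x) u
      = ∑ j, polyFun (MvPolynomial.pderiv j q) x * u j + polyFun b x * cross (x - c) u := by
  rw [rtFun_rtCoeff, Fin.sum_univ_two]
  simp only [cross, rotPoly, PiLp.add_apply, PiLp.smul_apply, smul_eq_mul, Matrix.cons_val_zero,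
    Matrix.cons_val_one, polyFun_neg]
  ring

theorem polyFun_eulerOp (c : Plane) (b : MvPolynomial (Fin 2) ℝ) (x : Plane) :
    polyFun (eulerOp c b) x = 2 * polyFun b x
      + ∑ j, polyFun (MvPolynomial.pderiv j b) x * (x - c) j := by
  rw [eulerOp, Fin.sum_univ_two, Fin.sum_univ_two]
  simp [polyFun, MvPolynomial.pderiv_X, Derivation.leibniz]
  ring

/-- The Euler operator is injective, hence bijective on polynomials of bounded degree. -/
theorem eq_zero_of_eulerOp_eq_zero {c : Plane} {b : MvPolynomial (Fin 2) ℝ}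
    (h : eulerOp c b = 0) : b = 0 := by
  refine eq_zero_of_polyFun_eq_zero isOpen_univ Set.univ_nonempty fun x _ => ?_
  -- On the ray through `x` the function `s² b(c + s (x - c))` has derivative `s · eulerOp c b`.
  have hd : ∀ s : ℝ, HasDerivAt (fun s : ℝ => s ^ 2 * polyFun b (c + s • (x - c))) 0 s := by
    intro s
    have h1 := ((hasDerivAt_id s).pow 2).mul (hasDerivAt_polyFun_line b c (x - c) s)
    have h2 := polyFun_eulerOp c b (c + s • (x - c))
    rw [h] at h2
    have h3 : polyFun 0 (c + s • (x - c)) = 0 := by simp [polyFun]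
    rw [h3, add_sub_cancel_left] at h2
    refine h1.congr_deriv ?_
    simp only [Fin.sum_univ_two, PiLp.smul_apply, smul_eq_mul, id, Pi.pow_apply] at h2 ⊢
    push_cast
    linear_combination (-s) * h2
  have hc := is_const_of_deriv_eq_zero (fun s => (hd s).differentiableAt) (fun s => (hd s).deriv) 1 0
  simpa using hc

theorem exists_eulerOp_eq (c : Plane) {n : ℕ} {r : MvPolynomial (Fin 2) ℝ}
    (hr : r ∈ PolyDeg n) : ∃ b ∈ PolyDeg n, eulerOp c b = r := by
  have hmem : ∀ b ∈ PolyDeg n, eulerOp c b ∈ PolyDeg n := by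
    intro b hb
    rw [MvPolynomial.mem_restrictTotalDegree] at hb ⊢
    refine MvPolynomial.totalDegree_finsetSum_le fun j _ => ?_
    refine (totalDegree_pderiv _ j (n + 1) ?_)
    refine (MvPolynomial.totalDegree_mul _ _).trans ?_
    have h1 : (MvPolynomial.X j - MvPolynomial.C (c j) : MvPolynomial (Fin 2) ℝ).totalDegree ≤ 1 :=
      (MvPolynomial.totalDegree_sub_C_le _ _).trans (MvPolynomial.totalDegree_X (R := ℝ) j).le
    omega
  let E : PolyDeg n →ₗ[ℝ] PolyDeg n :=
    { toFun := fun b => ⟨eulerOp c b.1, hmem b.1 b.2⟩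
      map_add' := fun a b => Subtype.ext (by
        simp only [eulerOp, Submodule.coe_add, mul_add, map_add, Finset.sum_add_distrib])
      map_smul' := fun s b => Subtype.ext (by
        simp only [eulerOp, Submodule.coe_smul, mul_smul_comm, Derivation.map_smul,
          Finset.smul_sum, RingHom.id_apply]) }
  have hinj : Function.Injective E := by
    rw [injective_iff_map_eq_zero]
    intro b hb
    exact Subtype.ext (eq_zero_of_eulerOp_eq_zero (congrArg Subtype.val hb))
  obtain ⟨b, hb⟩ := LinearMap.injective_iff_surjective.mp hinj ⟨r, hr⟩
  exact ⟨b.1, b.2, congrArg Subtype.val hb⟩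

/-- A polynomial with mean value `M` on `[0, 1]` is, up to the constant `M`, the derivative of a
polynomial that vanishes at `0` and `1`. -/
theorem exists_bubble {p : ℕ} (m : Polynomial ℝ) (hm : m.natDegree ≤ p) :
    ∃ (h : Polynomial ℝ) (M : ℝ), h.natDegree ≤ p - 1 ∧
      Polynomial.derivative (Polynomial.X * (1 - Polynomial.X) * h) = m - Polynomial.C M := by
  refine ⟨-∑ n ∈ Finset.range (p + 1), Polynomial.C (m.coeff n / (n + 1))
      * ∑ k ∈ Finset.range n, Polynomial.X ^ k,
    ∑ n ∈ Finset.range (p + 1), m.coeff n / (n + 1), ?_, ?_⟩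
  · rw [Polynomial.natDegree_neg]
    refine Polynomial.natDegree_sum_le_of_forall_le _ _ fun n hn => ?_
    refine (Polynomial.natDegree_C_mul_le _ _).trans ?_
    refine Polynomial.natDegree_sum_le_of_forall_le _ _ fun k hk => ?_
    rw [Polynomial.natDegree_X_pow]
    have h1 := Finset.mem_range.mp hn
    have h2 := Finset.mem_range.mp hk
    omega
  · have h1 : Polynomial.X * (1 - Polynomial.X) * -∑ n ∈ Finset.range (p + 1),
        Polynomial.C (m.coeff n / (n + 1)) * ∑ k ∈ Finset.range n, (Polynomial.X : Polynomial ℝ) ^ k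
        = ∑ n ∈ Finset.range (p + 1), Polynomial.C (m.coeff n / (n + 1))
          * (Polynomial.X ^ (n + 1) - Polynomial.X) := by
      rw [mul_neg, Finset.mul_sum, ← Finset.sum_neg_distrib]
      refine Finset.sum_congr rfl fun n _ => ?_
      have h2 := geom_sum_mul_neg (Polynomial.X : Polynomial ℝ) n
      linear_combination (-Polynomial.C (m.coeff n / (n + 1)) * Polynomial.X) * h2
    rw [h1, Polynomial.derivative_sum]
    refine Eq.trans ?_ (congrArg (· - _)
      (m.as_sum_range_C_mul_X_pow' (n := p + 1) (by omega)).symm)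
    rw [map_sum, ← Finset.sum_sub_distrib]
    refine Finset.sum_congr rfl fun n _ => ?_
    have hn : ((n : ℝ) + 1) ≠ 0 := by positivity
    rw [Polynomial.derivative_C_mul, Polynomial.derivative_sub, Polynomial.derivative_X_pow,
      Polynomial.derivative_X, mul_sub, mul_one, add_tsub_cancel_right, ← mul_assoc,
      ← Polynomial.C_mul]
    congr 3
    push_cast
    rw [div_mul_cancel₀ _ hn]

theorem integral_eq_of_bubble {m h : Polynomial ℝ} {M : ℝ}
    (hM : Polynomial.derivative (Polynomial.X * (1 - Polynomial.X) * h) = m - Polynomial.C M) :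
    ∫ t in (0 : ℝ)..1, m.eval t = M := by
  have h1 := intervalIntegral.integral_eq_sub_of_hasDerivAt
    (fun t _ => (Polynomial.X * (1 - Polynomial.X) * h).hasDerivAt t)
    ((Polynomial.continuous _).intervalIntegrable 0 1)
  rw [hM] at h1
  simp only [Polynomial.eval_sub, Polynomial.eval_C, Polynomial.eval_mul, Polynomial.eval_X,
    Polynomial.eval_one] at h1
  rw [intervalIntegral.integral_sub (m.continuous.intervalIntegrable 0 1)
    intervalIntegrable_const] at h1
  simp at h1
  linarith

/-- A cyclic family of increments with sum zero comes from a cyclic family of values. -/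
theorem exists_cyclic_potential {n : ℕ} (M : Fin (n + 1) → ℝ) (hM : ∑ i, M i = 0) :
    ∃ α : Fin (n + 1) → ℝ, ∀ i, α (i + 1) - α i = M i := by
  refine ⟨fun i => ∑ j ∈ Finset.range i.val, M (Fin.ofNat (n + 1) j), fun i => ?_⟩
  have hi : M (Fin.ofNat (n + 1) i.val) = M i := by
    congr 1
    exact Fin.ext (Nat.mod_eq_of_lt i.isLt)
  have hs := Finset.sum_range_succ (fun j => M (Fin.ofNat (n + 1) j)) i.val
  rw [hi] at hs
  beta_reduce
  rcases eq_or_ne i (Fin.last n) with rfl | hne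
  · rw [Fin.last_add_one, Fin.val_zero, Finset.sum_range_zero]
    have htot : ∑ j ∈ Finset.range (n + 1), M (Fin.ofNat (n + 1) j) = 0 := by
      rw [← Fin.sum_univ_eq_sum_range (fun j => M (Fin.ofNat (n + 1) j)), ← hM]
      refine Finset.sum_congr rfl fun j _ => congrArg M (Fin.ext (Nat.mod_eq_of_lt j.isLt))
    rw [Fin.val_last] at hs ⊢
    linarith
  · rw [Fin.val_add_one, if_neg hne]
    linarith

/-! ### Raviart-Thomas fields with prescribed normal trace and divergence -/

namespace PolygonalElement

variable {K : PolygonalElement} {p k : ℕ}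

theorem exists_edgePoly (K : PolygonalElement) (i : Fin (K.m + 3)) {n : ℕ}
    {q : MvPolynomial (Fin 2) ℝ} (hq : q ∈ PolyDeg n) :
    ∃ s : Polynomial ℝ, s.natDegree ≤ n ∧ ∀ t, s.eval t = polyFun q (K.edgeMap i t) := by
  rw [MvPolynomial.mem_restrictTotalDegree] at hq
  set l : Fin 2 → Polynomial ℝ := fun j =>
    Polynomial.C (K.vertex (i + 1) j - K.vertex i j) * Polynomial.X
      + Polynomial.C (K.vertex i j) with hl
  refine ⟨MvPolynomial.aeval l q, ?_, fun t => ?_⟩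
  · have := MvPolynomial.aeval_natDegree_le q hq l (n := 1) fun j =>
      Polynomial.natDegree_linear_le
    simpa using this
  · have h1 := MvPolynomial.eval₂_comp_left (Polynomial.evalRingHom t)
      (algebraMap ℝ (Polynomial ℝ)) l q
    have hc : (Polynomial.evalRingHom t).comp (algebraMap ℝ (Polynomial ℝ))
        = RingHom.id ℝ := by
      ext; simp
    have hj : (⇑(Polynomial.evalRingHom t) ∘ l) = fun j => K.edgeMap i t j := by
      funext j
      simp [hl, edgeMap, AffineMap.lineMap_apply]
      ring
    rw [hc, hj] at h1
    exact h1

/-- The barycentric coordinate of the `i`-th triangle that belongs to its vertex `v_i`. -/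
def baryLeft (K : PolygonalElement) (i : Fin (K.m + 3)) : MvPolynomial (Fin 2) ℝ :=
  MvPolynomial.C ((K.vertex (i + 1) - K.centre) 1 / K.jac i)
      * (MvPolynomial.X 0 - MvPolynomial.C (K.centre 0))
    - MvPolynomial.C ((K.vertex (i + 1) - K.centre) 0 / K.jac i)
      * (MvPolynomial.X 1 - MvPolynomial.C (K.centre 1))

/-- The barycentric coordinate of the `i`-th triangle that belongs to its vertex `v_{i+1}`. -/
def baryRight (K : PolygonalElement) (i : Fin (K.m + 3)) : MvPolynomial (Fin 2) ℝ :=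
  MvPolynomial.C ((K.vertex i - K.centre) 0 / K.jac i)
      * (MvPolynomial.X 1 - MvPolynomial.C (K.centre 1))
    - MvPolynomial.C ((K.vertex i - K.centre) 1 / K.jac i)
      * (MvPolynomial.X 0 - MvPolynomial.C (K.centre 0))

theorem totalDegree_linear_le (a b c d : ℝ) (i j : Fin 2) :
    (MvPolynomial.C a * (MvPolynomial.X i - MvPolynomial.C b)
      - MvPolynomial.C c * (MvPolynomial.X j - MvPolynomial.C d)
      : MvPolynomial (Fin 2) ℝ).totalDegree ≤ 1 := by
  have h : ∀ (a b : ℝ) (i : Fin 2), (MvPolynomial.C a * (MvPolynomial.X i - MvPolynomial.C b)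
      : MvPolynomial (Fin 2) ℝ).totalDegree ≤ 1 := fun a b i => by
    refine (MvPolynomial.totalDegree_mul _ _).trans ?_
    rw [MvPolynomial.totalDegree_C, zero_add]
    exact (MvPolynomial.totalDegree_sub_C_le _ _).trans (MvPolynomial.totalDegree_X (R := ℝ) i).le
  exact (MvPolynomial.totalDegree_sub _ _).trans (max_le (h a b i) (h c d j))

theorem polyFun_baryLeft (i : Fin (K.m + 3)) (s t : ℝ) :
    polyFun (K.baryLeft i) (K.coneMap i s t) = s * (1 - t) := by
  have h := K.cross_coneMap_right i s t
  have hJ := K.jac_ne_zero i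
  simp only [baryLeft, polyFun_sub, polyFun_mul, polyFun_C, polyFun_X]
  simp only [cross, PiLp.sub_apply] at h ⊢
  field_simp
  linarith

theorem polyFun_baryRight (i : Fin (K.m + 3)) (s t : ℝ) :
    polyFun (K.baryRight i) (K.coneMap i s t) = s * t := by
  have h := K.cross_coneMap_left i s t
  have hJ := K.jac_ne_zero i
  simp only [baryRight, polyFun_sub, polyFun_mul, polyFun_C, polyFun_X]
  simp only [cross, PiLp.sub_apply] at h ⊢
  field_simp
  linarith

/-- The stream function on the `i`-th triangle which is linear on the two sides at the centre,
with values `α` and `β` at the vertices, and differs by `t (1 - t) h(t)` from a linear function on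
the edge. -/
def stream (K : PolygonalElement) (i : Fin (K.m + 3)) (α β : ℝ) (h : Polynomial ℝ) :
    MvPolynomial (Fin 2) ℝ :=
  MvPolynomial.C α * K.baryLeft i + MvPolynomial.C β * K.baryRight i
    + K.baryLeft i * K.baryRight i * Polynomial.aeval (K.baryRight i) h

theorem polyFun_stream (i : Fin (K.m + 3)) (α β : ℝ) (h : Polynomial ℝ) (s t : ℝ) :
    polyFun (K.stream i α β h) (K.coneMap i s t)
      = α * (s * (1 - t)) + β * (s * t) + s * (1 - t) * (s * t) * h.eval (s * t) := by
  simp only [stream, polyFun_add, polyFun_mul, polyFun_C, polyFun_aeval, polyFun_baryLeft,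
    polyFun_baryRight]

theorem totalDegree_stream_le (i : Fin (K.m + 3)) (α β : ℝ) {h : Polynomial ℝ} {n : ℕ}
    (hn : h.natDegree ≤ n) : (K.stream i α β h).totalDegree ≤ n + 2 := by
  have hl : (K.baryLeft i).totalDegree ≤ 1 := totalDegree_linear_le _ _ _ _ _ _
  have hr : (K.baryRight i).totalDegree ≤ 1 := totalDegree_linear_le _ _ _ _ _ _
  refine (MvPolynomial.totalDegree_add _ _).trans (max_le
    ((MvPolynomial.totalDegree_add _ _).trans (max_le ?_ ?_)) ?_)
  · refine (MvPolynomial.totalDegree_mul _ _).trans ?_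
    rw [MvPolynomial.totalDegree_C]
    omega
  · refine (MvPolynomial.totalDegree_mul _ _).trans ?_
    rw [MvPolynomial.totalDegree_C]
    omega
  · have h1 := MvPolynomial.totalDegree_mul (K.baryLeft i * K.baryRight i)
      (Polynomial.aeval (K.baryRight i) h)
    have h2 := MvPolynomial.totalDegree_mul (K.baryLeft i) (K.baryRight i)
    have h3 := totalDegree_aeval_le h hr
    omega

theorem coneMap_one_left (i : Fin (K.m + 3)) (t : ℝ) :
    K.coneMap i 1 t = K.vertex i + t • (K.vertex (i + 1) - K.vertex i) := by
  ext j
  rw [coneMap_apply]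
  simp only [PiLp.add_apply, PiLp.smul_apply, PiLp.sub_apply, smul_eq_mul]
  ring

theorem coneMap_one_left' (i : Fin (K.m + 3)) (t : ℝ) : K.coneMap i 1 t = K.edgeMap i t := by
  rw [coneMap, one_smul, add_sub_cancel]

theorem coneMap_zero_right (i : Fin (K.m + 3)) (s : ℝ) :
    K.coneMap i s 0 = K.centre + s • (K.vertex i - K.centre) := by
  rw [coneMap, edgeMap_zero]

theorem coneMap_one_right (i : Fin (K.m + 3)) (s : ℝ) :
    K.coneMap i s 1 = K.centre + s • (K.vertex (i + 1) - K.centre) := by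
  rw [coneMap, edgeMap_one]

/-- The tangential derivative of the stream function along the edge. -/
theorem stream_edge {i : Fin (K.m + 3)} {α β M : ℝ} {m h : Polynomial ℝ} (hM : β - α = M)
    (hh : Polynomial.derivative (Polynomial.X * (1 - Polynomial.X) * h) = m - Polynomial.C M)
    (t : ℝ) :
    ∑ j, polyFun (MvPolynomial.pderiv j (K.stream i α β h)) (K.edgeMap i t)
      * (K.vertex (i + 1) - K.vertex i) j = m.eval t := by
  have h1 := hasDerivAt_polyFun_line (K.stream i α β h) (K.vertex i)
    (K.vertex (i + 1) - K.vertex i) t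
  simp only [← coneMap_one_left, polyFun_stream] at h1
  have h2 := ((Polynomial.X * (1 - Polynomial.X) * h).hasDerivAt t).add
    (((hasDerivAt_id t).const_mul (β - α)).add_const α)
  rw [hh] at h2
  rw [← coneMap_one_left']
  refine h1.unique ?_
  have hfun : (fun t => α * (1 * (1 - t)) + β * (1 * t)
      + 1 * (1 - t) * (1 * t) * Polynomial.eval (1 * t) h)
      = (fun x => (Polynomial.X * (1 - Polynomial.X) * h).eval x)
        + fun x => (β - α) * id x + α := by
    funext x
    simp only [Pi.add_apply, Polynomial.eval_mul, Polynomial.eval_sub, Polynomial.eval_X,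
      Polynomial.eval_one, id, one_mul]
    ring
  rw [hfun]
  refine h2.congr_deriv ?_
  simp only [Polynomial.eval_sub, Polynomial.eval_C, hM]
  ring

/-- The derivative along the side from the centre to `v_{i+1}` is the constant `β`, so that the
rotated gradients of neighbouring stream functions have equal normal components there. -/
theorem stream_right (i : Fin (K.m + 3)) (α β : ℝ) (h : Polynomial ℝ) (s : ℝ) :
    ∑ j, polyFun (MvPolynomial.pderiv j (K.stream i α β h))
      (K.centre + s • (K.vertex (i + 1) - K.centre)) * (K.vertex (i + 1) - K.centre) j = β := by
  have h1 := hasDerivAt_polyFun_line (K.stream i α β h) K.centre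
    (K.vertex (i + 1) - K.centre) s
  simp only [← coneMap_one_right, polyFun_stream] at h1 ⊢
  refine h1.unique ?_
  have h2 := (hasDerivAt_id s).const_mul β
  rw [mul_one] at h2
  refine h2.congr_of_eventuallyEq (Eventually.of_forall fun x => ?_)
  simp

/-- The derivative along the side from the centre to `v_i` is the constant `α`. -/
theorem stream_left (i : Fin (K.m + 3)) (α β : ℝ) (h : Polynomial ℝ) (s : ℝ) :
    ∑ j, polyFun (MvPolynomial.pderiv j (K.stream i α β h))
      (K.centre + s • (K.vertex i - K.centre)) * (K.vertex i - K.centre) j = α := by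
  have h1 := hasDerivAt_polyFun_line (K.stream i α β h) K.centre (K.vertex i - K.centre) s
  simp only [← coneMap_zero_right, polyFun_stream] at h1 ⊢
  refine h1.unique ?_
  have h2 := (hasDerivAt_id s).const_mul α
  rw [mul_one] at h2
  refine h2.congr_of_eventuallyEq (Eventually.of_forall fun x => ?_)
  simp

theorem cross_edgeMap_sub_centre (i : Fin (K.m + 3)) (t : ℝ) :
    cross (K.edgeMap i t - K.centre) (K.vertex (i + 1) - K.vertex i) = K.jac i := by
  rw [edgeMap_sub_centre]
  simp [cross, jac]
  ring

theorem cross_antisymm (a b : Plane) : cross a b = -cross b a := by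
  simp only [cross]; ring

theorem rtCoeff_mem (hp : 2 ≤ p) (hk : p ≤ k) {c : Plane} {b q : MvPolynomial (Fin 2) ℝ}
    (hb : b ∈ PolyDeg (p - 2)) (hq : q.totalDegree ≤ p + 1) (j : Fin 2) :
    rtCoeff c b q j ∈ PolyDeg k := by
  rw [MvPolynomial.mem_restrictTotalDegree] at hb ⊢
  refine (MvPolynomial.totalDegree_sub _ _).trans (max_le ?_ ?_)
  · have h0 := totalDegree_pderiv q 0 (p + 1) hq
    have h1 := totalDegree_pderiv q 1 (p + 1) hq
    fin_cases j
    · simp only [rotPoly, Fin.zero_eta, Matrix.cons_val_zero]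
      omega
    · refine (MvPolynomial.totalDegree_neg (MvPolynomial.pderiv 0 q)).le.trans ?_
      omega
  · refine (MvPolynomial.totalDegree_mul _ _).trans ?_
    rw [MvPolynomial.totalDegree_C]
    omega

/-- The boundary integral of the normal component of `b (x - c)`. -/
theorem integral_eulerOp (b : MvPolynomial (Fin 2) ℝ) :
    ∫ x in K.carrier, polyFun (eulerOp K.centre b) x
      = K.orient * ∑ i, ∫ t in (0 : ℝ)..1, polyFun b (K.edgeMap i t) * K.jac i := by
  have h := K.integral_divergence (η := rtFun (rtCoeff K.centre b 0) b)
    ((contDiff_rtFun _ _).of_le (by exact_mod_cast le_top))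
  simp only [divergence_rtFun_rtCoeff, cross_rtFun_rtCoeff, cross_edgeMap_sub_centre, map_zero] at h
  rw [h]
  congr 1
  refine Finset.sum_congr rfl fun i _ => ?_
  simp [polyFun]

/-- Continuity of the normal component across a side at the centre: `b (x - c)` is tangential there
and the stream functions of the two triangles agree. -/
theorem cross_stream_match (i : Fin (K.m + 3)) (b : MvPolynomial (Fin 2) ℝ) (α β γ : ℝ)
    (h h' : Polynomial ℝ) (s : ℝ) :
    cross (K.vertex (i + 1) - K.centre) (rtFun (rtCoeff K.centre b (K.stream i α β h)) b
        (K.centre + s • (K.vertex (i + 1) - K.centre)))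
      = cross (K.vertex (i + 1) - K.centre) (rtFun (rtCoeff K.centre b (K.stream (i + 1) β γ h')) b
        (K.centre + s • (K.vertex (i + 1) - K.centre))) := by
  rw [cross_antisymm, cross_antisymm (K.vertex (i + 1) - K.centre), cross_rtFun_rtCoeff,
    cross_rtFun_rtCoeff, stream_right, stream_left]

theorem cross_stream_edge {i : Fin (K.m + 3)} (b : MvPolynomial (Fin 2) ℝ) {α β M : ℝ}
    {m h : Polynomial ℝ} (hM : β - α = M)
    (hh : Polynomial.derivative (Polynomial.X * (1 - Polynomial.X) * h) = m - Polynomial.C M)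
    (t : ℝ) :
    cross (rtFun (rtCoeff K.centre b (K.stream i α β h)) b (K.edgeMap i t))
        (K.vertex (i + 1) - K.vertex i) = m.eval t + polyFun b (K.edgeMap i t) * K.jac i := by
  rw [cross_rtFun_rtCoeff, stream_edge hM hh, cross_edgeMap_sub_centre]

/-- The flux `m` through the edges that the rotated gradient has to provide once the flux of
`b (x - c)` is subtracted, with the bubble `h` whose tangential derivative is `m` up to its mean
value `M`, and a potential `α` at the vertices for these mean values. -/
theorem exists_flux (hp : 2 ≤ p) (μ : K.boundaryPoly p) {b : MvPolynomial (Fin 2) ℝ}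
    (hb : b ∈ PolyDeg (p - 2))
    (hcompat : ∑ i, K.edgeLength i * ∫ t in (0 : ℝ)..1, (μ.1 i).eval t
      = ∫ x in K.carrier, polyFun (eulerOp K.centre b) x) :
    ∃ (m h : Fin (K.m + 3) → Polynomial ℝ) (M α : Fin (K.m + 3) → ℝ),
      (∀ i t, (m i).eval t = K.orient * K.edgeLength i * (μ.1 i).eval t
        - polyFun b (K.edgeMap i t) * K.jac i) ∧
      (∀ i, (h i).natDegree ≤ p - 1) ∧
      (∀ i, Polynomial.derivative (Polynomial.X * (1 - Polynomial.X) * h i)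
        = m i - Polynomial.C (M i)) ∧ ∀ i, α (i + 1) - α i = M i := by
  choose bE hbE hbE' using fun i => K.exists_edgePoly i hb
  set m : Fin (K.m + 3) → Polynomial ℝ := fun i =>
    Polynomial.C (K.orient * K.edgeLength i) * μ.1 i - Polynomial.C (K.jac i) * bE i with hm
  have hmeval : ∀ i t, (m i).eval t = K.orient * K.edgeLength i * (μ.1 i).eval t
      - polyFun b (K.edgeMap i t) * K.jac i := fun i t => by
    simp only [hm, Polynomial.eval_sub, Polynomial.eval_mul, Polynomial.eval_C, hbE']
    ring
  have hmdeg : ∀ i, (m i).natDegree ≤ p := fun i => by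
    refine (Polynomial.natDegree_sub_le _ _).trans (max_le ?_ ?_)
    · exact (Polynomial.natDegree_C_mul_le _ _).trans (μ.2 i).1
    · exact (Polynomial.natDegree_C_mul_le _ _).trans ((hbE i).trans (by omega))
  choose h M hh hM using fun i => exists_bubble (m i) (hmdeg i)
  -- the mean values sum to zero by the compatibility condition and the divergence theorem
  have hsum : ∑ i, M i = 0 := by
    have h1 : ∀ i, M i = K.orient * (K.edgeLength i * ∫ t in (0 : ℝ)..1, (μ.1 i).eval t)
        - ∫ t in (0 : ℝ)..1, polyFun b (K.edgeMap i t) * K.jac i := fun i => by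
      rw [← integral_eq_of_bubble (hM i)]
      simp only [hmeval]
      rw [intervalIntegral.integral_sub, intervalIntegral.integral_const_mul, mul_assoc]
      · exact ((μ.1 i).continuous.const_mul _).intervalIntegrable 0 1
      · exact ((continuous_onBoundary (contDiff_polyFun b).continuous i).mul_const
          _).intervalIntegrable 0 1
    simp only [h1, Finset.sum_sub_distrib, ← Finset.mul_sum]
    rw [hcompat, integral_eulerOp, ← mul_assoc, orient_mul_self, one_mul, sub_self]
  obtain ⟨α, hα⟩ := exists_cyclic_potential M hsum
  exact ⟨m, h, M, α, hmeval, hh, hM, hα⟩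

/-- Piecewise Raviart-Thomas fields, continuous in the normal direction across the sides at the
centre, attain all compatible normal traces and divergences. -/
theorem exists_rt_field (hp : 2 ≤ p) (hk : p ≤ k) (μ : K.boundaryPoly p) (r : PolyDeg (p - 2))
    (hcompat : ∑ i, K.edgeLength i * ∫ t in (0 : ℝ)..1, (μ.1 i).eval t
      = ∫ x in K.carrier, polyFun r.1 x) :
    ∃ (a : Fin (K.m + 3) → Fin 2 → MvPolynomial (Fin 2) ℝ) (b : MvPolynomial (Fin 2) ℝ),
      (∀ i j, a i j ∈ PolyDeg k) ∧ b ∈ PolyDeg k ∧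
      (∀ i x, divergence (rtFun (a i) b) x = polyFun r.1 x) ∧
      (∀ i, ∀ s : ℝ, cross (K.vertex (i + 1) - K.centre)
          (rtFun (a i) b (K.centre + s • (K.vertex (i + 1) - K.centre)))
        = cross (K.vertex (i + 1) - K.centre)
          (rtFun (a (i + 1)) b (K.centre + s • (K.vertex (i + 1) - K.centre)))) ∧
      ∀ i t, cross (rtFun (a i) b (K.edgeMap i t)) (K.vertex (i + 1) - K.vertex i)
        = K.orient * K.edgeLength i * (μ.1 i).eval t := by
  obtain ⟨b, hb, hbr⟩ := exists_eulerOp_eq K.centre r.2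
  rw [← hbr] at hcompat
  obtain ⟨m, h, M, α, hm, hh, hM, hα⟩ := exists_flux hp μ hb hcompat
  have hdeg : ∀ i, (K.stream i (α i) (α (i + 1)) (h i)).totalDegree ≤ p + 1 := fun i =>
    (totalDegree_stream_le i _ _ (hh i)).trans (by omega)
  have hbk : b ∈ PolyDeg k := by
    rw [MvPolynomial.mem_restrictTotalDegree] at hb ⊢
    omega
  refine ⟨fun i => rtCoeff K.centre b (K.stream i (α i) (α (i + 1)) (h i)), b,
    fun i => rtCoeff_mem hp hk hb (hdeg i), hbk, fun i x => ?_, fun i s => ?_, fun i t => ?_⟩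
  · rw [divergence_rtFun_rtCoeff, hbr]
  · exact cross_stream_match i b _ _ _ _ _ s
  · rw [cross_stream_edge b (hα i) (hM i), hm, sub_add_cancel]

end PolygonalElement

/-! ### The field of minimal norm -/

namespace PolygonalElement

variable {K : PolygonalElement} {p k : ℕ}

/-- The coefficients of a piecewise Raviart-Thomas field. -/
abbrev RTCoeffs (K : PolygonalElement) (k : ℕ) :=
  Fin (K.m + 3) → (Fin 2 → PolyDeg k) × PolyDeg k

/-- The piecewise Raviart-Thomas field with given coefficients, set to zero off the open
triangles. -/
def rtField (A : RTCoeffs K k) (x : Plane) : Plane :=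
  ∑ i, (K.openTri i).indicator (rtFun (fun j => ((A i).1 j).1) (A i).2.1) x

theorem rtField_eq {A : RTCoeffs K k} {i : Fin (K.m + 3)} {x : Plane} (hx : x ∈ K.openTri i) :
    rtField A x = rtFun (fun j => ((A i).1 j).1) (A i).2.1 x := by
  rw [rtField, Finset.sum_eq_single i, Set.indicator_of_mem hx]
  · intro j _ hj
    exact Set.indicator_of_notMem (Set.disjoint_right.mp (K.openTri_disjoint hj) hx) _
  · simp

theorem memLp_rtField (A : RTCoeffs K k) : MemLp (rtField A) 2 (volume.restrict K.carrier) :=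
  memLp_finsetSum _ fun i _ =>
    (memLp_carrier (contDiff_rtFun _ _).continuous).indicator (K.measurableSet_openTri i)

theorem rtFun_add (a a' : Fin 2 → MvPolynomial (Fin 2) ℝ) (b b' : MvPolynomial (Fin 2) ℝ)
    (x : Plane) :
    rtFun (fun j => a j + a' j) (b + b') x = rtFun a b x + rtFun a' b' x := by
  ext j
  simp only [rtFun, polyFun_add, PiLp.add_apply]
  ring

theorem rtFun_smul (s : ℝ) (a : Fin 2 → MvPolynomial (Fin 2) ℝ) (b : MvPolynomial (Fin 2) ℝ)
    (x : Plane) : rtFun (fun j => s • a j) (s • b) x = s • rtFun a b x := by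
  ext j
  simp only [rtFun, polyFun_smul, PiLp.smul_apply, smul_eq_mul]
  ring

theorem rtField_add (A B : RTCoeffs K k) : rtField (A + B) = rtField A + rtField B := by
  funext x
  rw [Pi.add_apply]
  simp only [rtField]
  rw [← Finset.sum_add_distrib]
  refine Finset.sum_congr rfl fun i _ => ?_
  by_cases hx : x ∈ K.openTri i
  · simp only [Set.indicator_of_mem hx]
    exact rtFun_add _ _ _ _ x
  · simp only [Set.indicator_of_notMem hx, add_zero]

theorem rtField_smul (s : ℝ) (A : RTCoeffs K k) : rtField (s • A) = s • rtField A := by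
  funext x
  rw [Pi.smul_apply]
  simp only [rtField]
  rw [Finset.smul_sum]
  refine Finset.sum_congr rfl fun i _ => ?_
  by_cases hx : x ∈ K.openTri i
  · simp only [Set.indicator_of_mem hx]
    exact rtFun_smul _ _ _ x
  · simp only [Set.indicator_of_notMem hx, smul_zero]

/-- Piecewise Raviart-Thomas fields as elements of `L²(K)²`, linearly in their coefficients. -/
def rtLin (K : PolygonalElement) (k : ℕ) : RTCoeffs K k →ₗ[ℝ] L2Vec K.carrier where
  toFun A := (memLp_rtField A).toLp (rtField A)
  map_add' A B := by
    rw [← MemLp.toLp_add]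
    exact MemLp.toLp_congr _ _ (Eventually.of_forall fun x => congrFun (rtField_add A B) x)
  map_smul' s A := by
    rw [RingHom.id_apply, ← MemLp.toLp_const_smul]
    exact MemLp.toLp_congr _ _ (Eventually.of_forall fun x => congrFun (rtField_smul s A) x)

theorem coeFn_rtLin (A : RTCoeffs K k) :
    K.rtLin k A =ᵐ[volume.restrict K.carrier] rtField A :=
  MemLp.coeFn_toLp (memLp_rtField A)

theorem restrict_openTri_eq (i : Fin (K.m + 3)) :
    (volume : Measure Plane).restrict (K.subTriangle i) = volume.restrict (K.openTri i) :=
  Measure.restrict_congr_set (K.openTri_ae_eq i).symm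

theorem isPiecewiseRT_rtLin (A : RTCoeffs K k) : IsPiecewiseRT k (K.rtLin k A) := by
  intro i
  refine ⟨(A i).1, (A i).2, ?_⟩
  rw [restrict_openTri_eq]
  filter_upwards [ae_restrict_of_ae_restrict_of_subset (K.openTri_subset i) (coeFn_rtLin A),
    ae_restrict_mem (K.measurableSet_openTri i)] with x hx hxi
  rw [hx, rtField_eq hxi]

theorem ae_eq_of_openTri {E : Type*} {f g : Plane → E}
    (h : ∀ i, f =ᵐ[volume.restrict (K.openTri i)] g) : f =ᵐ[volume.restrict K.carrier] g := by
  rw [Measure.restrict_congr_set K.carrier_ae_eq, EventuallyEq, ae_restrict_iUnion_iff]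
  exact h

theorem IsPiecewiseRT.mem_range {τ : L2Vec K.carrier} (h : IsPiecewiseRT k τ) :
    τ ∈ LinearMap.range (K.rtLin k) := by
  choose a b hab using h
  refine ⟨fun i => (a i, b i), Lp.ext (ae_eq_of_openTri fun i => ?_)⟩
  have h1 := hab i
  rw [restrict_openTri_eq] at h1
  filter_upwards [ae_restrict_of_ae_restrict_of_subset (K.openTri_subset i)
    (coeFn_rtLin (K := K) (k := k) fun i => (a i, b i)), h1,
    ae_restrict_mem (K.measurableSet_openTri i)] with x hx hx1 hxi
  rw [hx, hx1, rtField_eq hxi]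

theorem coe_range_rtLin : (LinearMap.range (K.rtLin k) : Set (L2Vec K.carrier))
    = {τ | IsPiecewiseRT k τ} :=
  Set.Subset.antisymm (by rintro _ ⟨A, rfl⟩; exact isPiecewiseRT_rtLin A)
    fun _ h => IsPiecewiseRT.mem_range h

theorem onBoundary_eq_zero {ψ : Plane → ℝ} (hψ : IsTestFun K.carrier ψ) (i : Fin (K.m + 3))
    {t : ℝ} (ht : t ∈ Set.Icc (0 : ℝ) 1) : K.onBoundary ψ i t = 0 :=
  image_eq_zero_of_notMem_tsupport (f := ψ) (x := K.edgeMap i t) fun h =>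
    K.notMem_of_mem_frontier (K.edgeMap_mem_frontier i ht) (hψ.2.2 h)

/-- Green's formula for smooth functions contains the weak divergence, since test functions vanish
on the boundary. -/
theorem HasNormalTrace.hasWeakDiv {τ : L2Vec K.carrier} {d : Plane → ℝ}
    {g : Fin (K.m + 3) → ℝ → ℝ} (h : HasNormalTrace τ d g) : HasWeakDiv τ d := by
  intro ψ hψ
  have h1 := h ψ hψ.1
  have h2 : K.boundaryInner g (K.onBoundary ψ) = 0 := by
    refine Finset.sum_eq_zero fun i _ => ?_
    rw [intervalIntegral_eq_Icc, setIntegral_congr_fun (g := fun _ => (0 : ℝ)) measurableSet_Icc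
      fun t ht => by simp only [onBoundary_eq_zero hψ i ht, mul_zero]]
    simp
  rw [h2] at h1
  linarith

theorem integral_inner_gradient_eq (τ : L2Vec K.carrier) {w : Plane → ℝ} (hw : ContDiff ℝ ∞ w) :
    ∫ x in K.carrier, inner ℝ (τ x) (gradient w x)
      = inner ℝ τ ((memLp_carrier (K := K) (continuous_gradient hw)).toLp (gradient w)) := by
  rw [L2.inner_def]
  apply integral_congr_ae
  filter_upwards [(memLp_carrier (K := K) (continuous_gradient hw)).coeFn_toLp] with x hx
  rw [hx]

theorem isClosed_hasNormalTrace (d : Plane → ℝ) (g : Fin (K.m + 3) → ℝ → ℝ) :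
    IsClosed {τ : L2Vec K.carrier | HasNormalTrace τ d g} := by
  simp only [HasNormalTrace, Set.ofPred_forall]
  refine isClosed_iInter fun w => isClosed_iInter fun hw => ?_
  simp only [integral_inner_gradient_eq _ hw]
  exact isClosed_eq ((continuous_id.inner continuous_const).add continuous_const) continuous_const

theorem convex_hasNormalTrace (d : Plane → ℝ) (g : Fin (K.m + 3) → ℝ → ℝ) :
    Convex ℝ {τ : L2Vec K.carrier | HasNormalTrace τ d g} := by
  intro τ hτ σ hσ a b _ _ hab w hw
  have h1 := hτ w hw
  have h2 := hσ w hw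
  rw [integral_inner_gradient_eq _ hw] at h1 h2 ⊢
  rw [inner_add_left, real_inner_smul_left, real_inner_smul_left]
  obtain rfl : b = 1 - a := by linarith
  linear_combination a * h1 + (1 - a) * h2

/-- Admissible fields are the piecewise Raviart-Thomas fields, a finite-dimensional space, that
satisfy Green's formula; the weak divergence need not be imposed separately. -/
theorem admissible_eq (k : ℕ) (μ : K.boundaryPoly p) (r : PolyDeg (p - 2)) :
    admissible k μ r = (LinearMap.range (K.rtLin k) : Set (L2Vec K.carrier))
      ∩ {τ | HasNormalTrace τ (polyFun r.1) (polyOnBoundary μ.1)} := by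
  rw [coe_range_rtLin]
  ext τ
  exact ⟨fun h => ⟨h.1, h.2.2⟩, fun h => ⟨h.1, h.2.hasWeakDiv, h.2⟩⟩

/-- A field of minimal norm exists: it is the projection of zero onto a closed convex set. -/
theorem exists_isMinOn_admissible {k : ℕ} {μ : K.boundaryPoly p} {r : PolyDeg (p - 2)}
    (hne : (admissible k μ r).Nonempty) : ∃ θ ∈ admissible k μ r,
      IsMinOn (fun τ : L2Vec K.carrier => ‖τ‖) (admissible k μ r) θ := by
  have hcl : IsClosed (admissible k μ r) := by
    rw [admissible_eq]
    exact (Submodule.closed_of_finiteDimensional _).inter (isClosed_hasNormalTrace _ _)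
  have hconv : Convex ℝ (admissible k μ r) := by
    rw [admissible_eq]
    exact (Submodule.convex _).inter (convex_hasNormalTrace _ _)
  obtain ⟨θ, hθ, hmin⟩ := exists_norm_eq_iInf_of_complete_convex hne hcl.isComplete hconv 0
  refine ⟨θ, hθ, fun τ hτ => ?_⟩
  simp only [zero_sub, norm_neg] at hmin
  change ‖θ‖ ≤ ‖τ‖
  rw [hmin]
  exact ciInf_le ⟨0, by rintro _ ⟨w, rfl⟩; exact norm_nonneg _⟩
    (⟨τ, hτ⟩ : (admissible k μ r : Set (L2Vec K.carrier)))

/-- Green's formula for a field which is smooth on every triangle and has continuous normal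
components across the sides at the centre. -/
theorem green_piecewise {η : Fin (K.m + 3) → Plane → Plane} (hη : ∀ i, ContDiff ℝ ∞ (η i))
    (hmatch : ∀ i, ∀ s : ℝ, cross (K.vertex (i + 1) - K.centre)
        (η i (K.centre + s • (K.vertex (i + 1) - K.centre)))
      = cross (K.vertex (i + 1) - K.centre)
        (η (i + 1) (K.centre + s • (K.vertex (i + 1) - K.centre))))
    {w : Plane → ℝ} (hw : ContDiff ℝ ∞ w) :
    ∑ i, ∫ x in K.openTri i, (inner ℝ (η i x) (gradient w x) + w x * divergence (η i) x)
      = K.orient * ∑ i, ∫ t in (0 : ℝ)..1, w (K.edgeMap i t)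
        * cross (η i (K.edgeMap i t)) (K.vertex (i + 1) - K.vertex i) := by
  have hcs : ∀ (u v : Plane) (a : ℝ), cross u (a • v) = a * cross u v := fun u v a => by
    simp only [cross, PiLp.smul_apply, smul_eq_mul]; ring
  have hcs' : ∀ (u v : Plane) (a : ℝ), cross (a • u) v = a * cross u v := fun u v a => by
    simp only [cross, PiLp.smul_apply, smul_eq_mul]; ring
  have h := K.sum_integral_divergence (fun i x => w x • η i x)
    (fun i => (hw.smul (hη i)).of_le (by exact_mod_cast le_top)) fun i s => by
      simp only [hcs, hmatch]
  simp only [hcs'] at h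
  rw [← h]
  refine Finset.sum_congr rfl fun i _ => ?_
  congr 1
  funext x
  rw [divergence_smul (hw.differentiable (by simp) x) ((hη i).differentiable (by simp) x)]

theorem admissible_nonempty (hp : 2 ≤ p) (hk : p ≤ k) (μ : K.boundaryPoly p) (r : PolyDeg (p - 2))
    (hcompat : ∑ i, K.edgeLength i * ∫ t in (0 : ℝ)..1, (μ.1 i).eval t
      = ∫ x in K.carrier, polyFun r.1 x) : (admissible k μ r).Nonempty := by
  obtain ⟨a, b, ha, hb, hdiv, hmatch, hedge⟩ := exists_rt_field hp hk μ r hcompat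
  set A : RTCoeffs K k := fun i => (fun j => ⟨a i j, ha i j⟩, ⟨b, hb⟩) with hA
  refine ⟨K.rtLin k A, ?_⟩
  rw [admissible_eq]
  refine ⟨⟨A, rfl⟩, fun w hw => ?_⟩
  have hg := green_piecewise (fun i => contDiff_rtFun (a i) b) hmatch hw
  simp only [hdiv, hedge] at hg
  have hi1 : Integrable (fun x => inner ℝ (rtField A x) (gradient w x))
      (volume.restrict K.carrier) := by
    have hw2 := memLp_carrier (K := K) (continuous_gradient hw)
    refine (L2.integrable_inner (𝕜 := ℝ) (K.rtLin k A) (hw2.toLp _)).congr ?_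
    filter_upwards [coeFn_rtLin A, hw2.coeFn_toLp] with x hx hx'
    rw [hx, hx']
  have hi2 : Integrable (fun x => polyFun r.1 x * w x) (volume.restrict K.carrier) :=
    K.integrableOn_of_continuous ((contDiff_polyFun r.1).continuous.mul hw.continuous)
  have e1 : ∫ x in K.carrier, inner ℝ (K.rtLin k A x) (gradient w x)
      = ∫ x in K.carrier, inner ℝ (rtField A x) (gradient w x) := by
    apply integral_congr_ae
    filter_upwards [coeFn_rtLin A] with x hx
    rw [hx]
  rw [e1, ← integral_add hi1 hi2, K.integral_carrier_eq_sum
    (f := fun x => inner ℝ (rtField A x) (gradient w x) + polyFun r.1 x * w x) (hi1.add hi2)]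
  have e2 : ∀ i, ∫ x in K.openTri i, (inner ℝ (rtField A x) (gradient w x) + polyFun r.1 x * w x)
      = ∫ x in K.openTri i, (inner ℝ (rtFun (a i) b x) (gradient w x) + w x * polyFun r.1 x) :=
    fun i => setIntegral_congr_fun (K.measurableSet_openTri i) fun x hx => by
      simp only [rtField_eq hx, mul_comm (w x)]
      rfl
  refine (Finset.sum_congr rfl fun i _ => e2 i).trans (hg.trans ?_)
  rw [Finset.mul_sum, boundaryInner]
  refine Finset.sum_congr rfl fun i _ => ?_
  rw [← intervalIntegral.integral_const_mul, ← intervalIntegral.integral_const_mul]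
  congr 1
  funext t
  simp only [polyOnBoundary, onBoundary]
  linear_combination (K.edgeLength i * (μ.1 i).eval t * w (K.edgeMap i t)) * K.orient_mul_self

end PolygonalElement

/-! ### The generalised gradient on an element -/

namespace PolygonalElement

variable {K : PolygonalElement} {p k : ℕ}

theorem polyFun_one (x : Plane) : polyFun 1 x = 1 := by simp [polyFun]

/-- Testing the representation with the constant `1`, which `S((I - Π) φ, ·)` annihilates. -/
theorem IsLiftData.compat {S : LinearMap.BilinForm ℝ (K.VESpace p)} (hS : IsStabilisation S)
    {φ : K.VESpace p} {μ : K.boundaryPoly p} {r : PolyDeg (p - 2)} (h : IsLiftData S φ μ r) :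
    ∑ i, K.edgeLength i * ∫ t in (0 : ℝ)..1, (μ.1 i).eval t = ∫ x in K.carrier, polyFun r.1 x := by
  set g : K.boundaryPoly p := ⟨fun _ => 1, fun i => by simp⟩ with hg
  have htr : K.IsTrace (K.oneVE p).1 (polyOnBoundary g.1) := by
    have h1 := isTrace_polyH1 K 1
    have h2 : K.onBoundary (polyFun 1) = polyOnBoundary g.1 := by
      funext i t
      simp [onBoundary, polyOnBoundary, hg, polyFun_one]
    rw [h2] at h1
    exact h1
  have h3 := h (K.oneVE p) g htr
  have h4 : S (complProj S φ) (K.oneVE p) = 0 := (isPiNabla_piNabla hS φ).2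
  have h5 : ∫ x in K.carrier, polyFun r.1 x * H1val (K.oneVE p).1 x
      = ∫ x in K.carrier, polyFun r.1 x := by
    apply integral_congr_ae
    filter_upwards [coeFn_H1val_polyH1 K 1] with x hx
    change polyFun r.1 x * H1val (K.polyH1 1) x = _
    rw [hx, polyFun_one, mul_one]
  have h6 : K.boundaryInner (polyOnBoundary μ.1) (polyOnBoundary g.1)
      = ∑ i, K.edgeLength i * ∫ t in (0 : ℝ)..1, (μ.1 i).eval t := by
    simp [boundaryInner, polyOnBoundary, hg]
  rw [h4, h5, h6] at h3
  linarith

theorem exists_isGenGradient (hp : 2 ≤ p) (hk : p ≤ k)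
    {S : LinearMap.BilinForm ℝ (K.VESpace p)} (hS : IsStabilisation S) (φ : K.VESpace p) :
    ∃ G, IsGenGradient k S φ G := by
  obtain ⟨s, hs⟩ := exists_isStabLift hS φ
  obtain ⟨μ, r, hμ⟩ := exists_isLiftData S φ
  obtain ⟨θ, hθ, hmin⟩ := exists_isMinOn_admissible (k := k)
    (admissible_nonempty hp hk μ r (hμ.compat hS))
  exact ⟨_, s, μ, r, θ, hs, hμ, ⟨hθ, hmin⟩, rfl⟩

theorem isPiecewiseRT_gradPoly (hk : p ≤ k) (q : PolyDeg p) :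
    IsPiecewiseRT k (H1grad (K.polyH1 q.1)) := by
  have hq : ∀ j, MvPolynomial.pderiv j q.1 ∈ PolyDeg k := fun j => by
    have h := q.2
    rw [MvPolynomial.mem_restrictTotalDegree] at h ⊢
    exact (totalDegree_pderiv _ j _ h).trans (by omega)
  intro i
  refine ⟨fun j => ⟨MvPolynomial.pderiv j q.1, hq j⟩, 0, ?_⟩
  rw [restrict_openTri_eq]
  filter_upwards [ae_restrict_of_ae_restrict_of_subset (K.openTri_subset i)
    (coeFn_H1grad_polyH1 K q.1)] with x hx
  rw [hx]
  ext j
  rw [gradient_polyFun]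
  simp [rtFun, polyFun]

/-- Green's formula between a field with polynomial normal trace and an `H¹` function with
polynomial trace. -/
theorem HasNormalTrace.inner_H1grad {d : Plane → ℝ} (hd : Continuous d)
    {μ g : Fin (K.m + 3) → Polynomial ℝ} {θ : L2Vec K.carrier}
    (hθ : HasNormalTrace θ d (polyOnBoundary μ)) {v : H1 K.carrier}
    (h : K.IsTrace v (polyOnBoundary g)) :
    inner ℝ θ (H1grad v) = K.boundaryInner (polyOnBoundary μ) (polyOnBoundary g)
      - ∫ x in K.carrier, d x * H1val v x := by
  have h2 := green_of_isTrace (g := polyOnBoundary g) (ν := polyOnBoundary μ) (Lp.memLp θ)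
    (memLp_carrier hd) (fun i => (μ i).continuous) hθ (fun i => (g i).continuous) h
  rw [← h2, L2.inner_def, add_sub_cancel_right]

/-- The part of the generalised gradient that comes from the boundary and interior data represents
the stabilisation. -/
theorem inner_eq_of_admissible {S : LinearMap.BilinForm ℝ (K.VESpace p)} {φ : K.VESpace p}
    {μ : K.boundaryPoly p} {r : PolyDeg (p - 2)} (h : IsLiftData S φ μ r) {θ : L2Vec K.carrier}
    (hθ : HasNormalTrace θ (polyFun r.1) (polyOnBoundary μ.1)) (v : K.VESpace p) :
    inner ℝ θ (H1grad v.1) = S (complProj S φ) v :=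
  (hθ.inner_H1grad (contDiff_polyFun r.1).continuous (isTrace_traceFun v)).trans
    (h v (K.traceFun p v) (isTrace_traceFun v)).symm

/-- Linear algebra of the identity `a_h(φ, v) = (G, ∇v)`: `a`, `b`, `c`, `d` are the gradients of
`Π φ`, of the stabilisation lift, of `Π v` and of `v`. -/
theorem inner_identity {W : Type*} [NormedAddCommGroup W] [InnerProductSpace ℝ W]
    {a b c d θ : W} {x y : ℝ} (h1 : inner ℝ (d - c) a = 0) (h2 : inner ℝ (d - c) b = 0)
    (h3 : inner ℝ b c = y) (h4 : inner ℝ θ d = x) :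
    inner ℝ a c + (x - y) = inner ℝ (a - b + θ) d := by
  rw [inner_sub_left] at h1 h2
  rw [inner_add_left, inner_sub_left, real_inner_comm d a, real_inner_comm d b,
    real_inner_comm c a, h4, ← h3, real_inner_comm c b]
  linarith

theorem IsGenGradient.localForm_eq {S : LinearMap.BilinForm ℝ (K.VESpace p)}
    (hS : IsStabilisation S) {φ : K.VESpace p} {G : L2Vec K.carrier} (hG : IsGenGradient k S φ G)
    (v : K.VESpace p) : localForm S φ v = inner ℝ G (grad v) := by
  obtain ⟨s, μ, r, θ, hs, hμ, ⟨hθ, -⟩, rfl⟩ := hG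
  have hv := (isPiNabla_piNabla hS v).1
  have h5 : S (complProj S φ) (complProj S v)
      = S (complProj S φ) v - S (complProj S φ) (K.polyVE (piNabla S v)) :=
    (S (complProj S φ)).map_sub v (K.polyVE (piNabla S v))
  rw [localForm, h5]
  exact inner_identity (hv (piNabla S φ)) (hv s) (hs (piNabla S v))
    (inner_eq_of_admissible hμ hθ.2.2 v)

theorem IsGenGradient.isPiecewiseRT (hk : p ≤ k) {S : LinearMap.BilinForm ℝ (K.VESpace p)}
    {φ : K.VESpace p} {G : L2Vec K.carrier} (hG : IsGenGradient k S φ G) : IsPiecewiseRT k G := by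
  obtain ⟨s, μ, r, θ, -, -, ⟨hθ, -⟩, rfl⟩ := hG
  have h1 := (isPiecewiseRT_gradPoly (K := K) hk (piNabla S φ)).mem_range
  have h2 := (isPiecewiseRT_gradPoly (K := K) hk s).mem_range
  have h3 : _ ∈ (LinearMap.range (K.rtLin k) : Set (L2Vec K.carrier)) :=
    Submodule.add_mem _ (Submodule.sub_mem _ h1 h2) hθ.1.mem_range
  rw [coe_range_rtLin] at h3
  exact h3

end PolygonalElement

/-! ### The generalised gradient on the mesh -/

namespace PolygonalMesh

variable {Ω : Set Plane} {T : PolygonalMesh Ω} {p k : ℕ}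

theorem volume_frontier (K : PolygonalElement) : volume (frontier K.carrier) = 0 := by
  rw [K.frontier_eq]
  exact measure_iUnion_null fun i => volume_segment _ _

/-- The elements fill the domain up to their frontiers, which are null sets. -/
theorem domain_ae_eq (T : PolygonalMesh Ω) : Ω =ᵐ[volume] ⋃ i, (T.elem i).carrier := by
  refine (ae_eq_set (μ := volume)).mpr ⟨?_, ?_⟩
  · refine measure_mono_null (t := ⋃ i, frontier (T.elem i).carrier) ?_
      (measure_iUnion_null fun i => volume_frontier _)
    rintro x ⟨hx, hx'⟩
    have h1 : x ∈ ⋃ i, closure (T.elem i).carrier := T.cover ▸ subset_closure hx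
    obtain ⟨i, hi⟩ := Set.mem_iUnion.mp h1
    refine Set.mem_iUnion.mpr ⟨i, ?_⟩
    rw [(T.elem i).isOpen.frontier_eq]
    exact ⟨hi, fun h => hx' (Set.mem_iUnion.mpr ⟨i, h⟩)⟩
  · rw [Set.sdiff_eq_empty.mpr (Set.iUnion_subset T.subset), measure_empty]

theorem inner_eq_sum (T : PolygonalMesh Ω) (F G : L2Vec Ω) :
    inner ℝ F G = ∑ i, inner ℝ (restrictLp (T.subset i) F) (restrictLp (T.subset i) G) := by
  have hint : IntegrableOn (fun x => inner ℝ (F x) (G x)) Ω := L2.integrable_inner F G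
  rw [L2.inner_def, setIntegral_congr_set T.domain_ae_eq,
    integral_iUnion_fintype (fun i => (T.elem i).isOpen.measurableSet)
      (fun i j hij => T.disjoint i j hij) fun i => hint.mono_set (T.subset i)]
  refine Finset.sum_congr rfl fun i _ => ?_
  rw [L2.inner_def]
  apply integral_congr_ae
  filter_upwards [coeFn_restrictLp (T.subset i) F, coeFn_restrictLp (T.subset i) G] with x h1 h2
  rw [h1, h2]

/-- Square-integrable fields on the elements glue to a square-integrable field on the domain. -/
theorem exists_restrictLp_eq (T : PolygonalMesh Ω) (G : ∀ i, L2Vec (T.elem i).carrier) :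
    ∃ F : L2Vec Ω, ∀ i, restrictLp (T.subset i) F = G i := by
  set f : Plane → Plane := fun x => ∑ i, (T.elem i).carrier.indicator (G i) x with hf
  have hfL : MemLp f 2 (volume.restrict Ω) := by
    refine memLp_finsetSum _ fun i _ => ?_
    rw [memLp_indicator_iff_restrict (T.elem i).isOpen.measurableSet,
      Measure.restrict_restrict_of_subset (T.subset i)]
    exact Lp.memLp (G i)
  refine ⟨hfL.toLp f, fun i => Lp.ext ?_⟩
  filter_upwards [coeFn_restrictLp (T.subset i) (hfL.toLp f),
    ae_restrict_of_ae_restrict_of_subset (T.subset i) hfL.coeFn_toLp,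
    ae_restrict_mem (T.elem i).isOpen.measurableSet] with x h1 h2 hx
  rw [h1, h2]
  change ∑ j, (T.elem j).carrier.indicator (G j) x = G i x
  rw [Finset.sum_eq_single i, Set.indicator_of_mem hx]
  · intro j _ hj
    exact Set.indicator_of_notMem (Set.disjoint_right.mp (T.disjoint j i hj) hx) _
  · simp

theorem exists_isGlobalGenGradient (hp : 2 ≤ p) (hk : p ≤ k)
    {S : ∀ i, LinearMap.BilinForm ℝ ((T.elem i).VESpace p)} (hS : ∀ i, IsStabilisation (S i))
    (φ : T.globalSpace p) : ∃ G, IsGlobalGenGradient k S φ G := by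
  choose G hG using fun i => exists_isGenGradient hp hk (hS i) (localPart φ i)
  obtain ⟨F, hF⟩ := exists_restrictLp_eq T G
  refine ⟨F, fun i => ?_⟩
  rw [hF i]
  exact hG i

theorem IsGlobalGenGradient.globalForm_eq
    {S : ∀ i, LinearMap.BilinForm ℝ ((T.elem i).VESpace p)} (hS : ∀ i, IsStabilisation (S i))
    {φ : T.globalSpace p} {G : L2Vec Ω} (hG : IsGlobalGenGradient k S φ G) (v : T.globalSpace p) :
    globalForm S φ v = inner ℝ G (H1grad v.1) := by
  rw [T.inner_eq_sum, globalForm]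
  exact Finset.sum_congr rfl fun i _ => (hG i).localForm_eq (hS i) (localPart v i)

end PolygonalMesh

end VEM

end

theorem mainTheorem2
    (p : ℕ) (hp : 2 ≤ p) (k : ℕ) (hk : k = p ∨ k = p + 1)
    (Ω : Set Plane) (hΩ : IsOpen Ω) (T : PolygonalMesh Ω)
    (S : ∀ i, LinearMap.BilinForm ℝ ((T.elem i).VESpace p))
    (hS : ∀ i, IsStabilisation (S i)) :
    (∀ i, ∀ φ : (T.elem i).VESpace p,
      (∃! P, IsPiNabla (S i) φ P) ∧
      (∃ G, IsGenGradient k (S i) φ G) ∧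
      ∀ G, IsGenGradient k (S i) φ G →
        IsPiecewiseRT k G ∧
        ∀ v : (T.elem i).VESpace p, localForm (S i) φ v = inner ℝ G (grad v)) ∧
    (∀ φ : T.globalSpace p,
      (∃ G, IsGlobalGenGradient k S φ G) ∧
      ∀ G, IsGlobalGenGradient k S φ G →
        IsGlobalPiecewiseRT T k G ∧
        ∀ v : T.globalSpace p, globalForm S φ v = inner ℝ G (H1grad v.1)) := by
  have hk' : p ≤ k := by omega
  exact ⟨fun i φ => ⟨existsUnique_isPiNabla (hS i) φ, exists_isGenGradient hp hk' (hS i) φ,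
      fun _ hG => ⟨hG.isPiecewiseRT hk', hG.localForm_eq (hS i)⟩⟩,
    fun φ => ⟨exists_isGlobalGenGradient hp hk' hS φ,
      fun _ hG => ⟨fun i => (hG i).isPiecewiseRT hk', hG.globalForm_eq hS⟩⟩⟩
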